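/- **Theorem (formal Kuranishi theorem).** Let $\mathbb{K}$ be a field of characteristic zero. Graded spaces are $\mathbb{Z}$-graded $\mathbb{K}$-vector spaces $V=\bigoplus_k V^k$, and $V[1]^k=V^{k+1}$; all signs below are Koszul signs for the degrees in $V[1]$. *Setting.* A complete $L_\infty$ algebra $(V,F^\bullet V,Q)$ is a graded space $V$ with a descending filtration $V=F^1V\supset F^2V\supset\cdots$ by graded subspaces such that $V^k\to\varprojlim_p V^k/F^pV^k$ is bijective for all $k$, together with degree one maps $q_i:V[1]^{\odot i}\to V[1]$ ($i\ge1$) such that the induced coderivation $Q$ of $\overline S(V[1])$ satisfies $Q^2=0$ and $q_i(F^{p_1}V\odot\cdots\odot F^{p_i}V)\subset F^{p_1+\cdots+p_i}V$ for all $p_1,\dots,p_i\ge 1$. Let $(f_1,g_1,K)$ be a complete contraction of $(V[1],q_1)$ onto a dg space $(W[1],d_W)$: $f_1:W[1]\to V[1]$ and $g_1:V[1]\to W[1]$ are dg morphisms, $K:V[1]\to V[1]$ has degree $-1$, and $$g_1f_1=\mathrm{id}_W,\qquad Kq_1+q_1K=f_1g_1-\mathrm{id}_V,\qquad Kf_1=K^2=g_1K=0,$$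 and $K$ and $f_1g_1$ preserve the filtration of $V$. Put $F^pW=f_1^{-1}(F^pV)$. *Transfer.* Let $F^k_i:W[1]^{\odot i}\to V[1]^{\odot k}$ and $Q^k_i:V[1]^{\odot i}\to V[1]^{\odot k}$ be the components of the coalgebra morphism $F$ with Taylor coefficients $f_1,f_2,\dots$ and of the coderivation $Q$. Homotopy transfer defines, with $r_1=d_W$ and for $i\ge 2$, $$f_i=\sum_{k=2}^iKq_kF^k_i,\qquad r_i=\sum_{k=2}^i g_1q_kF^k_i,\qquad g_i=\sum_{k=1}^{i-1}g_kQ^k_iK^\Sigma_i,$$ $$K^\Sigma_i(v_1\odot\cdots\odot v_i)=\frac1{i!}\sum_{\sigma\in S_i}\sum_{j=1}^i\pm f_1g_1(v_{\sigma(1)})\odot\cdots\odot f_1g_1(v_{\sigma(j-1)})\odot K(v_{\sigma(j)})\odot v_{\sigma(j+1)}\odot\cdots\odot v_{\sigma(i)},$$ the transferred $L_\infty$ structure $R=(r_i)$ on $W$ and the $L_\infty$ morphisms $F=(f_i):(W,R)\to(V,Q)$ and $G=(g_i):(V,Q)\to(W,R)$. Let $$\mathrm{MC}(V)=\Big\{x\in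 V^1:\sum_{i\ge1}\tfrac1{i!}q_i(x^{\odot i})=0\Big\},\qquad \mathrm{MC}(W)=\Big\{y\in W^1:\sum_{i\ge1}\tfrac1{i!}r_i(y^{\odot i})=0\Big\},$$ $$\mathrm{MC}(F)(y)=\sum_{i\ge1}\tfrac1{i!}f_i(y^{\odot i}),\qquad \mathrm{MC}(G)(x)=\sum_{i\ge1}\tfrac1{i!}g_i(x^{\odot i}).$$ *Claim.* These series, and the one in the recursion below, converge in the topologies of the filtrations for all $x\in V^1$ and $y\in W^1$, and: 1. The map $\rho:\mathrm{MC}(V)\to\mathrm{MC}(W)\times K(V^1)$, $x\mapsto(\mathrm{MC}(G)(x),K(x))$, is well defined and bijective. 2. For $y\in\mathrm{MC}(W)$ and $v\in V^1$, the sequence in $V^1$ given by $x_0=0$ and $$x_{n+1}=f_1(y)-q_1K(v)+\sum_{i\ge2}\frac1{i!}\,(Kq_i-f_1g_i)(x_n^{\odot i})$$ converges, and its limit in $V^1$ is $\rho^{-1}(y,K(v))$. 3. $\rho^{-1}(y,0)=\mathrm{MC}(F)(y)$ for $y\in\mathrm{MC}(W)$, and $\mathrm{MC}(F)$ is a bijection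 from $\mathrm{MC}(W)$ onto $\mathrm{MC}(V)\cap\operatorname{Ker}K$, with inverse the restriction of $g_1$. -/

import Mathlib

namespace LInfty

universe u v w

noncomputable section

/-! ### Graded spaces and Koszul signs

A graded space is a module `V` with a decomposition `𝒱 : ℤ → Submodule 𝕜 V`, so that `𝒱 k` is
`V^k`. All multilinear maps below live on the desuspension `V[1]`, whose degree `k` part is
`V^{k+1}`; Koszul signs are computed with the degrees of `V[1]`. -/

section Graded

variable {𝕜 : Type u} [Field 𝕜] {V : Type v} [AddCommGroup V] [Module 𝕜 V]

/-- The grading of the desuspension: `V[1]^k = V^{k+1}`. -/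
def desusp (𝒱 : ℤ → Submodule 𝕜 V) : ℤ → Submodule 𝕜 V := fun k => 𝒱 (k + 1)

/-- The projection of `V[1]` onto its even part (`e = 0`) or its odd part (`e = 1`), parity being
that of the degree in `V[1]`: the summand `V^k = V[1]^{k-1}` is kept iff `k - 1 ≡ e` mod `2`. -/
def parityProj (𝒱 : ℤ → Submodule 𝕜 V) [DirectSum.Decomposition 𝒱] (e : ZMod 2) : V →ₗ[𝕜] V :=
  (DirectSum.toModule 𝕜 ℤ V fun k => if ((k - 1 : ℤ) : ZMod 2) = e then (𝒱 k).subtype else 0) ∘ₗ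
    (DirectSum.decomposeLinearEquiv 𝒱).toLinearMap

/-- The involution `v ↦ (-1)^{|v|} v` of `V[1]`. -/
def parityInv (𝒱 : ℤ → Submodule 𝕜 V) [DirectSum.Decomposition 𝒱] : V →ₗ[𝕜] V :=
  parityProj 𝒱 0 - parityProj 𝒱 1

/-- The Koszul sign `ε(σ)` in `v_1 ⊙ ⋯ ⊙ v_n = ε(σ) v_{σ(1)} ⊙ ⋯ ⊙ v_{σ(n)}`, where `v_i` has
degree of parity `e i`: one factor `-1` for each inversion of `σ` between two odd elements. -/
def koszulSign {n : ℕ} (e : Fin n → ZMod 2) (σ : Equiv.Perm (Fin n)) : ℤ :=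
  ∏ i : Fin n, ∏ j : Fin n,
    if i < j ∧ σ j < σ i ∧ e (σ i) = 1 ∧ e (σ j) = 1 then -1 else 1

/-- The multilinear map given on homogeneous elements of `V[1]` by
`(v_1, …, v_n) ↦ ε(σ) ϕ(v_{σ(1)}, …, v_{σ(n)})`. -/
def signedPerm (𝒱 : ℤ → Submodule 𝕜 V) [DirectSum.Decomposition 𝒱] {U : Type w} [AddCommGroup U]
    [Module 𝕜 U] {n : ℕ} (σ : Equiv.Perm (Fin n)) (ϕ : MultilinearMap 𝕜 (fun _ : Fin n => V) U) :
    MultilinearMap 𝕜 (fun _ : Fin n => V) U :=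
  ∑ e : Fin n → ZMod 2,
    koszulSign e σ • (ϕ.domDomCongr σ).compLinearMap fun i => parityProj 𝒱 (e i)

/-- A family of Taylor coefficients `ϕ_n : V[1]^{⊙ n} → U[1]`, `n ≥ 1`, as multilinear maps. Here
`V[1]` and `U[1]` have the same elements as `V` and `U`. The entry at `n = 0` is never used. -/
abbrev Taylor (𝕜 : Type u) [Field 𝕜] (V : Type v) [AddCommGroup V] [Module 𝕜 V]
    (U : Type w) [AddCommGroup U] [Module 𝕜 U] : Type (max v w) :=
  (n : ℕ) → MultilinearMap 𝕜 (fun _ : Fin n => V) U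

/-- The linear part `ϕ_1`. -/
def linearPart {U : Type w} [AddCommGroup U] [Module 𝕜 U] (ϕ : Taylor 𝕜 V U) : V →ₗ[𝕜] U :=
  (MultilinearMap.ofSubsingleton 𝕜 V U (0 : Fin 1)).symm (ϕ 1)

/-- A linear map as a multilinear map in one variable. -/
def toUnary {U : Type w} [AddCommGroup U] [Module 𝕜 U] (f : V →ₗ[𝕜] U) :
    MultilinearMap 𝕜 (fun _ : Fin 1 => V) U :=
  MultilinearMap.ofSubsingleton 𝕜 V U (0 : Fin 1) f

end Graded

/-! ### Coderivations, coalgebra morphisms and symmetrized homotopies -/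

section Coalgebra

variable {𝕜 : Type u} [Field 𝕜] {V : Type v} [AddCommGroup V] [Module 𝕜 V]

/-- `(j, m)`-unshuffles: permutations of `n = j + m` letters that are increasing on the first `j`
and on the last `m` letters. -/
def unshuffles (n j : ℕ) : Finset (Equiv.Perm (Fin n)) :=
  Finset.univ.filter fun σ => ∀ a b : Fin n, a < b → ((b : ℕ) < j ∨ j ≤ (a : ℕ)) → σ a < σ b

/-- `S(i_1, …, i_k)` for a composition `c = (i_1, …, i_k)` of `n`: permutations that are increasing
on each block of `c`. -/
def multiUnshuffles {n : ℕ} (c : Composition n) : Finset (Equiv.Perm (Fin n)) :=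
  Finset.univ.filter fun σ => ∀ a b : Fin n, a < b → c.index a = c.index b → σ a < σ b

/-- `(v_1, …, v_n) ↦ ϕ(ψ(v_1, …, v_j), v_{j+1}, …, v_n)`, where `n = j + m`. -/
def insertFirst {U : Type w} [AddCommGroup U] [Module 𝕜 U] {n j m : ℕ} (h : j + m = n)
    (ψ : MultilinearMap 𝕜 (fun _ : Fin j => V) V)
    (ϕ : MultilinearMap 𝕜 (fun _ : Fin (m + 1) => V) U) :
    MultilinearMap 𝕜 (fun _ : Fin n => V) U :=
  (MultilinearMap.uncurrySum (ϕ.curryLeft.compMultilinearMap ψ)).domDomCongr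
    (finSumFinEquiv.trans (finCongr h))

/-- The composite of `ϕ : V[1]^{⊙ (m+1)} → U` with the component
`Q^{m+1}_n : V[1]^{⊙ n} → V[1]^{⊙ (m+1)}`, `n = j + m`, of the coderivation `Q` with Taylor
coefficients `q`: on homogeneous elements,
`∑_{σ ∈ S(j, m)} ε(σ) ϕ(q_j(v_{σ(1)}, …, v_{σ(j)}), v_{σ(j+1)}, …, v_{σ(n)})`. -/
def compCoder (𝒱 : ℤ → Submodule 𝕜 V) [DirectSum.Decomposition 𝒱] {U : Type w} [AddCommGroup U]
    [Module 𝕜 U] {n j m : ℕ} (h : j + m = n)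
    (ϕ : MultilinearMap 𝕜 (fun _ : Fin (m + 1) => V) U)
    (qj : MultilinearMap 𝕜 (fun _ : Fin j => V) V) :
    MultilinearMap 𝕜 (fun _ : Fin n => V) U :=
  ∑ σ ∈ unshuffles n j, signedPerm 𝒱 σ (insertFirst h qj ϕ)

/-- `(w_1, …, w_n) ↦ ϕ(f_{i_1}(w_1, …, w_{i_1}), …, f_{i_k}(…, w_n))` for the composition
`c = (i_1, …, i_k)` of `n`. -/
def compBlocks {W : Type w} [AddCommGroup W] [Module 𝕜 W] {n : ℕ} (c : Composition n)
    (ϕ : MultilinearMap 𝕜 (fun _ : Fin c.length => V) V)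
    (f : (i : Fin c.length) → MultilinearMap 𝕜 (fun _ : Fin (c.blocksFun i) => W) V) :
    MultilinearMap 𝕜 (fun _ : Fin n => W) V :=
  (ϕ.compMultilinearMap f).domDomCongr c.blocksFinEquiv

/-- `1/k! ∑_{σ ∈ S(i_1, …, i_k)} ε(σ) ϕ(f_{i_1}(w_{σ(1)}, …), …, f_{i_k}(…, w_{σ(n)}))`, for the
composition `c = (i_1, …, i_k)` of `n`. The sum of these over all `c` with `k` blocks is the
composite of `ϕ` with the component `F^k_n : W[1]^{⊙ n} → V[1]^{⊙ k}` of the coalgebra morphism `F`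
with Taylor coefficients `f`. -/
def compMor {W : Type w} [AddCommGroup W] [Module 𝕜 W] (𝒲 : ℤ → Submodule 𝕜 W)
    [DirectSum.Decomposition 𝒲] {n : ℕ} (c : Composition n)
    (ϕ : MultilinearMap 𝕜 (fun _ : Fin c.length => V) V)
    (f : (i : Fin c.length) → MultilinearMap 𝕜 (fun _ : Fin (c.blocksFun i) => W) V) :
    MultilinearMap 𝕜 (fun _ : Fin n => W) V :=
  ((c.length.factorial : ℕ) : 𝕜)⁻¹ • ∑ σ ∈ multiUnshuffles c, signedPerm 𝒲 σ (compBlocks c ϕ f)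

/-- The composite of `ϕ : V[1]^{⊙ n} → U` with the symmetrized homotopy
`K^Σ_n(v_1 ⊙ ⋯ ⊙ v_n) = 1/n! ∑_σ ∑_j ± π v_{σ(1)} ⊙ ⋯ ⊙ π v_{σ(j-1)} ⊙ K v_{σ(j)} ⊙ v_{σ(j+1)} ⊙ ⋯`,
where `π = f₁ g₁` and `± = ε(σ) (-1)^{|v_{σ(1)}| + ⋯ + |v_{σ(j-1)}|}` because `K` has degree `-1`. -/
def compSymHtpy (𝒱 : ℤ → Submodule 𝕜 V) [DirectSum.Decomposition 𝒱] {U : Type w} [AddCommGroup U]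
    [Module 𝕜 U] (π K : V →ₗ[𝕜] V) {n : ℕ} (ϕ : MultilinearMap 𝕜 (fun _ : Fin n => V) U) :
    MultilinearMap 𝕜 (fun _ : Fin n => V) U :=
  ((n.factorial : ℕ) : 𝕜)⁻¹ • ∑ σ : Equiv.Perm (Fin n), ∑ j : Fin n,
    signedPerm 𝒱 σ (ϕ.compLinearMap fun i =>
      if i < j then π ∘ₗ parityInv 𝒱 else if i = j then K else LinearMap.id)

end Coalgebra

/-! ### Complete `L_∞` algebras -/

section Complete

variable {𝕜 : Type u} [Field 𝕜] {V : Type v} [AddCommGroup V] [Module 𝕜 V]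

/-- Convergence of a sequence in the topology of the filtration `F`. -/
def ConvergesTo (F : ℕ → Submodule 𝕜 V) (s : ℕ → V) (x : V) : Prop :=
  ∀ p : ℕ, ∃ N : ℕ, ∀ n ≥ N, s n - x ∈ F p

open Classical in
/-- The limit of a sequence, `0` if the sequence does not converge. -/
def limit (F : ℕ → Submodule 𝕜 V) (s : ℕ → V) : V :=
  if h : ∃ x, ConvergesTo F s x then h.choose else 0

/-- `(V, F^• V)` is a complete graded space: `F^1 V = V ⊇ F^2 V ⊇ ⋯` are graded subspaces, and
`V^k → lim_p V^k / F^p V^k` is bijective for each `k`. The index `p` starts at `1`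
(`F 0 = V` by `antitone` and `one`). -/
structure IsCompleteGraded (𝒱 : ℤ → Submodule 𝕜 V) [DirectSum.Decomposition 𝒱]
    (F : ℕ → Submodule 𝕜 V) : Prop where
  antitone : Antitone F
  one : F 1 = ⊤
  graded : ∀ p : ℕ, ∀ x ∈ F p, ∀ k : ℤ, ((DirectSum.decompose 𝒱 x k : 𝒱 k) : V) ∈ F p
  separated : ∀ k : ℤ, ∀ x ∈ 𝒱 k, (∀ p : ℕ, x ∈ F p) → x = 0
  complete : ∀ k : ℤ, ∀ s : ℕ → V, (∀ p, s p ∈ 𝒱 k) → (∀ p, s (p + 1) - s p ∈ F p) →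
    ∃ x ∈ 𝒱 k, ∀ p, s p - x ∈ F p

/-- `(V, F^• V, Q)` is a complete `L_∞` algebra, where `Q` has Taylor coefficients
`q_n : V[1]^{⊙ n} → V[1]`, `n ≥ 1`. -/
structure IsCompleteLInfty (𝒱 : ℤ → Submodule 𝕜 V) [DirectSum.Decomposition 𝒱]
    (F : ℕ → Submodule 𝕜 V) (q : Taylor 𝕜 V V) : Prop where
  completeGraded : IsCompleteGraded 𝒱 F
  /-- `q_n` is graded symmetric on `V[1]`. -/
  symm : ∀ n ≥ 1, ∀ (σ : Equiv.Perm (Fin n)) (d : Fin n → ℤ) (x : Fin n → V),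
    (∀ i, x i ∈ desusp 𝒱 (d i)) →
      q n x = koszulSign (fun i => (d i : ZMod 2)) σ • q n fun i => x (σ i)
  /-- `q_n` has degree one on `V[1]`. -/
  degree : ∀ n ≥ 1, ∀ (d : Fin n → ℤ) (x : Fin n → V),
    (∀ i, x i ∈ desusp 𝒱 (d i)) → q n x ∈ desusp 𝒱 (∑ i, d i + 1)
  /-- The coderivation `Q` squares to zero: the corestriction `∑_{k=1}^n q_k Q^k_n` of `Q ∘ Q`
  vanishes on `V[1]^{⊙ n}` for each `n`. In the sum, `k = m + 1` and `n = (j + 1) + m`. -/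
  sq_zero : ∀ n ≥ 1, ∑ j : Fin n,
    compCoder 𝒱 (n := n) (j := j + 1) (m := n - (j + 1)) (by omega)
      (q (n - (j + 1) + 1)) (q (j + 1)) = 0
  /-- `q_n(F^{p_1} ⊙ ⋯ ⊙ F^{p_n}) ⊆ F^{p_1 + ⋯ + p_n}`. -/
  continuous : ∀ n ≥ 1, ∀ (p : Fin n → ℕ) (x : Fin n → V),
    (∀ i, 1 ≤ p i) → (∀ i, x i ∈ F (p i)) → q n x ∈ F (∑ i, p i)

/-- The partial sums `∑_{i = a}^{N} 1/i! ϕ_i(x^{⊙ i})`. -/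
def expSum {U : Type w} [AddCommGroup U] [Module 𝕜 U] (ϕ : Taylor 𝕜 V U) (a : ℕ) (x : V) (N : ℕ) :
    U :=
  ∑ i ∈ Finset.Icc a N, ((i.factorial : ℕ) : 𝕜)⁻¹ • ϕ i fun _ => x

/-- The value `∑_{i ≥ 1} 1/i! ϕ_i(x^{⊙ i})`, in a space `U` with filtration `F`. For an `L_∞`
structure `ϕ` this is the curvature, for a morphism `ϕ` it is the push-forward. -/
def push {U : Type w} [AddCommGroup U] [Module 𝕜 U] (F : ℕ → Submodule 𝕜 U) (ϕ : Taylor 𝕜 V U)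
    (x : V) : U :=
  limit F (expSum ϕ 1 x)

/-- The Maurer-Cartan set: those `x ∈ V^1` with `∑_{i ≥ 1} 1/i! q_i(x^{⊙ i}) = 0`. -/
def MC (𝒱 : ℤ → Submodule 𝕜 V) (F : ℕ → Submodule 𝕜 V) (q : Taylor 𝕜 V V) : Set V :=
  {x | x ∈ 𝒱 1 ∧ ConvergesTo F (expSum q 1 x) 0}

end Complete

/-! ### Complete contractions and homotopy transfer -/

section Transfer

variable {𝕜 : Type u} [Field 𝕜] {V : Type v} [AddCommGroup V] [Module 𝕜 V]
  {W : Type w} [AddCommGroup W] [Module 𝕜 W]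

/-- `(f, g, K)` is a complete contraction of `(V[1], F^• V, dV)` onto `(W[1], dW)`. -/
structure IsCompleteContraction (𝒱 : ℤ → Submodule 𝕜 V) [DirectSum.Decomposition 𝒱]
    (F : ℕ → Submodule 𝕜 V) (dV : V →ₗ[𝕜] V) (𝒲 : ℤ → Submodule 𝕜 W) (dW : W →ₗ[𝕜] W)
    (f : W →ₗ[𝕜] V) (g : V →ₗ[𝕜] W) (K : V →ₗ[𝕜] V) : Prop where
  completeGraded : IsCompleteGraded 𝒱 F
  dV_degree : ∀ k, ∀ x ∈ 𝒱 k, dV x ∈ 𝒱 (k + 1)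
  dV_sq : dV ∘ₗ dV = 0
  dV_continuous : ∀ p, ∀ x ∈ F p, dV x ∈ F p
  dW_degree : ∀ k, ∀ y ∈ 𝒲 k, dW y ∈ 𝒲 (k + 1)
  dW_sq : dW ∘ₗ dW = 0
  f_degree : ∀ k, ∀ y ∈ 𝒲 k, f y ∈ 𝒱 k
  g_degree : ∀ k, ∀ x ∈ 𝒱 k, g x ∈ 𝒲 k
  K_degree : ∀ k, ∀ x ∈ 𝒱 k, K x ∈ 𝒱 (k - 1)
  f_comm : f ∘ₗ dW = dV ∘ₗ f
  g_comm : g ∘ₗ dV = dW ∘ₗ g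
  g_f : g ∘ₗ f = LinearMap.id
  homotopy : K ∘ₗ dV + dV ∘ₗ K = f ∘ₗ g - LinearMap.id
  K_f : K ∘ₗ f = 0
  K_K : K ∘ₗ K = 0
  g_K : g ∘ₗ K = 0
  K_continuous : ∀ p, ∀ x ∈ F p, K x ∈ F p
  fg_continuous : ∀ p, ∀ x ∈ F p, f (g x) ∈ F p

/-- The induced filtration `F^p W = f⁻¹(F^p V)`. -/
def inducedFiltration (F : ℕ → Submodule 𝕜 V) (f : W →ₗ[𝕜] V) : ℕ → Submodule 𝕜 W :=
  fun p => (F p).comap f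

theorem blocksFun_lt_of_two_le_length {n : ℕ} (c : Composition n) (hc : 2 ≤ c.length)
    (i : Fin c.length) : c.blocksFun i < n := by
  have hn : 0 < n := by
    have := c.length_le
    omega
  refine (Composition.ne_single_iff hn).1 ?_ i
  rintro rfl
  simp at hc

/-- The Taylor coefficients of the morphism `F : (W, R) → (V, Q)` of homotopy transfer:
`f_1 = f` and `f_n = ∑_{k=2}^n K q_k F^k_n` for `n ≥ 2`. -/
def transferF (𝒲 : ℤ → Submodule 𝕜 W) [DirectSum.Decomposition 𝒲] (q : Taylor 𝕜 V V)
    (f : W →ₗ[𝕜] V) (K : V →ₗ[𝕜] V) : Taylor 𝕜 W V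
  | 0 => 0
  | 1 => toUnary f
  | n + 2 => K.compMultilinearMap (∑ c : {c : Composition (n + 2) // 2 ≤ c.length},
      compMor 𝒲 c.1 (q c.1.length) fun i => transferF 𝒲 q f K (c.1.blocksFun i))
termination_by n => n
decreasing_by exact blocksFun_lt_of_two_le_length c.1 c.2 i

/-- The Taylor coefficients of the transferred `L_∞` structure `R` on `W`:
`r_1 = dW` and `r_n = ∑_{k=2}^n g q_k F^k_n` for `n ≥ 2`. -/
def transferR (𝒲 : ℤ → Submodule 𝕜 W) [DirectSum.Decomposition 𝒲] (q : Taylor 𝕜 V V)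
    (dW : W →ₗ[𝕜] W) (f : W →ₗ[𝕜] V) (g : V →ₗ[𝕜] W) (K : V →ₗ[𝕜] V) : Taylor 𝕜 W W
  | 0 => 0
  | 1 => toUnary dW
  | n + 2 => g.compMultilinearMap (∑ c : {c : Composition (n + 2) // 2 ≤ c.length},
      compMor 𝒲 c.1 (q c.1.length) fun i => transferF 𝒲 q f K (c.1.blocksFun i))

/-- The Taylor coefficients of the morphism `G : (V, Q) → (W, R)` of homotopy transfer:
`g_1 = g` and `g_n = ∑_{k=1}^{n-1} g_k Q^k_n K^Σ_n` for `n ≥ 2`. Below `n + 2` is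
written for `n`, the operation `Q^k_{n+2}` uses `q_{j+2}` with `0 ≤ j ≤ n`, and
`k = (n - j) + 1`. -/
def transferG (𝒱 : ℤ → Submodule 𝕜 V) [DirectSum.Decomposition 𝒱] (q : Taylor 𝕜 V V)
    (f : W →ₗ[𝕜] V) (g : V →ₗ[𝕜] W) (K : V →ₗ[𝕜] V) : Taylor 𝕜 V W
  | 0 => 0
  | 1 => toUnary g
  | n + 2 => ∑ j : Fin (n + 1), compSymHtpy 𝒱 (f ∘ₗ g) K
      (compCoder 𝒱 (j := j + 2) (m := n - j) (by omega)
        (transferG 𝒱 q f g K (n - j + 1)) (q (j + 2)))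
termination_by n => n
decreasing_by omega

/-- The Taylor coefficients `K q_i - f g_i` of the recursion. -/
def recTaylor (𝒱 : ℤ → Submodule 𝕜 V) [DirectSum.Decomposition 𝒱] (q : Taylor 𝕜 V V)
    (f : W →ₗ[𝕜] V) (g : V →ₗ[𝕜] W) (K : V →ₗ[𝕜] V) : Taylor 𝕜 V V :=
  fun i => K.compMultilinearMap (q i) - f.compMultilinearMap (transferG 𝒱 q f g K i)

/-- The sequence `x_0 = 0`,
`x_{n+1} = f(y) - q_1(z) + ∑_{i ≥ 2} 1/i! (K q_i - f g_i)(x_n^{⊙ i})`. -/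
def recSeq (𝒱 : ℤ → Submodule 𝕜 V) [DirectSum.Decomposition 𝒱] (F : ℕ → Submodule 𝕜 V)
    (q : Taylor 𝕜 V V) (f : W →ₗ[𝕜] V) (g : V →ₗ[𝕜] W) (K : V →ₗ[𝕜] V) (y : W) (z : V) : ℕ → V
  | 0 => 0
  | n + 1 => f y - linearPart q z +
      limit F (expSum (recTaylor 𝒱 q f g K) 2 (recSeq 𝒱 F q f g K y z n))

end Transfer

end

end LInfty

namespace LInfty

universe u v w

set_option linter.unusedSectionVars false

open Function (update)

/-! ### Koszul signs -/

section Signs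

/-! Write Q(x), R(y), F(y), G(x) for the sums of the Taylor series at points of degree one in `V`
and `W`, and primes for derivatives. The theorem rests on a fixed point equation and on a curvature
identity. Both are handled through partial sums up to order M, compared modulo the M-th step of the
filtration.

Fixed point equation. By K q_1 + q_1 K = f g - 1, the equation x = f(y) - q_1 K x + ∑_{i≥2} (K q_i -
f g_i)(x^i)/i! says the same as K Q(x) + f(y - G(x)) = 0 (`fix_eq`, `isFix_iff`). Applying f g, and
using g K = 0 and g f = 1, splits it into G(x) = y and K Q(x) = 0 (`IsFix.push_eq`). With q_1 K v in
place of q_1 K x, applying K to the equation gives back K x = K v (`IsFix.K_eq`). The terms of order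
at least two raise the filtration, so the right side is a contraction and the recursion converges to
the only solution. A Maurer-Cartan element x solves the equation with data (G(x), K x), hence is
determined by these data. Conversely let x be a solution over a Maurer-Cartan element y, with
curvature c = Q(x). Then K c = 0; Q² = 0 gives the Bianchi identity Q'_x(c) = 0; and the curvature
identity gives G'_x(c) = R(y) = 0. The leading terms of the last two are q_1 c and g c, and c = f g
c - K q_1 c, so c moves up the filtration step by step and vanishes (`IsFix.mem_MC`).

Curvature identity: G'_x(Q(x)) = R(G(x)) (`expSum_coder_transferG`). The full morphism equations for
F and G are not needed; only this polynomial identity on `V^1` is. Let D be the difference of its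
two sides. Two properties of the symmetrized homotopy (`evenDer_compSymHtpy`, `oddDer_compSymHtpy`)
imply that K, acting as an odd derivation, annihilates both G and G Q (`oddDer_transferG`,
`oddDer_coder_transferG`). Together with Q² = 0 this shows that G and G Q have zero derivative along
the vector field L(x) = Q'_x(K x) + K Q(x), hence so has D. The linear part of L is f g - 1, that is
-p for the projection p = 1 - f g. On the image of F, where K vanishes and G reduces to g, D
vanishes by the very definition of F and R; this image is tangent at 0 to f g(V^1) = Ker p. So the
lowest homogeneous component of D is constant along the image of p and zero on its kernel, hence
zero, and induction on the order gives D = 0 (`polyMap_eq_zero`).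

For v = 0, F(y) itself solves the fixed point equation (`push_transferF`), and G agrees with g on
Ker K (`g_eq_push`); this is the last claim. -/

/-- A product over pairs `i < j` of a symmetric function is invariant under permutations. -/
theorem prod_lt_comp_perm {n : ℕ} (F : Fin n → Fin n → ℤ) (hF : ∀ a b, F a b = F b a)
    (τ : Equiv.Perm (Fin n)) :
    (∏ i, ∏ j, if i < j then F (τ i) (τ j) else 1) = ∏ i, ∏ j, if i < j then F i j else 1 := by
  have h1 : (∏ i, ∏ j, if i < j then F (τ i) (τ j) else 1) =
      ∏ a, ∏ b, if τ.symm a < τ.symm b then F a b else 1 := by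
    symm
    rw [← Equiv.prod_comp τ]
    refine Finset.prod_congr rfl fun i _ => ?_
    rw [← Equiv.prod_comp τ]
    simp only [Equiv.symm_apply_apply]
  have h2 : ∀ a b, (if τ.symm a < τ.symm b then F a b else 1) =
      (if a < b ∧ τ.symm a < τ.symm b then F a b else 1) *
        (if b < a ∧ τ.symm a < τ.symm b then F a b else 1) := by
    intro a b
    rcases lt_trichotomy a b with h | h | h
    · simp [h, h.not_gt]
    · simp [h]
    · simp [h, h.not_gt]
  rw [h1]
  simp_rw [h2, Finset.prod_mul_distrib]
  -- Renaming the indices in the factor over b < a folds it onto the pairs a < b, where the symmetry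
  -- of `F` makes the two halves complementary.
  rw [Finset.prod_comm (f := fun a b => if b < a ∧ τ.symm a < τ.symm b then F a b else 1),
    ← Finset.prod_mul_distrib]
  refine Finset.prod_congr rfl fun a _ => ?_
  rw [← Finset.prod_mul_distrib]
  refine Finset.prod_congr rfl fun b _ => ?_
  by_cases hab : a < b
  · have hne : τ.symm a ≠ τ.symm b := fun h => hab.ne (τ.symm.injective h)
    rcases lt_or_gt_of_ne hne with h | h
    · simp [hab, h, h.not_gt]
    · simp [hab, h, h.not_gt, hF a b]
  · simp [hab]

/-- The cocycle property of Koszul signs. -/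
theorem koszulSign_mul {n : ℕ} (e : Fin n → ZMod 2) (σ τ : Equiv.Perm (Fin n)) :
    koszulSign e (σ * τ) = koszulSign e σ * koszulSign (fun i => e (σ i)) τ := by
  -- The sign of an inversion of σ is symmetric in the two positions, so its product may be taken
  -- over τ-images of pairs. A pair is inverted by σ * τ iff exactly one of τ (on the pair) and σ
  -- (on its τ-image) inverts it.
  have h := prod_lt_comp_perm (fun i j => if (i < j ∧ σ j < σ i ∨ j < i ∧ σ i < σ j) ∧
    e (σ i) = 1 ∧ e (σ j) = 1 then -1 else 1) (fun a b => by congr 1; grind) τ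
  have h3 : koszulSign e σ = ∏ i, ∏ j, if i < j then
      (if (i < j ∧ σ j < σ i ∨ j < i ∧ σ i < σ j) ∧ e (σ i) = 1 ∧ e (σ j) = 1 then -1 else 1)
      else 1 := by
    refine Finset.prod_congr rfl fun a _ => Finset.prod_congr rfl fun b _ => ?_
    by_cases hab : a < b
    · simp [hab, hab.not_gt]
    · simp [hab]
  rw [h3, ← h]
  unfold koszulSign
  rw [← Finset.prod_mul_distrib]
  refine Finset.prod_congr rfl fun a _ => ?_
  rw [← Finset.prod_mul_distrib]
  refine Finset.prod_congr rfl fun b _ => ?_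
  by_cases hab : a < b
  · have hne : τ a ≠ τ b := fun h => hab.ne (τ.injective h)
    have hne2 : σ (τ a) ≠ σ (τ b) := fun h => hne (σ.injective h)
    simp only [hab, true_and, if_true, Equiv.Perm.mul_apply]
    by_cases h1 : e (σ (τ a)) = 1 <;> by_cases h2 : e (σ (τ b)) = 1 <;>
    rcases lt_or_gt_of_ne hne with h4 | h4 <;> rcases lt_or_gt_of_ne hne2 with h5 | h5 <;>
      simp [h1, h2, h4, h5, h4.not_gt, h5.not_gt]
  · simp [hab]

theorem koszulSign_mul_self {n : ℕ} (e : Fin n → ZMod 2) (σ : Equiv.Perm (Fin n)) :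
    koszulSign e σ * koszulSign e σ = 1 := by
  unfold koszulSign
  rw [← Finset.prod_mul_distrib]
  refine Finset.prod_eq_one fun a _ => ?_
  rw [← Finset.prod_mul_distrib]
  exact Finset.prod_eq_one fun b _ => by split_ifs <;> simp

theorem koszulSign_one {n : ℕ} (e : Fin n → ZMod 2) : koszulSign e 1 = 1 :=
  Finset.prod_eq_one fun a _ => Finset.prod_eq_one fun b _ => by
    rw [if_neg]
    rintro ⟨h1, h2, -⟩
    exact absurd h1 h2.not_gt

/-- The Koszul sign when at most the entries `σ i` and `σ j` are odd. -/
theorem koszulSign_two {n : ℕ} (e : Fin n → ZMod 2) (σ : Equiv.Perm (Fin n)) {i j : Fin n}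
    (hij : i < j) (he : ∀ k, e (σ k) = 1 → k = i ∨ k = j) :
    koszulSign e σ = if σ j < σ i ∧ e (σ i) = 1 ∧ e (σ j) = 1 then -1 else 1 := by
  unfold koszulSign
  rw [Finset.prod_eq_single i, Finset.prod_eq_single j]
  · simp [hij]
  · intro b _ hb
    rw [if_neg]
    rintro ⟨h1, -, -, h4⟩
    rcases he b h4 with rfl | rfl
    · exact lt_irrefl _ h1
    · exact hb rfl
  · simp
  · intro a _ ha
    refine Finset.prod_eq_one fun b _ => ?_
    rw [if_neg]
    rintro ⟨h1, -, h3, h4⟩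
    rcases he a h3 with rfl | rfl
    · exact ha rfl
    · rcases he b h4 with rfl | rfl
      · exact absurd h1 hij.not_gt
      · exact lt_irrefl _ h1
  · simp

/-- The Koszul sign is trivial when at most one entry is odd. -/
theorem koszulSign_eq_one {n : ℕ} (e : Fin n → ZMod 2) (σ : Equiv.Perm (Fin n)) (i : Fin n)
    (he : ∀ k, e k = 1 → k = i) : koszulSign e σ = 1 := by
  refine Finset.prod_eq_one fun a _ => Finset.prod_eq_one fun b _ => ?_
  rw [if_neg]
  rintro ⟨h1, -, h3, h4⟩
  have := (he _ h3).trans (he _ h4).symm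
  exact h1.ne (σ.injective this)

theorem koszulSign_even {n : ℕ} (e : Fin n → ZMod 2) (σ : Equiv.Perm (Fin n))
    (he : ∀ k, e k = 0) : koszulSign e σ = 1 := by
  refine Finset.prod_eq_one fun a _ => Finset.prod_eq_one fun b _ => ?_
  simp [he]

/-- The sign `(-1)^e`. -/
def zsign (e : ZMod 2) : ℤ := if e = 1 then -1 else 1

theorem zmod_two_cases (e : ZMod 2) : e = 0 ∨ e = 1 := by
  revert e; decide

theorem zsign_mul_self (e : ZMod 2) : zsign e * zsign e = 1 := by
  unfold zsign; split_ifs <;> simp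

/-- Changing the parity of the entry `σ j` changes the Koszul sign of `σ` by the difference of the
signs that an odd operator picks up on its way to position `j` of the permuted, and to position
`σ j` of the original sequence. -/
theorem koszulSign_flip {n : ℕ} (e e' : Fin n → ZMod 2) (σ : Equiv.Perm (Fin n)) (j : Fin n)
    (h : ∀ l, l ≠ σ j → e' l = e l) (h' : e' (σ j) = e (σ j) + 1) :
    koszulSign e σ * ∏ i, (if i < j then zsign (e (σ i)) else 1) =
      koszulSign e' σ * ∏ l, (if l < σ j then zsign (e l) else 1) := by
  -- Only pairs containing `σ j` see the change of parity. On such a pair exactly one of the two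
  -- parity functions counts the inversion, provided that the other entry is odd.
  have key : koszulSign e σ * koszulSign e' σ =
      (∏ i, if i < j ∧ σ j < σ i then zsign (e (σ i)) else 1) *
        ∏ i, if j < i ∧ σ i < σ j then zsign (e (σ i)) else 1 := by
    have : ∀ a b : Fin n,
        (if a < b ∧ σ b < σ a ∧ e (σ a) = 1 ∧ e (σ b) = 1 then (-1 : ℤ) else 1) *
        (if a < b ∧ σ b < σ a ∧ e' (σ a) = 1 ∧ e' (σ b) = 1 then (-1 : ℤ) else 1) =
        (if b = j then (if a < j ∧ σ j < σ a then zsign (e (σ a)) else 1) else 1) *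
        (if a = j then (if j < b ∧ σ b < σ j then zsign (e (σ b)) else 1) else 1) := by
      intro a b
      by_cases ha : a = j
      · by_cases hb : b = j
        · simp [ha, hb]
        · subst ha
          have := h (σ b) (fun hh => hb (σ.injective hh))
          rw [this, h']
          simp only [hb, if_false, one_mul, if_true]
          unfold zsign
          rcases zmod_two_cases (e (σ a)) with h1 | h1 <;>
          rcases zmod_two_cases (e (σ b)) with h2 | h2 <;> simp [h1, h2]
      · have h3 := h (σ a) (fun hh => ha (σ.injective hh))
        by_cases hb : b = j
        · subst hb
          rw [h3, h']
          simp only [ha, if_false, mul_one, if_true]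
          unfold zsign
          rcases zmod_two_cases (e (σ a)) with h1 | h1 <;>
          rcases zmod_two_cases (e (σ b)) with h2 | h2 <;> simp [h1, h2]
        · have h4 := h (σ b) (fun hh => hb (σ.injective hh))
          rw [h3, h4]
          simp only [ha, hb, if_false, mul_one]
          split_ifs <;> simp
    unfold koszulSign
    rw [← Finset.prod_mul_distrib]
    simp_rw [← Finset.prod_mul_distrib, this]
    simp_rw [Finset.prod_mul_distrib]
    congr 1
    · refine Finset.prod_congr rfl fun a _ => ?_
      rw [Finset.prod_ite_eq' Finset.univ j]
      simp
    · rw [Finset.prod_comm]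
      refine Finset.prod_congr rfl fun a _ => ?_
      rw [Finset.prod_ite_eq' Finset.univ j]
      simp
  have h2 : (∏ l, (if l < σ j then zsign (e l) else 1)) =
      ∏ i, (if σ i < σ j then zsign (e (σ i)) else 1) :=
    (Equiv.prod_comp σ fun l => if l < σ j then zsign (e l) else 1).symm
  have h3 : (∏ i, (if i < j then zsign (e (σ i)) else 1)) *
      (∏ i, (if σ i < σ j then zsign (e (σ i)) else 1)) =
      (∏ i, if i < j ∧ σ j < σ i then zsign (e (σ i)) else 1) *
        ∏ i, if j < i ∧ σ i < σ j then zsign (e (σ i)) else 1 := by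
    rw [← Finset.prod_mul_distrib, ← Finset.prod_mul_distrib]
    refine Finset.prod_congr rfl fun i _ => ?_
    rcases lt_trichotomy i j with h4 | h4 | h4
    · have hne : σ i ≠ σ j := fun hh => h4.ne (σ.injective hh)
      rcases lt_or_gt_of_ne hne with h5 | h5 <;>
        simp [h4, h5, h4.not_gt, h5.not_gt, zsign_mul_self]
    · simp [h4]
    · have hne : σ i ≠ σ j := fun hh => h4.ne' (σ.injective hh)
      rcases lt_or_gt_of_ne hne with h5 | h5 <;>
        simp [h4, h5, h4.not_gt, h5.not_gt]
  have h4 : (∏ i, (if σ i < σ j then zsign (e (σ i)) else 1)) *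
      (∏ i, (if σ i < σ j then zsign (e (σ i)) else 1)) = 1 := by
    rw [← Finset.prod_mul_distrib]
    exact Finset.prod_eq_one fun i _ => by split_ifs <;> simp [zsign_mul_self]
  rw [h2]
  have h5 := koszulSign_mul_self e' σ
  set A := koszulSign e σ
  set B := koszulSign e' σ
  set X := ∏ i, (if i < j then zsign (e (σ i)) else 1)
  set Y := ∏ i, (if σ i < σ j then zsign (e (σ i)) else 1)
  rw [← h3] at key
  have hX : X * X = 1 := by
    rw [← Finset.prod_mul_distrib]
    exact Finset.prod_eq_one fun i _ => by split_ifs <;> simp [zsign_mul_self]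
  calc A * X = A * (B * B) * X := by rw [h5]; ring
    _ = (A * B) * B * X := by ring
    _ = B * Y * (X * X) := by rw [key]; ring
    _ = B * Y := by rw [hX]; ring

end Signs

/-! ### Graded multilinear maps -/

section GradedMultilinear

variable {𝕜 : Type u} [Field 𝕜] {V : Type v} [AddCommGroup V] [Module 𝕜 V]
  (𝒱 : ℤ → Submodule 𝕜 V) [DirectSum.Decomposition 𝒱]
  {U : Type w} [AddCommGroup U] [Module 𝕜 U]

theorem parityProj_of_mem {k : ℤ} {x : V} (hx : x ∈ 𝒱 k) (e : ZMod 2) :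
    parityProj 𝒱 e x = if ((k - 1 : ℤ) : ZMod 2) = e then x else 0 := by
  unfold parityProj
  simp only [LinearMap.comp_apply, LinearEquiv.coe_coe, DirectSum.decomposeLinearEquiv_apply]
  rw [DirectSum.decompose_of_mem 𝒱 hx]
  rw [← DirectSum.lof_eq_of 𝕜, DirectSum.toModule_lof]
  split_ifs <;> simp

theorem parityProj_of_mem_desusp {d : ℤ} {x : V} (hx : x ∈ desusp 𝒱 d) (e : ZMod 2) :
    parityProj 𝒱 e x = if (d : ZMod 2) = e then x else 0 := by
  have := parityProj_of_mem 𝒱 (show x ∈ 𝒱 (d + 1) from hx) e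
  simpa using this

theorem parityInv_of_mem_desusp {d : ℤ} {x : V} (hx : x ∈ desusp 𝒱 d) :
    parityInv 𝒱 x = zsign (d : ZMod 2) • x := by
  unfold parityInv zsign
  rw [LinearMap.sub_apply, parityProj_of_mem_desusp 𝒱 hx, parityProj_of_mem_desusp 𝒱 hx]
  rcases zmod_two_cases (d : ZMod 2) with h | h <;> simp [h]

/-- Of all parity assignments in the defining sum, only that of the actual degrees survives the
projections. -/
theorem signedPerm_apply {n : ℕ} (σ : Equiv.Perm (Fin n))
    (ϕ : MultilinearMap 𝕜 (fun _ : Fin n => V) U) (d : Fin n → ℤ) (x : Fin n → V)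
    (hx : ∀ i, x i ∈ desusp 𝒱 (d i)) :
    signedPerm 𝒱 σ ϕ x = koszulSign (fun i => (d i : ZMod 2)) σ • ϕ fun i => x (σ i) := by
  unfold signedPerm
  rw [sum_apply, Finset.sum_eq_single (fun i => (d i : ZMod 2))]
  · rw [smul_apply]
    congr 1
    rw [MultilinearMap.compLinearMap_apply, MultilinearMap.domDomCongr_apply]
    congr 1
    funext i
    simp [parityProj_of_mem_desusp 𝒱 (hx (σ i))]
  · intro e _ he
    obtain ⟨i, hi⟩ : ∃ i, e i ≠ d i := by
      by_contra! hcon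
      exact he (funext hcon)
    rw [smul_apply, MultilinearMap.compLinearMap_apply,
      MultilinearMap.domDomCongr_apply, MultilinearMap.map_coord_zero (i := σ.symm i), smul_zero]
    simp [parityProj_of_mem_desusp 𝒱 (hx i), hi.symm]
  · simp

theorem mem_span_desusp (x : V) : x ∈ Submodule.span 𝕜 {x | ∃ d, x ∈ desusp 𝒱 d} := by
  classical
  rw [← DirectSum.sum_support_decompose 𝒱 x]
  refine Submodule.sum_mem _ fun k _ => Submodule.subset_span ⟨k - 1, ?_⟩
  simp [desusp]

/-- A multilinear map vanishing on a product of sets vanishes on the product of their spans. -/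
theorem multilinear_eq_zero_of_span {ι : Type*} [Fintype ι] (φ : MultilinearMap 𝕜 (fun _ : ι => V) U)
    (s : ι → Set V) (h : ∀ v : ι → V, (∀ i, v i ∈ s i) → φ v = 0) (v : ι → V)
    (hv : ∀ i, v i ∈ Submodule.span 𝕜 (s i)) : φ v = 0 := by
  classical
  -- `S` is the set of slots already allowed to range over the span; enlarging it by one slot uses
  -- linearity in that slot alone.
  suffices H : ∀ (S : Finset ι) (v : ι → V), (∀ i ∈ S, v i ∈ Submodule.span 𝕜 (s i)) →
      (∀ i ∉ S, v i ∈ s i) → φ v = 0 from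
    H Finset.univ v (fun i _ => hv i) (by simp)
  intro S
  induction S using Finset.induction_on with
  | empty => exact fun v _ h2 => h v fun i => h2 i (by simp)
  | insert a S ha ih =>
    intro v h1 h2
    have key : ∀ x ∈ Submodule.span 𝕜 (s a), φ (Function.update v a x) = 0 := by
      intro x hx
      induction hx using Submodule.span_induction with
      | mem x hx =>
        refine ih _ (fun i hi => ?_) (fun i hi => ?_)
        · have : i ≠ a := fun h => ha (h ▸ hi)
          rw [Function.update_of_ne this]
          exact h1 i (Finset.mem_insert_of_mem hi)
        · by_cases hia : i = a
          · subst hia; simpa using hx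
          · rw [Function.update_of_ne hia]
            exact h2 i (by simp [hia, hi])
      | zero => simp
      | add x y _ _ hx hy => rw [MultilinearMap.map_update_add, hx, hy, add_zero]
      | smul c x _ hx => rw [MultilinearMap.map_update_smul, hx, smul_zero]
    simpa using key (v a) (h1 a (Finset.mem_insert_self _ _))

/-- Multilinear maps agreeing on homogeneous vectors are equal. -/
theorem multilinear_ext_homogeneous {n : ℕ} {φ ψ : MultilinearMap 𝕜 (fun _ : Fin n => V) U}
    (h : ∀ (d : Fin n → ℤ) (x : Fin n → V), (∀ i, x i ∈ desusp 𝒱 (d i)) → φ x = ψ x) : φ = ψ := by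
  ext v
  rw [← sub_eq_zero]
  refine multilinear_eq_zero_of_span (φ - ψ) (fun _ => {x | ∃ d, x ∈ desusp 𝒱 d}) ?_ v
    fun i => mem_span_desusp 𝒱 (v i)
  intro w hw
  choose d hd using hw
  exact sub_eq_zero.2 (h d w hd)

end GradedMultilinear

/-! ### The signed action of the symmetric group and graded symmetry -/

section Symmetric

variable {𝕜 : Type u} [Field 𝕜] {V : Type v} [AddCommGroup V] [Module 𝕜 V]
  (𝒱 : ℤ → Submodule 𝕜 V) [DirectSum.Decomposition 𝒱]
  {U : Type w} [AddCommGroup U] [Module 𝕜 U]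

/-- The cocycle identity of the Koszul sign is exactly what makes this an action, so that summing
over the group symmetrizes. -/
theorem signedPerm_mul {n : ℕ} (σ τ : Equiv.Perm (Fin n))
    (ϕ : MultilinearMap 𝕜 (fun _ : Fin n => V) U) :
    signedPerm 𝒱 σ (signedPerm 𝒱 τ ϕ) = signedPerm 𝒱 (σ * τ) ϕ := by
  refine multilinear_ext_homogeneous 𝒱 fun d x hx => ?_
  rw [signedPerm_apply 𝒱 σ _ d x hx, signedPerm_apply 𝒱 (σ * τ) _ d x hx,
    signedPerm_apply 𝒱 τ _ (fun i => d (σ i)) _ fun i => hx (σ i), smul_smul, koszulSign_mul]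
  rfl

theorem signedPerm_sum {n : ℕ} {ι : Type*} (s : Finset ι) (σ : Equiv.Perm (Fin n))
    (ϕ : ι → MultilinearMap 𝕜 (fun _ : Fin n => V) U) :
    signedPerm 𝒱 σ (∑ i ∈ s, ϕ i) = ∑ i ∈ s, signedPerm 𝒱 σ (ϕ i) := by
  refine multilinear_ext_homogeneous 𝒱 fun d x hx => ?_
  rw [signedPerm_apply 𝒱 σ _ d x hx, sum_apply, sum_apply, Finset.smul_sum]
  exact Finset.sum_congr rfl fun i _ => (signedPerm_apply 𝒱 σ _ d x hx).symm

theorem signedPerm_smul {n : ℕ} (c : 𝕜) (σ : Equiv.Perm (Fin n))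
    (ϕ : MultilinearMap 𝕜 (fun _ : Fin n => V) U) :
    signedPerm 𝒱 σ (c • ϕ) = c • signedPerm 𝒱 σ ϕ := by
  refine multilinear_ext_homogeneous 𝒱 fun d x hx => ?_
  rw [signedPerm_apply 𝒱 σ _ d x hx, smul_apply, smul_apply,
    signedPerm_apply 𝒱 σ _ d x hx, smul_comm]

/-- Graded symmetry of a multilinear map on `V[1]`. -/
def IsSym {n : ℕ} (ϕ : MultilinearMap 𝕜 (fun _ : Fin n => V) U) : Prop :=
  ∀ σ, signedPerm 𝒱 σ ϕ = ϕ

variable {𝒱}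

theorem IsSym.apply_perm {n : ℕ} {ϕ : MultilinearMap 𝕜 (fun _ : Fin n => V) U} (h : IsSym 𝒱 ϕ)
    (σ : Equiv.Perm (Fin n)) (d : Fin n → ℤ) (x : Fin n → V) (hx : ∀ i, x i ∈ desusp 𝒱 (d i)) :
    ϕ x = koszulSign (fun i => (d i : ZMod 2)) σ • ϕ fun i => x (σ i) := by
  rw [← signedPerm_apply 𝒱 σ ϕ d x hx, h σ]

theorem IsSym.sum {n : ℕ} {ι : Type*} (s : Finset ι)
    {ϕ : ι → MultilinearMap 𝕜 (fun _ : Fin n => V) U} (h : ∀ i ∈ s, IsSym 𝒱 (ϕ i)) :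
    IsSym 𝒱 (∑ i ∈ s, ϕ i) := fun σ => by
  rw [signedPerm_sum]
  exact Finset.sum_congr rfl fun i hi => h i hi σ

theorem IsSym.smul {n : ℕ} (c : 𝕜) {ϕ : MultilinearMap 𝕜 (fun _ : Fin n => V) U}
    (h : IsSym 𝒱 ϕ) : IsSym 𝒱 (c • ϕ) := fun σ => by
  rw [signedPerm_smul, h σ]

theorem isSym_of_subsingleton {n : ℕ} (hn : n ≤ 1) (ϕ : MultilinearMap 𝕜 (fun _ : Fin n => V) U) :
    IsSym 𝒱 ϕ := fun σ => by
  have : Subsingleton (Fin n) := by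
    interval_cases n <;> infer_instance
  refine multilinear_ext_homogeneous 𝒱 fun d x hx => ?_
  obtain rfl : σ = 1 := Subsingleton.elim _ _
  rw [signedPerm_apply 𝒱 _ _ d x hx, koszulSign_one, one_smul]
  rfl

variable (𝒱)

theorem isSym_sum_signedPerm {n : ℕ} (ϕ : MultilinearMap 𝕜 (fun _ : Fin n => V) U) :
    IsSym 𝒱 (∑ σ, signedPerm 𝒱 σ ϕ) := fun τ => by
  rw [signedPerm_sum]
  simp_rw [signedPerm_mul]
  exact Equiv.sum_comp (Equiv.mulLeft τ) fun σ => signedPerm 𝒱 σ ϕ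

theorem isSym_compSymHtpy (π K : V →ₗ[𝕜] V) {n : ℕ}
    (ϕ : MultilinearMap 𝕜 (fun _ : Fin n => V) U) : IsSym 𝒱 (compSymHtpy 𝒱 π K ϕ) := by
  unfold compSymHtpy
  rw [Finset.sum_comm]
  exact IsSym.smul _ (IsSym.sum _ fun j _ => isSym_sum_signedPerm 𝒱 _)

end Symmetric

/-! ### Unshuffles as coset representatives -/

section Cosets

/-- Summation over permutations through representatives: each permutation becomes an element of
`s` after composition with `ι h` for a unique `h`. -/
theorem sum_perm_eq_card_smul {n : ℕ} {H : Type*} [Fintype H] {A : Type*} [AddCommMonoid A]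
    (ι : H → Equiv.Perm (Fin n)) (s : Finset (Equiv.Perm (Fin n)))
    (hs : ∀ σ, ∃! h, σ * ι h ∈ s) (f : Equiv.Perm (Fin n) → A)
    (hf : ∀ σ h, f (σ * ι h) = f σ) : ∑ σ, f σ = Fintype.card H • ∑ σ ∈ s, f σ := by
  choose r hr hr' using hs
  rw [← Finset.card_univ, ← Finset.sum_const, Finset.sum_comm', Finset.sum_sigma']
  rotate_left
  · exact s
  · exact fun _ => Finset.univ
  · simp
  refine Finset.sum_bij' (fun σ _ => ⟨σ * ι (r σ), r σ⟩) (fun p _ => p.1 * (ι p.2)⁻¹) ?_ ?_ ?_ ?_ ?_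
  · intro σ _
    simpa using hr σ
  · simp
  · simp
  · rintro ⟨σ, h⟩ hp
    have h1 : σ ∈ s := by simpa using hp
    have h2 : r (σ * (ι h)⁻¹) = h := (hr' _ h (by simpa using h1)).symm
    simp [h2]
  · intro σ _
    exact (hf σ _).symm

/-- Sorting; injectivity excludes ties, so the stable sort is the only choice. -/
theorem existsUnique_strictMono_comp {k n : ℕ} (f : Fin k → Fin n) (hf : Function.Injective f) :
    ∃! ρ : Equiv.Perm (Fin k), StrictMono (f ∘ ρ) := by
  refine ⟨Tuple.sort f, (Tuple.monotone_sort f).strictMono_of_injective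
    (hf.comp (Tuple.sort f).injective), fun ρ hρ => ?_⟩
  rw [Tuple.eq_sort_iff]
  exact ⟨hρ.monotone, fun i j hij h => absurd h (hρ hij).ne⟩

/-- Permutations of two consecutive blocks. -/
def blockPerm (j m : ℕ) (h : Equiv.Perm (Fin j) × Equiv.Perm (Fin m)) : Equiv.Perm (Fin (j + m)) :=
  finSumFinEquiv.permCongr (Equiv.sumCongr h.1 h.2)

@[simp] theorem blockPerm_castAdd {j m : ℕ} (h : Equiv.Perm (Fin j) × Equiv.Perm (Fin m))
    (i : Fin j) : blockPerm j m h (Fin.castAdd m i) = Fin.castAdd m (h.1 i) := by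
  simp [blockPerm, Equiv.permCongr_apply]

@[simp] theorem blockPerm_natAdd {j m : ℕ} (h : Equiv.Perm (Fin j) × Equiv.Perm (Fin m))
    (i : Fin m) : blockPerm j m h (Fin.natAdd j i) = Fin.natAdd j (h.2 i) := by
  simp [blockPerm, Equiv.permCongr_apply]

theorem mem_unshuffles_iff {j m : ℕ} (σ : Equiv.Perm (Fin (j + m))) :
    σ ∈ unshuffles (j + m) j ↔
      StrictMono (σ ∘ Fin.castAdd m) ∧ StrictMono (σ ∘ Fin.natAdd j) := by
  simp only [unshuffles, Finset.mem_filter, Finset.mem_univ, true_and]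
  constructor
  · intro h
    exact ⟨fun a b hab => h _ _ (Fin.lt_def.2 hab) (Or.inl (by simp)),
      fun a b hab => h _ _ (by simpa using hab) (Or.inr (by simp))⟩
  · rintro ⟨h1, h2⟩ a b hab h
    induction a using Fin.addCases with
    | left a =>
      induction b using Fin.addCases with
      | left b => exact h1 (Fin.lt_def.2 hab)
      | right b => simp at h; omega
    | right a =>
      induction b using Fin.addCases with
      | left b => exact absurd hab (by simp [Fin.lt_def]; omega)
      | right b => exact h2 (by simpa using hab)

/-- Sort the values of σ on each of the two blocks. -/
theorem existsUnique_blockPerm {j m : ℕ} (σ : Equiv.Perm (Fin (j + m))) :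
    ∃! h, σ * blockPerm j m h ∈ unshuffles (j + m) j := by
  obtain ⟨ρ₁, h1, h1'⟩ := existsUnique_strictMono_comp (σ ∘ Fin.castAdd m)
    (σ.injective.comp (Fin.castAdd_injective j m))
  obtain ⟨ρ₂, h2, h2'⟩ := existsUnique_strictMono_comp (σ ∘ Fin.natAdd j)
    (σ.injective.comp (Fin.natAdd_injective m j))
  have e1 : ∀ h, (σ * blockPerm j m h : Equiv.Perm _) ∘ Fin.castAdd m =
      (σ ∘ Fin.castAdd m) ∘ h.1 := fun h => by funext i; simp
  have e2 : ∀ h, (σ * blockPerm j m h : Equiv.Perm _) ∘ Fin.natAdd j =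
      (σ ∘ Fin.natAdd j) ∘ h.2 := fun h => by funext i; simp
  refine ⟨(ρ₁, ρ₂), ?_, ?_⟩
  · simp only [mem_unshuffles_iff, e1, e2]
    exact ⟨h1, h2⟩
  · intro h
    simp only [mem_unshuffles_iff, e1, e2]
    rintro ⟨h3, h4⟩
    exact Prod.ext (h1' _ h3) (h2' _ h4)

/-- The coset count applied to the constant function 1. -/
theorem card_unshuffles (j m : ℕ) :
    (j + m).factorial = j.factorial * m.factorial * (unshuffles (j + m) j).card := by
  have := sum_perm_eq_card_smul (blockPerm j m) (unshuffles (j + m) j) existsUnique_blockPerm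
    (fun _ => 1) (fun _ _ => rfl)
  simpa [Fintype.card_perm] using this

/-- Permutations of the blocks of a composition. -/
def compositionPerm {n : ℕ} (c : Composition n)
    (h : (i : Fin c.length) → Equiv.Perm (Fin (c.blocksFun i))) : Equiv.Perm (Fin n) :=
  c.blocksFinEquiv.permCongr (Equiv.sigmaCongrRight h)

theorem compositionPerm_embedding {n : ℕ} (c : Composition n)
    (h : (i : Fin c.length) → Equiv.Perm (Fin (c.blocksFun i))) (i : Fin c.length)
    (a : Fin (c.blocksFun i)) :
    compositionPerm c h (c.embedding i a) = c.embedding i (h i a) := by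
  have : c.embedding i a = c.blocksFinEquiv ⟨i, a⟩ := rfl
  rw [this, compositionPerm, Equiv.permCongr_apply, Equiv.symm_apply_apply]
  rfl

theorem mem_multiUnshuffles_iff {n : ℕ} (c : Composition n) (σ : Equiv.Perm (Fin n)) :
    σ ∈ multiUnshuffles c ↔ ∀ i, StrictMono (σ ∘ c.embedding i) := by
  simp only [multiUnshuffles, Finset.mem_filter, Finset.mem_univ, true_and]
  constructor
  · intro h i a b hab
    exact h _ _ ((c.embedding i).strictMono hab) (by simp)
  · intro h a b hab hi
    have h1 := c.embedding_comp_inv a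
    have h2 := c.embedding_comp_inv b
    obtain ⟨i, hi'⟩ : ∃ i, c.index a = i := ⟨_, rfl⟩
    have ha : a ∈ Set.range (c.embedding i) := by rw [c.mem_range_embedding_iff', hi']
    have hb : b ∈ Set.range (c.embedding i) := by rw [c.mem_range_embedding_iff', ← hi, hi']
    obtain ⟨a', rfl⟩ := ha
    obtain ⟨b', rfl⟩ := hb
    exact h i ((c.embedding i).lt_iff_lt.1 hab)

theorem existsUnique_compositionPerm {n : ℕ} (c : Composition n) (σ : Equiv.Perm (Fin n)) :
    ∃! h, σ * compositionPerm c h ∈ multiUnshuffles c := by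
  have H := fun i => existsUnique_strictMono_comp (σ ∘ c.embedding i)
    (σ.injective.comp (c.embedding i).injective)
  choose ρ h1 h1' using H
  have e1 : ∀ h i, (σ * compositionPerm c h : Equiv.Perm _) ∘ c.embedding i =
      (σ ∘ c.embedding i) ∘ h i := fun h i => by
    funext a; simp [compositionPerm_embedding]
  refine ⟨ρ, ?_, ?_⟩
  · simp only [mem_multiUnshuffles_iff, e1]
    exact h1
  · intro h
    simp only [mem_multiUnshuffles_iff, e1]
    intro h3
    funext i
    exact h1' i _ (h3 i)

theorem card_multiUnshuffles {n : ℕ} (c : Composition n) :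
    n.factorial = (∏ i, (c.blocksFun i).factorial) * (multiUnshuffles c).card := by
  have := sum_perm_eq_card_smul (compositionPerm c) (multiUnshuffles c)
    (existsUnique_compositionPerm c) (fun _ => 1) (fun _ _ => rfl)
  simpa [Fintype.card_perm, Fintype.card_pi] using this

end Cosets

/-! ### Components of coderivations as symmetrizations -/

section CompCoder

variable {𝕜 : Type u} [Field 𝕜] {V : Type v} [AddCommGroup V] [Module 𝕜 V]
  {U : Type w} [AddCommGroup U] [Module 𝕜 U]

theorem insertFirst_apply {j m : ℕ} (ψ : MultilinearMap 𝕜 (fun _ : Fin j => V) V)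
    (ϕ : MultilinearMap 𝕜 (fun _ : Fin (m + 1) => V) U) (v : Fin (j + m) → V) :
    insertFirst rfl ψ ϕ v =
      ϕ (Fin.cons (ψ fun i => v (Fin.castAdd m i)) fun i => v (Fin.natAdd j i)) := by
  simp [insertFirst, MultilinearMap.uncurrySum, MultilinearMap.curryLeft]

/-- A multilinear map `V[1]^{⊗ n} → U[1]` of degree `k`. -/
def HasDeg (𝒱 : ℤ → Submodule 𝕜 V) (𝒰 : ℤ → Submodule 𝕜 U) {n : ℕ}
    (ϕ : MultilinearMap 𝕜 (fun _ : Fin n => V) U) (k : ℤ) : Prop :=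
  ∀ (d : Fin n → ℤ) (x : Fin n → V), (∀ i, x i ∈ desusp 𝒱 (d i)) → ϕ x ∈ desusp 𝒰 (∑ i, d i + k)

/-- No inversion occurs between letters of different blocks. -/
theorem koszulSign_blockPerm {j m : ℕ} (e : Fin (j + m) → ZMod 2)
    (h : Equiv.Perm (Fin j) × Equiv.Perm (Fin m)) :
    koszulSign e (blockPerm j m h) = koszulSign (fun i => e (Fin.castAdd m i)) h.1 *
      koszulSign (fun i => e (Fin.natAdd j i)) h.2 := by
  unfold koszulSign
  simp_rw [Fin.prod_univ_add, blockPerm_castAdd, blockPerm_natAdd]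
  have h1 : ∀ (a b : Fin j), (Fin.castAdd m a < Fin.castAdd m b) = (a < b) := fun a b => rfl
  have h2 : ∀ (a b : Fin m), (Fin.natAdd j a < Fin.natAdd j b) = (a < b) := fun a b => by simp
  have h3 : ∀ (a : Fin m) (b : Fin j), ¬ (Fin.natAdd j a < Fin.castAdd m b) := fun a b => by
    simp [Fin.lt_def]; omega
  simp_rw [h1, h2, h3]
  simp

/-- A permutation of the last `m` of `m + 1` letters. -/
def succPerm {m : ℕ} (h : Equiv.Perm (Fin m)) : Equiv.Perm (Fin (m + 1)) :=
  Equiv.Perm.decomposeFin.symm (0, h)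

@[simp] theorem succPerm_zero {m : ℕ} (h : Equiv.Perm (Fin m)) : succPerm h 0 = 0 := by
  simp [succPerm]

@[simp] theorem succPerm_succ {m : ℕ} (h : Equiv.Perm (Fin m)) (i : Fin m) :
    succPerm h i.succ = (h i).succ := by
  simp [succPerm]

theorem koszulSign_succPerm {m : ℕ} (e : Fin (m + 1) → ZMod 2) (h : Equiv.Perm (Fin m)) :
    koszulSign e (succPerm h) = koszulSign (fun i => e i.succ) h := by
  unfold koszulSign
  simp [Fin.prod_univ_succ]

variable (𝒱 : ℤ → Submodule 𝕜 V) [DirectSum.Decomposition 𝒱]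

/-- The two factors of the sign are absorbed separately: one by the symmetry of ψ, the other by the
symmetry of ϕ under permutations that fix its first slot. Homogeneity of ψ is what allows the
symmetry of ϕ to be used with the value of ψ in that slot. -/
theorem signedPerm_blockPerm_insertFirst {j m : ℕ} {ψ : MultilinearMap 𝕜 (fun _ : Fin j => V) V}
    {ϕ : MultilinearMap 𝕜 (fun _ : Fin (m + 1) => V) U} {k : ℤ} (hd : HasDeg 𝒱 𝒱 ψ k)
    (hψ : IsSym 𝒱 ψ) (hϕ : IsSym 𝒱 ϕ) (h : Equiv.Perm (Fin j) × Equiv.Perm (Fin m)) :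
    signedPerm 𝒱 (blockPerm j m h) (insertFirst rfl ψ ϕ) = insertFirst rfl ψ ϕ := by
  refine multilinear_ext_homogeneous 𝒱 fun d x hx => ?_
  rw [signedPerm_apply 𝒱 _ _ d x hx, insertFirst_apply, insertFirst_apply, koszulSign_blockPerm]
  have h1 := hψ.apply_perm h.1 (fun i => d (Fin.castAdd m i)) (fun i => x (Fin.castAdd m i))
    fun i => hx _
  set z := ψ fun i => x (Fin.castAdd m i) with hz
  have hzd : z ∈ desusp 𝒱 (∑ i, d (Fin.castAdd m i) + k) := hd _ _ fun i => hx _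
  have h2 := hϕ.apply_perm (succPerm h.2)
    (Fin.cons (∑ i, d (Fin.castAdd m i) + k) fun i => d (Fin.natAdd j i))
    (Fin.cons z fun i => x (Fin.natAdd j i)) (fun i => by
      refine Fin.cases ?_ (fun i => ?_) i
      · simpa using hzd
      · simpa using hx _)
  rw [h2, koszulSign_succPerm]
  have h3 : (fun i => (Fin.cons z (fun i => x (Fin.natAdd j i)) : Fin (m + 1) → V) (succPerm h.2 i))
      = Fin.cons z fun i => x (Fin.natAdd j (h.2 i)) := by
    funext i
    refine Fin.cases ?_ (fun i => ?_) i <;> simp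
  rw [h3]
  simp only [blockPerm_castAdd, blockPerm_natAdd, Fin.cons_succ]
  rw [h1]
  set ε₁ := koszulSign (fun i => ((d (Fin.castAdd m i) : ℤ) : ZMod 2)) h.1
  set y := ψ fun i => x (Fin.castAdd m (h.1 i))
  have h4 : ϕ (Fin.cons (ε₁ • y) fun i => x (Fin.natAdd j (h.2 i))) =
      ε₁ • ϕ (Fin.cons y fun i => x (Fin.natAdd j (h.2 i))) := by
    rw [← Int.cast_smul_eq_zsmul 𝕜, ← Int.cast_smul_eq_zsmul 𝕜, MultilinearMap.cons_smul]
  rw [h4, smul_smul, mul_comm]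

/-- `compCoder` as a sum over all permutations. -/
theorem sum_signedPerm_insertFirst {j m : ℕ} {ψ : MultilinearMap 𝕜 (fun _ : Fin j => V) V}
    {ϕ : MultilinearMap 𝕜 (fun _ : Fin (m + 1) => V) U} {k : ℤ} (hd : HasDeg 𝒱 𝒱 ψ k)
    (hψ : IsSym 𝒱 ψ) (hϕ : IsSym 𝒱 ϕ) :
    ∑ σ, signedPerm 𝒱 σ (insertFirst rfl ψ ϕ) =
      (j.factorial * m.factorial) • compCoder 𝒱 rfl ϕ ψ := by
  rw [sum_perm_eq_card_smul (blockPerm j m) (unshuffles (j + m) j) existsUnique_blockPerm]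
  · simp [Fintype.card_perm, compCoder]
  · intro σ h
    rw [← signedPerm_mul, signedPerm_blockPerm_insertFirst 𝒱 hd hψ hϕ]

/-- In characteristic zero the sum over unshuffles is a multiple of the sum over all permutations,
which is symmetric. -/
theorem isSym_compCoder [CharZero 𝕜] {n j m : ℕ} (h : j + m = n)
    {ψ : MultilinearMap 𝕜 (fun _ : Fin j => V) V}
    {ϕ : MultilinearMap 𝕜 (fun _ : Fin (m + 1) => V) U} {k : ℤ} (hd : HasDeg 𝒱 𝒱 ψ k)
    (hψ : IsSym 𝒱 ψ) (hϕ : IsSym 𝒱 ϕ) : IsSym 𝒱 (compCoder 𝒱 h ϕ ψ) := by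
  subst h
  have h1 := sum_signedPerm_insertFirst 𝒱 hd hψ hϕ
  have h2 : ((j.factorial * m.factorial : ℕ) : 𝕜) ≠ 0 := by
    exact_mod_cast (Nat.mul_pos j.factorial_pos m.factorial_pos).ne'
  rw [← Nat.cast_smul_eq_nsmul 𝕜] at h1
  have h3 : compCoder 𝒱 rfl ϕ ψ = ((j.factorial * m.factorial : ℕ) : 𝕜)⁻¹ •
      ∑ σ, signedPerm 𝒱 σ (insertFirst rfl ψ ϕ) := by
    rw [h1, smul_smul, inv_mul_cancel₀ h2, one_smul]
  rw [h3]
  exact (isSym_sum_signedPerm 𝒱 _).smul _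

end CompCoder

/-! ### Operators acting on one argument -/

section Spot

variable {𝕜 : Type u} [Field 𝕜] {V : Type v} [AddCommGroup V] [Module 𝕜 V]
  (𝒱 : ℤ → Submodule 𝕜 V) [DirectSum.Decomposition 𝒱]
  {U : Type w} [AddCommGroup U] [Module 𝕜 U]

/-- The composite of `ϕ` with `o_1 ⊗ ⋯ ⊗ D ⊗ ⋯ ⊗ o_n`, where the odd operator `D` is in position
`k`. -/
def spot {n : ℕ} (ϕ : MultilinearMap 𝕜 (fun _ : Fin n => V) U) (o : Fin n → V →ₗ[𝕜] V)
    (D : V →ₗ[𝕜] V) (k : Fin n) : MultilinearMap 𝕜 (fun _ : Fin n => V) U :=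
  ϕ.compLinearMap fun i => if i < k then o i ∘ₗ parityInv 𝒱 else if i = k then D else o i

theorem spot_apply {n : ℕ} (ϕ : MultilinearMap 𝕜 (fun _ : Fin n => V) U) (o : Fin n → V →ₗ[𝕜] V)
    (D : V →ₗ[𝕜] V) (k : Fin n) (d : Fin n → ℤ) (x : Fin n → V)
    (hx : ∀ i, x i ∈ desusp 𝒱 (d i)) :
    spot 𝒱 ϕ o D k x = (∏ l, if l < k then zsign (d l : ZMod 2) else 1) •
      ϕ fun l => if l = k then D (x l) else o l (x l) := by
  rw [← Int.cast_smul_eq_zsmul 𝕜, Int.cast_prod, ← MultilinearMap.map_smul_univ]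
  unfold spot
  rw [MultilinearMap.compLinearMap_apply]
  congr 1
  funext l
  rcases lt_trichotomy l k with h | h | h
  · simp [h, h.ne, parityInv_of_mem_desusp 𝒱 (hx l), Int.cast_smul_eq_zsmul]
  · simp [h]
  · simp [h.not_gt, h.ne']

/-- Permuting the arguments carries D from slot j to slot `σ j`. The Koszul sign must then be taken
with the parity of that entry changed by D, and `koszulSign_flip` shows that the discrepancy is the
difference of the signs collected by D on its way to the two slots. -/
theorem signedPerm_spot {n : ℕ} {ϕ : MultilinearMap 𝕜 (fun _ : Fin n => V) U} (hϕ : IsSym 𝒱 ϕ)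
    (o : Fin n → V →ₗ[𝕜] V) (ho : ∀ i k, ∀ x ∈ 𝒱 k, o i x ∈ 𝒱 k) (D : V →ₗ[𝕜] V) (r : ℤ)
    (hr : (r : ZMod 2) = 1) (hD : ∀ k, ∀ x ∈ 𝒱 k, D x ∈ 𝒱 (k + r)) (σ : Equiv.Perm (Fin n))
    (j : Fin n) :
    signedPerm 𝒱 σ (spot 𝒱 ϕ o D j) = spot 𝒱 ϕ (fun l => o (σ.symm l)) D (σ j) := by
  refine multilinear_ext_homogeneous 𝒱 fun d x hx => ?_
  rw [signedPerm_apply 𝒱 _ _ d x hx, spot_apply 𝒱 ϕ o D j (fun i => d (σ i)) _ fun i => hx (σ i),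
    spot_apply 𝒱 ϕ _ D (σ j) d x hx]
  have h1 := hϕ.apply_perm σ (fun l => if l = σ j then d l + r else d l)
    (fun l => if l = σ j then D (x l) else o (σ.symm l) (x l)) (fun l => by
      split_ifs with h
      · have := hD _ _ (hx l)
        simp only [desusp] at this ⊢
        convert this using 2
        ring
      · exact ho _ _ _ (hx l))
  rw [h1, smul_smul, smul_smul]
  have h2 := koszulSign_flip (fun i => (d i : ZMod 2))
    (fun l => ((if l = σ j then d l + r else d l : ℤ) : ZMod 2)) σ j
    (fun l hl => by simp [hl]) (by simp [hr])
  rw [h2, mul_comm]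
  congr 2
  funext i
  simp

/-- The sum of `1 ⊗ ⋯ ⊗ D ⊗ ⋯ ⊗ 1` over all positions of the odd operator `D`. -/
def oddDer {n : ℕ} (D : V →ₗ[𝕜] V) (ϕ : MultilinearMap 𝕜 (fun _ : Fin n => V) U) :
    MultilinearMap 𝕜 (fun _ : Fin n => V) U :=
  ∑ k, spot 𝒱 ϕ (fun _ => LinearMap.id) D k

/-- The sum of `1 ⊗ ⋯ ⊗ A ⊗ ⋯ ⊗ 1` over all positions of the even operator `A`. -/
def evenDer {n : ℕ} (A : V →ₗ[𝕜] V) (ϕ : MultilinearMap 𝕜 (fun _ : Fin n => V) U) :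
    MultilinearMap 𝕜 (fun _ : Fin n => V) U :=
  ∑ k, ϕ.compLinearMap fun i => if i = k then A else LinearMap.id

theorem evenDer_apply {n : ℕ} (A : V →ₗ[𝕜] V) (ϕ : MultilinearMap 𝕜 (fun _ : Fin n => V) U)
    (x : Fin n → V) : evenDer A ϕ x = ∑ k, ϕ (Function.update x k (A (x k))) := by
  rw [evenDer, sum_apply]
  refine Finset.sum_congr rfl fun k _ => ?_
  rw [MultilinearMap.compLinearMap_apply]
  congr 1
  funext i
  by_cases h : i = k
  · subst h; simp
  · simp [h]

theorem parityInv_parityInv (x : V) : parityInv 𝒱 (parityInv 𝒱 x) = x := by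
  have h := mem_span_desusp 𝒱 x
  induction h using Submodule.span_induction with
  | mem x hx =>
    obtain ⟨d, hd⟩ := hx
    rw [parityInv_of_mem_desusp 𝒱 hd, map_zsmul, parityInv_of_mem_desusp 𝒱 hd, smul_smul,
      zsign_mul_self, one_smul]
  | zero => simp
  | add x y _ _ hx hy => rw [map_add, map_add, hx, hy]
  | smul c x _ hx => rw [map_smul, map_smul, hx]

theorem parityInv_odd {D : V →ₗ[𝕜] V} {r : ℤ} (hr : (r : ZMod 2) = 1)
    (hD : ∀ k, ∀ x ∈ 𝒱 k, D x ∈ 𝒱 (k + r)) (x : V) :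
    parityInv 𝒱 (D x) = - D (parityInv 𝒱 x) := by
  have h := mem_span_desusp 𝒱 x
  induction h using Submodule.span_induction with
  | mem x hx =>
    obtain ⟨d, hd⟩ := hx
    have h1 : D x ∈ desusp 𝒱 (d + r) := by
      have := hD _ _ hd
      simp only [desusp] at this ⊢
      convert this using 2
      ring
    rw [parityInv_of_mem_desusp 𝒱 hd, map_zsmul, parityInv_of_mem_desusp 𝒱 h1]
    rcases zmod_two_cases (d : ZMod 2) with h | h <;> simp [zsign, h, hr]
  | zero => simp
  | add x y _ _ hx hy => rw [map_add, map_add, hx, hy, map_add, map_add, neg_add]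
  | smul c x _ hx => rw [map_smul, map_smul, hx, map_smul, map_smul, smul_neg]

theorem map_eq_neg {n : ℕ} (ϕ : MultilinearMap 𝕜 (fun _ : Fin n => V) U) (l : Fin n)
    (x y : Fin n → V) (hl : x l = - y l) (h : ∀ i, i ≠ l → x i = y i) : ϕ x = - ϕ y := by
  have h1 : x = Function.update y l ((-1 : 𝕜) • y l) := by
    funext i
    by_cases hi : i = l
    · subst hi; simpa using hl
    · simp [hi, h i hi]
  rw [h1, MultilinearMap.map_update_smul, Function.update_eq_self, neg_one_smul]

/-- Odd derivations anticommute up to the even derivation of the anticommutator. -/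
theorem oddDer_anticomm {n : ℕ} {D E : V →ₗ[𝕜] V}
    (hD : ∀ x, parityInv 𝒱 (D x) = - D (parityInv 𝒱 x))
    (hE : ∀ x, parityInv 𝒱 (E x) = - E (parityInv 𝒱 x))
    (ϕ : MultilinearMap 𝕜 (fun _ : Fin n => V) U) :
    oddDer 𝒱 D (oddDer 𝒱 E ϕ) + oddDer 𝒱 E (oddDer 𝒱 D ϕ) = evenDer (D ∘ₗ E + E ∘ₗ D) ϕ := by
  ext v
  rw [add_apply, evenDer_apply]
  have hX : ∀ D E : V →ₗ[𝕜] V, oddDer 𝒱 D (oddDer 𝒱 E ϕ) v = ∑ k, ∑ l,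
      ϕ fun i => (if i < l then parityInv 𝒱 else if i = l then E else LinearMap.id)
        ((if i < k then parityInv 𝒱 else if i = k then D else LinearMap.id) (v i)) := by
    intro D E
    simp only [oddDer, spot, sum_apply, MultilinearMap.compLinearMap_apply, LinearMap.id_comp]
  rw [hX, hX, Finset.sum_comm (f := fun k l => ϕ fun i =>
    (if i < l then parityInv 𝒱 else if i = l then D else LinearMap.id)
      ((if i < k then parityInv 𝒱 else if i = k then E else LinearMap.id) (v i))),
    ← Finset.sum_add_distrib]
  refine Finset.sum_congr rfl fun k _ => ?_
  -- Now D sits in slot k and E in slot l in both terms. For k ≠ l the two orders differ in a single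
  -- slot by an anticommutation with the parity involution, hence cancel; for k = l the involutions
  -- square to one and leave the anticommutator.
  rw [← Finset.sum_add_distrib, Finset.sum_eq_single k]
  · have h1 : ∀ D E : V →ₗ[𝕜] V,
        (fun i => (if i < k then parityInv 𝒱 else if i = k then E else LinearMap.id)
          ((if i < k then parityInv 𝒱 else if i = k then D else LinearMap.id) (v i))) =
        Function.update v k (E (D (v k))) := by
      intro D E
      funext i
      rcases lt_trichotomy i k with h | h | h
      · simp [h, h.ne, parityInv_parityInv]
      · subst h; simp
      · simp [h.not_gt, h.ne']
    rw [h1, h1, ← MultilinearMap.map_update_add]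
    simp [add_comm]
  · intro l _ hlk
    have h2 : ∀ i, i ≠ l → i ≠ k →
        (if i < l then parityInv 𝒱 else if i = l then E else LinearMap.id)
          ((if i < k then parityInv 𝒱 else if i = k then D else LinearMap.id) (v i)) =
        (if i < k then parityInv 𝒱 else if i = k then D else LinearMap.id)
          ((if i < l then parityInv 𝒱 else if i = l then E else LinearMap.id) (v i)) := by
      intro i hi hik
      simp only [hi, hik, if_false]
      split_ifs <;> rfl
    rcases lt_or_gt_of_ne hlk with h | h
    · refine eq_neg_iff_add_eq_zero.1 (map_eq_neg ϕ l _ _ ?_ fun i hi => ?_)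
      · simp [h, hE]
      · by_cases hik : i = k
        · subst hik
          simp [h.not_gt, h.ne']
        · exact h2 i hi hik
    · refine eq_neg_iff_add_eq_zero.1 (map_eq_neg ϕ k _ _ ?_ fun i hi => ?_)
      · simp [h, hD]
      · by_cases hil : i = l
        · subst hil
          simp [h.not_gt, h.ne']
        · exact h2 i hil hi
  · simp

/-! ### The symmetrized homotopy -/

/-- Each element of `s` comes first in the same number of orderings. -/
theorem card_mul_card_first {n : ℕ} (s : Finset (Fin n)) {k : Fin n} (hk : k ∈ s) :
    s.card * (Finset.univ.filter fun σ : Equiv.Perm (Fin n) => ∀ l ∈ s, σ k ≤ σ l).card =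
      n.factorial := by
  have h1 : ∀ k' ∈ s, (Finset.univ.filter fun σ : Equiv.Perm (Fin n) => ∀ l ∈ s, σ k' ≤ σ l).card =
      (Finset.univ.filter fun σ : Equiv.Perm (Fin n) => ∀ l ∈ s, σ k ≤ σ l).card := by
    intro k' hk'
    have hs : ∀ l ∈ s, Equiv.swap k k' l ∈ s := fun l hl => by
      rcases eq_or_ne l k with rfl | h1
      · simpa using hk'
      · rcases eq_or_ne l k' with rfl | h2
        · simpa using hk
        · rwa [Equiv.swap_apply_of_ne_of_ne h1 h2]
    refine Finset.card_bij' (fun σ _ => σ * Equiv.swap k k') (fun σ _ => σ * Equiv.swap k k')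
      ?_ ?_ ?_ ?_
    · intro σ hσ
      simp only [Finset.mem_filter, Finset.mem_univ, true_and, Equiv.Perm.mul_apply,
        Equiv.swap_apply_left] at hσ ⊢
      exact fun l hl => hσ _ (hs l hl)
    · intro σ hσ
      simp only [Finset.mem_filter, Finset.mem_univ, true_and, Equiv.Perm.mul_apply,
        Equiv.swap_apply_right] at hσ ⊢
      exact fun l hl => hσ _ (hs l hl)
    · intro σ _
      simp [mul_assoc]
    · intro σ _
      simp [mul_assoc]
  rw [← smul_eq_mul, ← Finset.sum_const, ← Finset.sum_congr rfl h1]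
  simp_rw [Finset.card_filter]
  rw [Finset.sum_comm]
  -- Double counting: in each ordering exactly one element of `s` comes first.
  have h2 : ∀ σ : Equiv.Perm (Fin n), ∑ k ∈ s, (if ∀ l ∈ s, σ k ≤ σ l then 1 else 0) = 1 := by
    intro σ
    obtain ⟨m, hm, hmin⟩ := s.exists_min_image σ ⟨k, hk⟩
    rw [Finset.sum_eq_single_of_mem m hm, if_pos hmin]
    intro b hb hbm
    rw [if_neg]
    exact fun hb' => hbm (σ.injective (le_antisymm (hb' m hm) (hmin b hb)))
  rw [Finset.sum_congr rfl fun σ _ => h2 σ]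
  simp [Fintype.card_perm]

section Htpy

variable {π K : V →ₗ[𝕜] V}

/-- By symmetry of ϕ the permutation can be undone: instead of permuting the vectors, π is applied
to those vectors that precede the k-th one in the ordering σ. -/
theorem compSymHtpy_eq {n : ℕ} {ϕ : MultilinearMap 𝕜 (fun _ : Fin n => V) U} (hϕ : IsSym 𝒱 ϕ)
    (hπ : ∀ k, ∀ x ∈ 𝒱 k, π x ∈ 𝒱 k) (hK : ∀ k, ∀ x ∈ 𝒱 k, K x ∈ 𝒱 (k - 1)) :
    compSymHtpy 𝒱 π K ϕ = ((n.factorial : ℕ) : 𝕜)⁻¹ • ∑ k : Fin n, ∑ σ : Equiv.Perm (Fin n),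
      spot 𝒱 ϕ (fun l => if σ l < σ k then π else LinearMap.id) K k := by
  unfold compSymHtpy
  congr 1
  rw [Finset.sum_comm (s := (Finset.univ : Finset (Fin n))),
    ← Equiv.sum_comp (Equiv.inv (Equiv.Perm (Fin n)))]
  refine Finset.sum_congr rfl fun σ _ => ?_
  rw [← Equiv.sum_comp σ]
  refine Finset.sum_congr rfl fun k _ => ?_
  have h1 : (ϕ.compLinearMap fun i => if i < σ k then π ∘ₗ parityInv 𝒱 else
      if i = σ k then K else LinearMap.id) =
      spot 𝒱 ϕ (fun i => if i < σ k then π else LinearMap.id) K (σ k) := by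
    unfold spot
    congr 1
    funext i
    by_cases h : i < σ k
    · simp [h]
    · simp [h]
  rw [h1, signedPerm_spot 𝒱 hϕ _ ?_ K (-1) (by decide) hK]
  · simp [Equiv.Perm.inv_def]
  · intro i k x hx
    split_ifs
    · exact hπ k x hx
    · exact hx

/-- On vectors each of which lies in the image or in the kernel of `π`, the symmetrized homotopy
is the derivation along `K` divided by the number of vectors in the kernel. -/
theorem card_smul_compSymHtpy [CharZero 𝕜] {n : ℕ}
    {ϕ : MultilinearMap 𝕜 (fun _ : Fin n => V) U} (hϕ : IsSym 𝒱 ϕ)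
    (hπ : ∀ k, ∀ x ∈ 𝒱 k, π x ∈ 𝒱 k) (hK : ∀ k, ∀ x ∈ 𝒱 k, K x ∈ 𝒱 (k - 1))
    (hKπ : ∀ x, K (π x) = 0) (d : Fin n → ℤ) (x : Fin n → V) (hx : ∀ i, x i ∈ desusp 𝒱 (d i))
    (s : Finset (Fin n)) (h1 : ∀ i ∈ s, π (x i) = 0) (h2 : ∀ i ∉ s, π (x i) = x i) :
    (s.card : 𝕜) • compSymHtpy 𝒱 π K ϕ x = oddDer 𝒱 K ϕ x ∧
      (s = ∅ → compSymHtpy 𝒱 π K ϕ x = 0) := by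
  have h3 : ∀ k ∉ s, ∀ o, spot 𝒱 ϕ o K k x = 0 := by
    intro k hk o
    rw [spot_apply 𝒱 _ _ _ _ d x hx, MultilinearMap.map_coord_zero (i := k), smul_zero]
    rw [if_pos rfl, ← h2 k hk, hKπ]
  -- The vectors preceding k are hit by π, which kills those in `s` and fixes the others. So a term
  -- survives only if k comes first among `s`, and then no π is visible.
  have h4 : ∀ k ∈ s, ∀ σ : Equiv.Perm (Fin n),
      spot 𝒱 ϕ (fun l => if σ l < σ k then π else LinearMap.id) K k x =
        if ∀ l ∈ s, σ k ≤ σ l then spot 𝒱 ϕ (fun _ => LinearMap.id) K k x else 0 := by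
    intro k hk σ
    rw [spot_apply 𝒱 _ _ _ _ d x hx, spot_apply 𝒱 _ _ _ _ d x hx]
    split_ifs with h
    · congr 2
      funext l
      by_cases hl : l ∈ s
      · simp [(h l hl).not_gt]
      · by_cases hlk : l = k
        · simp [hlk]
        · simp only [hlk, if_false]
          split_ifs <;> simp [h2 l hl]
    · push Not at h
      obtain ⟨l, hl, hlk⟩ := h
      have hne : l ≠ k := by rintro rfl; exact lt_irrefl _ hlk
      rw [MultilinearMap.map_coord_zero (i := l), smul_zero]
      simp [hne, hlk, h1 l hl]
  have h5 : compSymHtpy 𝒱 π K ϕ x = ((n.factorial : ℕ) : 𝕜)⁻¹ • ∑ k ∈ s,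
      ((Finset.univ.filter fun σ : Equiv.Perm (Fin n) => ∀ l ∈ s, σ k ≤ σ l).card : 𝕜) •
        spot 𝒱 ϕ (fun _ => LinearMap.id) K k x := by
    rw [compSymHtpy_eq 𝒱 hϕ hπ hK, smul_apply, sum_apply]
    congr 1
    rw [← Finset.sum_subset (Finset.subset_univ s)]
    · refine Finset.sum_congr rfl fun k hk => ?_
      rw [sum_apply, Finset.sum_congr rfl fun σ _ => h4 k hk σ, ← Finset.sum_filter,
        Finset.sum_const, Nat.cast_smul_eq_nsmul]
    · intro k _ hk
      rw [sum_apply]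
      exact Finset.sum_eq_zero fun σ _ => h3 k hk _
  refine ⟨?_, fun h => by rw [h5, h]; simp⟩
  rw [h5, oddDer, sum_apply, ← Finset.sum_subset (Finset.subset_univ s) fun k _ hk => h3 k hk _,
    Finset.smul_sum, Finset.smul_sum]
  refine Finset.sum_congr rfl fun k hk => ?_
  have h6 := congrArg (Nat.cast : ℕ → 𝕜) (card_mul_card_first s hk)
  have h7 : ((n.factorial : ℕ) : 𝕜) ≠ 0 := by exact_mod_cast n.factorial_ne_zero
  rw [smul_smul, smul_smul, mul_comm ((s.card : ℕ) : 𝕜), mul_assoc,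
    ← Nat.cast_mul, h6, inv_mul_cancel₀ h7, one_smul]

/-- Multilinear maps agreeing on vectors which are homogeneous and lie in the image or the kernel
of the idempotent `π` are equal. -/
theorem multilinear_ext_split {n : ℕ} {ϕ ψ : MultilinearMap 𝕜 (fun _ : Fin n => V) U}
    (hπ : ∀ k, ∀ x ∈ 𝒱 k, π x ∈ 𝒱 k) (hππ : ∀ x, π (π x) = π x)
    (h : ∀ (d : Fin n → ℤ) (x : Fin n → V) (s : Finset (Fin n)), (∀ i, x i ∈ desusp 𝒱 (d i)) →
      (∀ i ∈ s, π (x i) = 0) → (∀ i ∉ s, π (x i) = x i) → ϕ x = ψ x) : ϕ = ψ := by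
  classical
  refine multilinear_ext_homogeneous 𝒱 fun d x hx => ?_
  rw [← sub_eq_zero]
  refine multilinear_eq_zero_of_span (ϕ - ψ)
    (fun i => {x | x ∈ desusp 𝒱 (d i) ∧ (π x = 0 ∨ π x = x)}) ?_ x fun i => ?_
  · intro w hw
    refine sub_eq_zero.2 (h d w (Finset.univ.filter fun i => π (w i) = 0) (fun i => (hw i).1)
      (fun i hi => by simpa using hi) fun i hi => ?_)
    exact (hw i).2.resolve_left (by simpa using hi)
  · have h1 : x i = π (x i) + (x i - π (x i)) := by abel
    have h2 : π (x i) ∈ desusp 𝒱 (d i) := hπ _ _ (hx i)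
    rw [h1]
    exact Submodule.add_mem _ (Submodule.subset_span ⟨h2, Or.inr (hππ _)⟩)
      (Submodule.subset_span ⟨Submodule.sub_mem _ (hx i) h2, Or.inl (by simp [hππ])⟩)

variable [CharZero 𝕜] {n : ℕ} {ϕ : MultilinearMap 𝕜 (fun _ : Fin n => V) U} (hϕ : IsSym 𝒱 ϕ)
    (hπ : ∀ k, ∀ x ∈ 𝒱 k, π x ∈ 𝒱 k) (hK : ∀ k, ∀ x ∈ 𝒱 k, K x ∈ 𝒱 (k - 1))
    (hKπ : ∀ x, K (π x) = 0) (hππ : ∀ x, π (π x) = π x)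

include hϕ hπ hK hKπ hππ

/-- On split vectors the even derivation of 1 - π multiplies by the number of arguments in Ker π,
which is the number by which the symmetrized homotopy divides. -/
theorem evenDer_compSymHtpy :
    evenDer (LinearMap.id - π) (compSymHtpy 𝒱 π K ϕ) = oddDer 𝒱 K ϕ := by
  refine multilinear_ext_split 𝒱 hπ hππ fun d x s hx h1 h2 => ?_
  rw [← (card_smul_compSymHtpy 𝒱 hϕ hπ hK hKπ d x hx s h1 h2).1, evenDer_apply,
    ← Finset.sum_subset (Finset.subset_univ s)]
  · rw [Nat.cast_smul_eq_nsmul, ← Finset.sum_const]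
    refine Finset.sum_congr rfl fun k hk => ?_
    simp [h1 k hk]
  · intro k _ hk
    exact MultilinearMap.map_coord_zero _ k (by simp [h2 k hk])

/-- K maps into Ker π and thus preserves the number of arguments in Ker π. Up to this number, the
left side is the square of the odd derivation K, which vanishes because K² = 0. -/
theorem oddDer_compSymHtpy (hKK : ∀ x, K (K x) = 0) (hπK : ∀ x, π (K x) = 0) :
    oddDer 𝒱 K (compSymHtpy 𝒱 π K ϕ) = 0 := by
  refine multilinear_ext_split 𝒱 hπ hππ fun d x s hx h1 h2 => ?_
  have hodd := parityInv_odd 𝒱 (r := -1) (by decide) hK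
  have h0 : oddDer 𝒱 K (oddDer 𝒱 K ϕ) = 0 := by
    have h := oddDer_anticomm 𝒱 hodd hodd ϕ
    have h3 : K ∘ₗ K = 0 := LinearMap.ext hKK
    have h4 : evenDer (0 : V →ₗ[𝕜] V) ϕ = 0 := by
      ext v
      rw [evenDer_apply]
      exact Finset.sum_eq_zero fun k _ => MultilinearMap.map_coord_zero _ k (by simp)
    rw [h3, add_zero, h4, ← two_smul 𝕜] at h
    exact (smul_eq_zero.1 h).resolve_left two_ne_zero
  have h3 : ∀ k ∉ s, ∀ χ : MultilinearMap 𝕜 (fun _ : Fin n => V) U,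
      spot 𝒱 χ (fun _ => LinearMap.id) K k x = 0 := by
    intro k hk χ
    rw [spot_apply 𝒱 _ _ _ _ d x hx, MultilinearMap.map_coord_zero (i := k), smul_zero]
    rw [if_pos rfl, ← h2 k hk, hKπ]
  have h4 : ∀ k ∈ s, (s.card : 𝕜) • spot 𝒱 (compSymHtpy 𝒱 π K ϕ) (fun _ => LinearMap.id) K k x =
      spot 𝒱 (oddDer 𝒱 K ϕ) (fun _ => LinearMap.id) K k x := by
    intro k hk
    rw [spot_apply 𝒱 _ _ _ _ d x hx, spot_apply 𝒱 _ _ _ _ d x hx, smul_comm]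
    congr 1
    refine (card_smul_compSymHtpy 𝒱 hϕ hπ hK hKπ (fun l => if l = k then d l - 1 else d l) _
      (fun l => ?_) s (fun l hl => ?_) fun l hl => ?_).1
    · split_ifs with h
      · have := hK _ _ (hx l)
        simp only [desusp] at this ⊢
        convert this using 2
        ring
      · exact hx l
    · split_ifs with h
      · exact hπK _
      · exact h1 l hl
    · have : l ≠ k := fun h => hl (h ▸ hk)
      simpa [this] using h2 l hl
  have h5 : (s.card : 𝕜) • oddDer 𝒱 K (compSymHtpy 𝒱 π K ϕ) x = 0 := by
    rw [oddDer, sum_apply, ← Finset.sum_subset (Finset.subset_univ s) fun k _ hk => h3 k hk _,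
      Finset.smul_sum, Finset.sum_congr rfl h4,
      Finset.sum_subset (Finset.subset_univ s) fun k _ hk => h3 k hk _, ← sum_apply]
    change oddDer 𝒱 K (oddDer 𝒱 K ϕ) x = 0
    rw [h0]; rfl
  -- For empty `s` one cannot divide by the count, but all vectors then lie in the image of π, where
  -- K vanishes.
  rcases s.eq_empty_or_nonempty with h | h
  · subst h
    rw [oddDer, sum_apply]
    exact Finset.sum_eq_zero fun k _ => h3 k (by simp) _
  · exact (smul_eq_zero.1 h5).resolve_left (by exact_mod_cast h.card_pos.ne')

end Htpy

end Spot

/-! ### Splitting off the linear part of a coderivation -/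

section LinearCoder

variable {𝕜 : Type u} [Field 𝕜] {V : Type v} [AddCommGroup V] [Module 𝕜 V]
  {U : Type w} [AddCommGroup U] [Module 𝕜 U]

theorem sum_perm_apply {n m : ℕ} (hn : n = m + 1) {A : Type*} [AddCommMonoid A] (a : Fin n)
    (f : Fin n → A) : ∑ σ : Equiv.Perm (Fin n), f (σ a) = m.factorial • ∑ k, f k := by
  subst hn
  have h1 : ∑ σ : Equiv.Perm (Fin (m + 1)), f (σ a) =
      ∑ σ : Equiv.Perm (Fin (m + 1)), f (σ 0) := by
    rw [← Equiv.sum_comp (Equiv.mulRight (Equiv.swap 0 a))]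
    simp
  rw [h1, ← Equiv.sum_comp (Equiv.Perm.decomposeFin (n := m)).symm, Fintype.sum_prod_type]
  simp [Fintype.card_perm, Finset.smul_sum]

/-- A (1, m)-unshuffle is determined by the image of its first letter. Both sides are compared with
the sum over all permutations, in which each image occurs m! times. -/
theorem sum_unshuffles_one {n m : ℕ} (h : 1 + m = n) [CharZero 𝕜] (a : Fin n)
    (ha : (a : ℕ) = 0) (f : Fin n → U) : ∑ σ ∈ unshuffles n 1, f (σ a) = ∑ k, f k := by
  subst h
  have h1 := sum_perm_eq_card_smul (blockPerm 1 m) (unshuffles (1 + m) 1) existsUnique_blockPerm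
    (fun σ => f (σ a)) (fun σ h => by
      have : a = Fin.castAdd m 0 := Fin.ext ha
      rw [this, Equiv.Perm.mul_apply, blockPerm_castAdd, Subsingleton.elim (h.1 0) 0])
  rw [sum_perm_apply (m := m) (by omega) a f] at h1
  simp only [Fintype.card_prod, Fintype.card_perm, Fintype.card_fin, Nat.factorial_one,
    one_mul] at h1
  rw [← Nat.cast_smul_eq_nsmul 𝕜, ← Nat.cast_smul_eq_nsmul 𝕜] at h1
  exact (smul_right_injective U (by exact_mod_cast m.factorial_ne_zero) h1).symm

theorem insertFirst_apply' {n j m : ℕ} (h : j + m = n)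
    (ψ : MultilinearMap 𝕜 (fun _ : Fin j => V) V)
    (ϕ : MultilinearMap 𝕜 (fun _ : Fin (m + 1) => V) U) (v : Fin n → V) :
    insertFirst h ψ ϕ v = ϕ (Fin.cons (ψ fun i => v (Fin.cast h (Fin.castAdd m i)))
      fun i => v (Fin.cast h (Fin.natAdd j i))) := by
  subst h
  exact insertFirst_apply ψ ϕ v

variable (𝒱 : ℤ → Submodule 𝕜 V) [DirectSum.Decomposition 𝒱]

/-- The component of a coderivation given by a unary operation is a derivation. -/
theorem compCoder_unary [CharZero 𝕜] {m : ℕ} (h : 1 + m = m + 1)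
    {ϕ : MultilinearMap 𝕜 (fun _ : Fin (m + 1) => V) U} (hϕ : IsSym 𝒱 ϕ)
    (q : MultilinearMap 𝕜 (fun _ : Fin 1 => V) V) (D : V →ₗ[𝕜] V) (hqD : ∀ x, q x = D (x 0))
    (r : ℤ) (hr : (r : ZMod 2) = 1) (hD : ∀ k, ∀ x ∈ 𝒱 k, D x ∈ 𝒱 (k + r)) :
    compCoder 𝒱 h ϕ q = oddDer 𝒱 D ϕ := by
  have h1 : insertFirst h q ϕ = spot 𝒱 ϕ (fun _ => LinearMap.id) D 0 := by
    ext v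
    rw [insertFirst_apply', spot, MultilinearMap.compLinearMap_apply, hqD]
    congr 1
    funext i
    refine Fin.cases ?_ (fun i => ?_) i
    · have : Fin.cast h (Fin.castAdd m (0 : Fin 1)) = 0 := Fin.ext rfl
      simp only [Fin.cons_zero, lt_irrefl, if_false, if_true]
      exact congrArg (fun a => D (v a)) this
    · have : Fin.cast h (Fin.natAdd 1 i) = i.succ := Fin.ext (by simp)
      rw [Fin.cons_succ, this]
      simp [Fin.succ_ne_zero]
  unfold compCoder oddDer
  rw [h1, ← sum_unshuffles_one (𝕜 := 𝕜) h 0 rfl]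
  refine Finset.sum_congr rfl fun σ _ => ?_
  rw [signedPerm_spot 𝒱 hϕ _ (fun _ _ x hx => hx) D r hr hD]

/-- The composite of the corestriction `ϕ` with the coderivation with Taylor coefficients `q`. -/
noncomputable def coder (ϕ : Taylor 𝕜 V U) (q : Taylor 𝕜 V V) : Taylor 𝕜 V U := fun n =>
  ∑ j : Fin n, compCoder 𝒱 (n := n) (j := j + 1) (m := n - (j + 1)) (by omega)
    (ϕ (n - (j + 1) + 1)) (q (j + 1))

/-- The part of `coder` that uses only the operations `q_j` with `j ≥ 2`. -/
noncomputable def coderPlus (ϕ : Taylor 𝕜 V U) (q : Taylor 𝕜 V V) (n : ℕ) :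
    MultilinearMap 𝕜 (fun _ : Fin (n + 1) => V) U :=
  ∑ j : Fin n, compCoder 𝒱 (j := j + 2) (m := n - 1 - j) (by omega)
      (ϕ (n - 1 - j + 1)) (q (j + 2))

/-- Absorbs the different natural subtractions that compute the same number of remaining arguments.
-/
theorem compCoder_congr {n j m m' : ℕ} (h : j + m = n) (h' : j + m' = n) (ϕ : Taylor 𝕜 V U)
    (q : MultilinearMap 𝕜 (fun _ : Fin j => V) V) :
    compCoder 𝒱 h (ϕ (m + 1)) q = compCoder 𝒱 h' (ϕ (m' + 1)) q := by
  obtain rfl : m = m' := by omega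
  rfl

/-- The summand of `q 1` is an odd derivation, for which a homotopy formula is available; the rest
is what defines the next coefficient of G. -/
theorem coder_succ [CharZero 𝕜] {ϕ : Taylor 𝕜 V U} {q : Taylor 𝕜 V V} {n : ℕ}
    (hϕ : IsSym 𝒱 (ϕ (n + 1)))
    (hq : ∀ k, ∀ x ∈ 𝒱 k, linearPart q x ∈ 𝒱 (k + 1)) :
    coder 𝒱 ϕ q (n + 1) = oddDer 𝒱 (linearPart q) (ϕ (n + 1)) + coderPlus 𝒱 ϕ q n := by
  unfold coder coderPlus
  rw [Fin.sum_univ_succ]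
  congr 1
  · refine compCoder_unary 𝒱 _ hϕ _ _ (fun x => ?_) 1 (by decide) hq
    change q 1 x = q 1 (fun _ => x 0)
    congr 1
    funext i
    rw [Subsingleton.elim i 0]
  · refine Finset.sum_congr rfl fun j _ => ?_
    have h1 : ((j.succ : Fin (n + 1)) : ℕ) + 1 = j + 2 := by simp
    exact compCoder_congr 𝒱 (by simp; omega) (by omega) ϕ (q (j + 2))

theorem compSymHtpy_sum {n : ℕ} {ι : Type*} (s : Finset ι) (π K : V →ₗ[𝕜] V)
    (ϕ : ι → MultilinearMap 𝕜 (fun _ : Fin n => V) U) :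
    compSymHtpy 𝒱 π K (∑ i ∈ s, ϕ i) = ∑ i ∈ s, compSymHtpy 𝒱 π K (ϕ i) := by
  have h : ∀ L : Fin n → V →ₗ[𝕜] V, (∑ i ∈ s, ϕ i).compLinearMap L =
      ∑ i ∈ s, (ϕ i).compLinearMap L := fun L => by
    ext v
    simp [sum_apply]
  unfold compSymHtpy
  simp_rw [h, signedPerm_sum]
  rw [← Finset.smul_sum]
  congr 1
  rw [Finset.sum_comm (s := s)]
  exact Finset.sum_congr rfl fun σ _ => Finset.sum_comm

end LinearCoder

/-! ### Degrees and filtrations -/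

section Classes

variable {𝕜 : Type u} [Field 𝕜] {V : Type v} [AddCommGroup V] [Module 𝕜 V]
  {U : Type w} [AddCommGroup U] [Module 𝕜 U]

/-- Compatibility of a multilinear map with filtrations. -/
def IsCont (F : ℕ → Submodule 𝕜 V) (F' : ℕ → Submodule 𝕜 U) {n : ℕ}
    (ϕ : MultilinearMap 𝕜 (fun _ : Fin n => V) U) : Prop :=
  ∀ (p : Fin n → ℕ) (x : Fin n → V), (∀ i, 1 ≤ p i) → (∀ i, x i ∈ F (p i)) → ϕ x ∈ F' (∑ i, p i)

variable {𝒱 : ℤ → Submodule 𝕜 V} [DirectSum.Decomposition 𝒱] {𝒰 : ℤ → Submodule 𝕜 U}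
  {F : ℕ → Submodule 𝕜 V} {F' : ℕ → Submodule 𝕜 U} {n : ℕ}

theorem parityProj_mem_filtration
    (hF : ∀ p : ℕ, ∀ x ∈ F p, ∀ k : ℤ, ((DirectSum.decompose 𝒱 x k : 𝒱 k) : V) ∈ F p)
    (e : ZMod 2) {p : ℕ} {x : V} (hx : x ∈ F p) : parityProj 𝒱 e x ∈ F p := by
  classical
  rw [← DirectSum.sum_support_decompose 𝒱 x, map_sum]
  refine Submodule.sum_mem _ fun k _ => ?_
  rw [parityProj_of_mem 𝒱 (SetLike.coe_mem _)]
  split_ifs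
  · exact hF p x hx k
  · exact zero_mem _

theorem parityInv_mem_filtration
    (hF : ∀ p : ℕ, ∀ x ∈ F p, ∀ k : ℤ, ((DirectSum.decompose 𝒱 x k : 𝒱 k) : V) ∈ F p)
    {p : ℕ} {x : V} (hx : x ∈ F p) : parityInv 𝒱 x ∈ F p :=
  Submodule.sub_mem _ (parityProj_mem_filtration hF _ hx) (parityProj_mem_filtration hF _ hx)

theorem parityInv_mem_grading {k : ℤ} {x : V} (hx : x ∈ 𝒱 k) : parityInv 𝒱 x ∈ 𝒱 k := by
  rw [parityInv_of_mem_desusp 𝒱 (d := k - 1) (by simpa [desusp] using hx)]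
  exact Submodule.smul_of_tower_mem _ _ hx

namespace HasDeg

theorem sum {ι : Type*} (s : Finset ι) {ϕ : ι → MultilinearMap 𝕜 (fun _ : Fin n => V) U} {k : ℤ}
    (h : ∀ i ∈ s, HasDeg 𝒱 𝒰 (ϕ i) k) : HasDeg 𝒱 𝒰 (∑ i ∈ s, ϕ i) k := fun d x hx => by
  rw [sum_apply]
  exact Submodule.sum_mem _ fun i hi => h i hi d x hx

theorem smul (c : 𝕜) {ϕ : MultilinearMap 𝕜 (fun _ : Fin n => V) U} {k : ℤ}
    (h : HasDeg 𝒱 𝒰 ϕ k) : HasDeg 𝒱 𝒰 (c • ϕ) k := fun d x hx =>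
  Submodule.smul_mem _ _ (h d x hx)

theorem zero (k : ℤ) : HasDeg 𝒱 𝒰 (0 : MultilinearMap 𝕜 (fun _ : Fin n => V) U) k :=
  fun _ _ _ => zero_mem _

theorem signedPerm {ϕ : MultilinearMap 𝕜 (fun _ : Fin n => V) U} {k : ℤ}
    (h : HasDeg 𝒱 𝒰 ϕ k) (σ : Equiv.Perm (Fin n)) : HasDeg 𝒱 𝒰 (signedPerm 𝒱 σ ϕ) k := by
  intro d x hx
  rw [signedPerm_apply 𝒱 σ ϕ d x hx, ← Equiv.sum_comp σ d]
  exact Submodule.smul_of_tower_mem _ _ (h (fun i => d (σ i)) _ fun i => hx (σ i))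

theorem insertFirst {j m : ℕ} (h : j + m = n) {ψ : MultilinearMap 𝕜 (fun _ : Fin j => V) V}
    {ϕ : MultilinearMap 𝕜 (fun _ : Fin (m + 1) => V) U} {k l : ℤ} (hψ : HasDeg 𝒱 𝒱 ψ k)
    (hϕ : HasDeg 𝒱 𝒰 ϕ l) : HasDeg 𝒱 𝒰 (insertFirst h ψ ϕ) (k + l) := by
  subst h
  intro d x hx
  rw [insertFirst_apply]
  have := hϕ (Fin.cons (∑ i, d (Fin.castAdd m i) + k) fun i => d (Fin.natAdd j i))
    (Fin.cons (ψ fun i => x (Fin.castAdd m i)) fun i => x (Fin.natAdd j i)) (fun i => by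
      refine Fin.cases ?_ (fun i => ?_) i
      · simpa using hψ _ _ fun i => hx _
      · simpa using hx _)
  rw [Fin.sum_univ_succ] at this
  simp only [Fin.cons_zero, Fin.cons_succ] at this
  rw [Fin.sum_univ_add]
  convert this using 1
  ring_nf

theorem compCoder {j m : ℕ} (h : j + m = n) {ψ : MultilinearMap 𝕜 (fun _ : Fin j => V) V}
    {ϕ : MultilinearMap 𝕜 (fun _ : Fin (m + 1) => V) U} {k l : ℤ} (hψ : HasDeg 𝒱 𝒱 ψ k)
    (hϕ : HasDeg 𝒱 𝒰 ϕ l) : HasDeg 𝒱 𝒰 (compCoder 𝒱 h ϕ ψ) (k + l) :=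
  sum _ fun σ _ => (insertFirst h hψ hϕ).signedPerm σ

theorem compSymHtpy {π K : V →ₗ[𝕜] V} {ϕ : MultilinearMap 𝕜 (fun _ : Fin n => V) U} {k : ℤ}
    (hϕ : HasDeg 𝒱 𝒰 ϕ k)
    (hπ : ∀ k, ∀ x ∈ 𝒱 k, π x ∈ 𝒱 k) (hK : ∀ k, ∀ x ∈ 𝒱 k, K x ∈ 𝒱 (k - 1)) :
    HasDeg 𝒱 𝒰 (compSymHtpy 𝒱 π K ϕ) (k - 1) := by
  refine smul _ (sum _ fun σ _ => sum _ fun j _ => signedPerm (fun d x hx => ?_) σ)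
  rw [MultilinearMap.compLinearMap_apply]
  have := hϕ (fun i => if i = j then d i - 1 else d i) (fun i => (if i < j then
    π ∘ₗ parityInv 𝒱 else if i = j then K else LinearMap.id) (x i)) (fun i => by
      rcases lt_trichotomy i j with h | h | h
      · simp only [h, h.ne, if_true, if_false]
        exact hπ _ _ (parityInv_mem_grading (hx i))
      · subst h
        simp only [lt_irrefl, if_false, if_true]
        have := hK _ _ (hx i)
        simp only [desusp] at this ⊢
        convert this using 2
        ring
      · simp only [h.not_gt, h.ne', if_false]
        exact hx i)
  convert this using 1
  have : ∀ i, (if i = j then d i - 1 else d i) = d i - if i = j then 1 else 0 := fun i => by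
    split_ifs <;> simp
  simp_rw [this, Finset.sum_sub_distrib]
  simp only [Finset.sum_ite_eq', Finset.mem_univ, if_true]
  ring_nf

end HasDeg

namespace IsCont

theorem sum {ι : Type*} (s : Finset ι) {ϕ : ι → MultilinearMap 𝕜 (fun _ : Fin n => V) U}
    (h : ∀ i ∈ s, IsCont F F' (ϕ i)) : IsCont F F' (∑ i ∈ s, ϕ i) := fun d x h1 hx => by
  rw [sum_apply]
  exact Submodule.sum_mem _ fun i hi => h i hi d x h1 hx

theorem smul (c : 𝕜) {ϕ : MultilinearMap 𝕜 (fun _ : Fin n => V) U}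
    (h : IsCont F F' ϕ) : IsCont F F' (c • ϕ) := fun d x h1 hx =>
  Submodule.smul_mem _ _ (h d x h1 hx)

theorem zero : IsCont F F' (0 : MultilinearMap 𝕜 (fun _ : Fin n => V) U) :=
  fun _ _ _ _ => zero_mem _

theorem signedPerm
    (hF : ∀ p : ℕ, ∀ x ∈ F p, ∀ k : ℤ, ((DirectSum.decompose 𝒱 x k : 𝒱 k) : V) ∈ F p)
    {ϕ : MultilinearMap 𝕜 (fun _ : Fin n => V) U} (h : IsCont F F' ϕ)
    (σ : Equiv.Perm (Fin n)) : IsCont F F' (signedPerm 𝒱 σ ϕ) := by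
  refine sum _ fun e _ => fun p x h1 hx => ?_
  rw [smul_apply, MultilinearMap.compLinearMap_apply, MultilinearMap.domDomCongr_apply,
    ← Equiv.sum_comp σ p]
  exact Submodule.smul_of_tower_mem _ _ (h (fun i => p (σ i)) _ (fun i => h1 _)
    fun i => parityProj_mem_filtration hF _ (hx (σ i)))

theorem insertFirst {j m : ℕ} (h : j + m = n) (hj : 1 ≤ j)
    {ψ : MultilinearMap 𝕜 (fun _ : Fin j => V) V}
    {ϕ : MultilinearMap 𝕜 (fun _ : Fin (m + 1) => V) U} (hψ : IsCont F F ψ)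
    (hϕ : IsCont F F' ϕ) : IsCont F F' (insertFirst h ψ ϕ) := by
  subst h
  intro p x h1 hx
  rw [insertFirst_apply]
  have := hϕ (Fin.cons (∑ i, p (Fin.castAdd m i)) fun i => p (Fin.natAdd j i))
    (Fin.cons (ψ fun i => x (Fin.castAdd m i)) fun i => x (Fin.natAdd j i)) (fun i => by
      refine Fin.cases ?_ (fun i => ?_) i
      · simp only [Fin.cons_zero]
        exact (h1 _).trans (Finset.single_le_sum (f := fun i => p (Fin.castAdd m i))
          (fun i _ => Nat.zero_le _) (Finset.mem_univ (⟨0, hj⟩ : Fin j)))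
      · simpa using h1 _) (fun i => by
      refine Fin.cases ?_ (fun i => ?_) i
      · simpa using hψ _ _ (fun i => h1 _) fun i => hx _
      · simpa using hx _)
  rw [Fin.sum_univ_succ] at this
  simp only [Fin.cons_zero, Fin.cons_succ] at this
  rwa [Fin.sum_univ_add]

theorem compCoder
    (hF : ∀ p : ℕ, ∀ x ∈ F p, ∀ k : ℤ, ((DirectSum.decompose 𝒱 x k : 𝒱 k) : V) ∈ F p)
    {j m : ℕ} (h : j + m = n) (hj : 1 ≤ j) {ψ : MultilinearMap 𝕜 (fun _ : Fin j => V) V}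
    {ϕ : MultilinearMap 𝕜 (fun _ : Fin (m + 1) => V) U} (hψ : IsCont F F ψ)
    (hϕ : IsCont F F' ϕ) : IsCont F F' (compCoder 𝒱 h ϕ ψ) :=
  sum _ fun σ _ => (insertFirst h hj hψ hϕ).signedPerm hF σ

theorem compSymHtpy
    (hF : ∀ p : ℕ, ∀ x ∈ F p, ∀ k : ℤ, ((DirectSum.decompose 𝒱 x k : 𝒱 k) : V) ∈ F p)
    {π K : V →ₗ[𝕜] V} {ϕ : MultilinearMap 𝕜 (fun _ : Fin n => V) U}
    (hϕ : IsCont F F' ϕ) (hπ : ∀ p, ∀ x ∈ F p, π x ∈ F p) (hK : ∀ p, ∀ x ∈ F p, K x ∈ F p) :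
    IsCont F F' (compSymHtpy 𝒱 π K ϕ) := by
  refine smul _ (sum _ fun σ _ => sum _ fun j _ => signedPerm hF (fun p x h1 hx => ?_) σ)
  rw [MultilinearMap.compLinearMap_apply]
  refine hϕ p _ h1 fun i => ?_
  split_ifs
  · exact hπ _ _ (parityInv_mem_filtration hF (hx i))
  · exact hK _ _ (hx i)
  · exact hx i

end IsCont

end Classes

/-! ### The morphism G and the derivation along K -/

section TransferG

variable {𝕜 : Type u} [Field 𝕜] [CharZero 𝕜]
    {V : Type v} [AddCommGroup V] [Module 𝕜 V] {W : Type w} [AddCommGroup W] [Module 𝕜 W]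
    {𝒱 : ℤ → Submodule 𝕜 V} [DirectSum.Decomposition 𝒱]
    {𝒲 : ℤ → Submodule 𝕜 W}
    {FV : ℕ → Submodule 𝕜 V} {q : Taylor 𝕜 V V}
    {dW : W →ₗ[𝕜] W} {f : W →ₗ[𝕜] V} {g : V →ₗ[𝕜] W} {K : V →ₗ[𝕜] V}

theorem IsCompleteLInfty.isSym (hq : IsCompleteLInfty 𝒱 FV q) (n : ℕ) (hn : 1 ≤ n) :
    IsSym 𝒱 (q n) := fun σ => by
  refine multilinear_ext_homogeneous 𝒱 fun d x hx => ?_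
  rw [signedPerm_apply 𝒱 σ _ d x hx]
  exact (hq.symm n hn σ d x hx).symm

theorem IsCompleteLInfty.hasDeg (hq : IsCompleteLInfty 𝒱 FV q) (n : ℕ) (hn : 1 ≤ n) :
    HasDeg 𝒱 𝒱 (q n) 1 := hq.degree n hn

theorem IsCompleteLInfty.isCont (hq : IsCompleteLInfty 𝒱 FV q) (n : ℕ) (hn : 1 ≤ n) :
    IsCont FV FV (q n) := hq.continuous n hn

theorem IsCompleteLInfty.coder_eq_zero (hq : IsCompleteLInfty 𝒱 FV q) (n : ℕ) :
    coder 𝒱 q q n = 0 := by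
  rcases n with - | n
  · simp [coder]
  · exact hq.sq_zero (n + 1) (by omega)

theorem transferG_add_two (n : ℕ) : transferG 𝒱 q f g K (n + 2) =
    compSymHtpy 𝒱 (f ∘ₗ g) K (coderPlus 𝒱 (transferG 𝒱 q f g K) q (n + 1)) := by
  rw [transferG, coderPlus, compSymHtpy_sum]
  rfl

variable (hc : IsCompleteContraction 𝒱 FV (linearPart q) 𝒲 dW f g K)

theorem IsCompleteContraction.fg_degree (hc : IsCompleteContraction 𝒱 FV (linearPart q) 𝒲 dW f g K)
    (k : ℤ) (x : V) (hx : x ∈ 𝒱 k) : (f ∘ₗ g) x ∈ 𝒱 k :=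
  hc.f_degree _ _ (hc.g_degree _ _ hx)

theorem IsCompleteContraction.K_K_apply
    (hc : IsCompleteContraction 𝒱 FV (linearPart q) 𝒲 dW f g K) (x : V) : K (K x) = 0 :=
  LinearMap.congr_fun hc.K_K x

theorem IsCompleteContraction.K_f_apply
    (hc : IsCompleteContraction 𝒱 FV (linearPart q) 𝒲 dW f g K) (y : W) : K (f y) = 0 :=
  LinearMap.congr_fun hc.K_f y

theorem IsCompleteContraction.g_K_apply
    (hc : IsCompleteContraction 𝒱 FV (linearPart q) 𝒲 dW f g K) (x : V) : g (K x) = 0 :=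
  LinearMap.congr_fun hc.g_K x

theorem IsCompleteContraction.g_f_apply
    (hc : IsCompleteContraction 𝒱 FV (linearPart q) 𝒲 dW f g K) (y : W) : g (f y) = y :=
  LinearMap.congr_fun hc.g_f y

theorem IsCompleteContraction.homotopy_apply
    (hc : IsCompleteContraction 𝒱 FV (linearPart q) 𝒲 dW f g K) (x : V) :
    K (linearPart q x) + linearPart q (K x) = f (g x) - x :=
  LinearMap.congr_fun hc.homotopy x

theorem isCont_toUnary {F : ℕ → Submodule 𝕜 V} {F' : ℕ → Submodule 𝕜 W} {A : V →ₗ[𝕜] W}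
    (h : ∀ p, ∀ x ∈ F p, A x ∈ F' p) : IsCont F F' (toUnary A) := fun p x _ hx => by
  simpa [toUnary] using h _ _ (hx 0)

theorem hasDeg_toUnary {𝒰 : ℤ → Submodule 𝕜 W} {A : V →ₗ[𝕜] W} {k : ℤ}
    (h : ∀ d, ∀ x ∈ 𝒱 d, A x ∈ 𝒰 (d + k)) : HasDeg 𝒱 𝒰 (toUnary A) k := fun d x hx => by
  have := h _ _ (hx 0)
  have h1 : toUnary A x = A (x 0) := rfl
  have h2 : ∑ i, d i + k + 1 = d 0 + 1 + k := by
    rw [Fin.sum_univ_one]; ring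
  simpa only [desusp, h1, h2] using this

variable (hq : IsCompleteLInfty 𝒱 FV q)

include hc in
theorem isSym_transferG (n : ℕ) : IsSym 𝒱 (transferG 𝒱 q f g K n) := by
  match n with
  | 0 => exact isSym_of_subsingleton (by simp) _
  | 1 => exact isSym_of_subsingleton (by simp) _
  | n + 2 =>
    rw [transferG_add_two]
    exact isSym_compSymHtpy 𝒱 _ _ _

include hc hq

theorem hasDeg_transferG (n : ℕ) : HasDeg 𝒱 𝒲 (transferG 𝒱 q f g K n) 0 := by
  induction n using Nat.strong_induction_on with
  | _ n ih =>
    match n with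
    | 0 => rw [transferG]; exact HasDeg.zero 0
    | 1 =>
      rw [transferG]
      exact hasDeg_toUnary fun d x hx => by simpa using hc.g_degree d x hx
    | n + 2 =>
      rw [transferG_add_two]
      have h : HasDeg 𝒱 𝒲 (coderPlus 𝒱 (transferG 𝒱 q f g K) q (n + 1)) (1 + 0) :=
        HasDeg.sum _ fun j _ => HasDeg.compCoder _ (hq.hasDeg _ (by omega)) (ih _ (by omega))
      simpa using h.compSymHtpy hc.fg_degree hc.K_degree

theorem isCont_transferG (n : ℕ) :
    IsCont FV (inducedFiltration FV f) (transferG 𝒱 q f g K n) := by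
  induction n using Nat.strong_induction_on with
  | _ n ih =>
    match n with
    | 0 => rw [transferG]; exact IsCont.zero
    | 1 =>
      rw [transferG]
      exact isCont_toUnary fun p x hx => hc.fg_continuous p x hx
    | n + 2 =>
      rw [transferG_add_two]
      refine IsCont.compSymHtpy hc.completeGraded.graded (IsCont.sum _ fun j _ =>
        IsCont.compCoder hc.completeGraded.graded _ (by omega) (hq.isCont _ (by omega))
          (ih _ (by omega))) hc.fg_continuous hc.K_continuous

theorem isSym_coderPlus (n : ℕ) : IsSym 𝒱 (coderPlus 𝒱 (transferG 𝒱 q f g K) q n) :=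
  IsSym.sum _ fun _ _ => isSym_compCoder 𝒱 _ (hq.hasDeg _ (by omega)) (hq.isSym _ (by omega))
    (isSym_transferG hc _)

/-- In arity one this is g K = 0; in higher arity it holds because the coefficient is composed with
the symmetrized homotopy. -/
theorem oddDer_transferG (n : ℕ) : oddDer 𝒱 K (transferG 𝒱 q f g K n) = 0 := by
  match n with
  | 0 => simp [oddDer]
  | 1 =>
    ext v
    rw [transferG, oddDer, sum_apply]
    simp [spot, toUnary, hc.g_K_apply]
  | n + 2 =>
    rw [transferG_add_two]
    exact oddDer_compSymHtpy 𝒱 (isSym_coderPlus hc hq _) hc.fg_degree hc.K_degree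
      (fun x => hc.K_f_apply _) (fun x => by simp [hc.g_f_apply]) hc.K_K_apply
      (fun x => by simp [hc.g_K_apply])

/-- Inverts the division hidden in the definition of G. In arity one both sides vanish: g(1 - f g) =
0, and the sum on the right is empty. -/
theorem evenDer_transferG (n : ℕ) :
    evenDer (LinearMap.id - f ∘ₗ g) (transferG 𝒱 q f g K (n + 1)) =
      oddDer 𝒱 K (coderPlus 𝒱 (transferG 𝒱 q f g K) q n) := by
  match n with
  | 0 =>
    ext v
    rw [evenDer_apply]
    simp [coderPlus, oddDer, spot, transferG, toUnary, hc.g_f_apply]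
  | n + 1 =>
    rw [transferG_add_two]
    exact evenDer_compSymHtpy 𝒱 (isSym_coderPlus hc hq _) hc.fg_degree hc.K_degree
      (fun x => hc.K_f_apply _) (fun x => by simp [hc.g_f_apply])

/-- Let the derivation K act on the two parts of G Q. On the linear part, anticommuting K past q_1
gives the even derivation of f g - 1 on G, since K annihilates G. On the remaining part
`evenDer_transferG` gives the even derivation of 1 - f g. The two cancel. -/
theorem oddDer_coder_transferG (n : ℕ) :
    oddDer 𝒱 K (coder 𝒱 (transferG 𝒱 q f g K) q n) = 0 := by
  match n with
  | 0 => simp [oddDer]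
  | n + 1 =>
    have hK := parityInv_odd 𝒱 (r := -1) (by decide) hc.K_degree
    have hd := parityInv_odd 𝒱 (r := 1) (by decide) hc.dV_degree
    have h1 := oddDer_anticomm 𝒱 hK hd (transferG 𝒱 q f g K (n + 1))
    have h0 : oddDer 𝒱 (linearPart q) (0 : MultilinearMap 𝕜 (fun _ : Fin (n + 1) => V) W) = 0 := by
      ext v
      simp [oddDer, spot]
    rw [oddDer_transferG hc hq, h0, add_zero, hc.homotopy] at h1
    have h2 : oddDer 𝒱 K (coder 𝒱 (transferG 𝒱 q f g K) q (n + 1)) =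
        oddDer 𝒱 K (oddDer 𝒱 (linearPart q) (transferG 𝒱 q f g K (n + 1))) +
          oddDer 𝒱 K (coderPlus 𝒱 (transferG 𝒱 q f g K) q n) := by
      rw [coder_succ 𝒱 (isSym_transferG hc _) hc.dV_degree]
      ext v
      simp [oddDer, spot, Finset.sum_add_distrib]
    rw [h2, h1, ← evenDer_transferG hc hq]
    ext v
    rw [add_apply, evenDer_apply, evenDer_apply, ← Finset.sum_add_distrib]
    refine Finset.sum_eq_zero fun k _ => ?_
    rw [← MultilinearMap.map_update_add]
    exact MultilinearMap.map_coord_zero _ k (by simp)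

end TransferG

/-! ### Evaluation at an even point and in tangent directions -/

section Evaluation

variable {𝕜 : Type u} [Field 𝕜] {V : Type v} [AddCommGroup V] [Module 𝕜 V]
  {U : Type w} [AddCommGroup U] [Module 𝕜 U] {n : ℕ}

/-- The sign of the transposition of elements of degrees `a` and `b`. -/
def ksgn (a b : ℤ) : ℤ := if (a : ZMod 2) = 1 ∧ (b : ZMod 2) = 1 then -1 else 1

theorem ksgn_mul_self (a b : ℤ) : ksgn a b * ksgn a b = 1 := by
  unfold ksgn; split_ifs <;> simp

theorem ksgn_comm (a b : ℤ) : ksgn a b = ksgn b a := by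
  unfold ksgn; simp only [and_comm]

/-- The sum over all ways to replace one argument of `ϕ(x, …, x)` by `a`. -/
def ev₁ (ϕ : MultilinearMap 𝕜 (fun _ : Fin n => V) U) (x a : V) : U :=
  ∑ α, ϕ (update (fun _ => x) α a)

/-- The value of `ϕ(x, …, x)` with arguments `α` and `β` replaced by `a` and `b`, with the sign `s`
if `b` comes first. -/
def ev₂Term (s : ℤ) (ϕ : MultilinearMap 𝕜 (fun _ : Fin n => V) U) (x a b : V) (α β : Fin n) : U :=
  if α = β then 0 else (if α < β then 1 else s) • ϕ (update (update (fun _ => x) α a) β b)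

/-- The signed sum over all ways to replace two arguments of `ϕ(x, …, x)` by `a` and `b`. -/
def ev₂ (s : ℤ) (ϕ : MultilinearMap 𝕜 (fun _ : Fin n => V) U) (x a b : V) : U :=
  ∑ α, ∑ β, ev₂Term s ϕ x a b α β

theorem update_comp_perm (x : Fin n → V) (σ : Equiv.Perm (Fin n)) (α : Fin n) (a : V) (i : Fin n) :
    update x (σ α) a (σ i) = update (fun i => x (σ i)) α a i := by
  by_cases h : i = α
  · subst h; simp
  · rw [Function.update_of_ne h, Function.update_of_ne (fun h' => h (σ.injective h'))]

variable (𝒱 : ℤ → Submodule 𝕜 V) [DirectSum.Decomposition 𝒱]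

section Invariance

variable {x a b : V} (hx : x ∈ desusp 𝒱 0) {da db : ℤ} (ha : a ∈ desusp 𝒱 da)
  (hb : b ∈ desusp 𝒱 db)

include hx

theorem apply_const_signedPerm (ϕ : MultilinearMap 𝕜 (fun _ : Fin n => V) U)
    (σ : Equiv.Perm (Fin n)) : signedPerm 𝒱 σ ϕ (fun _ => x) = ϕ fun _ => x := by
  rw [signedPerm_apply 𝒱 σ ϕ (fun _ => 0) _ fun _ => hx, koszulSign_even _ _ (by simp), one_smul]

include ha

theorem mem_desusp_update (α i : Fin n) :
    update (fun _ => x) α a i ∈ desusp 𝒱 (update (fun _ => (0 : ℤ)) α da i) := by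
  by_cases h : i = α
  · subst h; simpa using ha
  · simpa [h] using hx

/-- Base points have even degree in `V[1]`, so with a single other entry no sign can occur. -/
theorem apply_update_signedPerm (ϕ : MultilinearMap 𝕜 (fun _ : Fin n => V) U)
    (σ : Equiv.Perm (Fin n)) (α : Fin n) :
    signedPerm 𝒱 σ ϕ (update (fun _ => x) (σ α) a) = ϕ (update (fun _ => x) α a) := by
  rw [signedPerm_apply 𝒱 σ ϕ (update (fun _ => (0 : ℤ)) (σ α) da) _
    (mem_desusp_update 𝒱 hx ha _), koszulSign_eq_one _ _ (σ α), one_smul]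
  · congr 1
    funext i
    exact update_comp_perm _ σ α a i
  · intro k hk
    by_contra h
    simp [h] at hk

theorem ev₁_signedPerm (ϕ : MultilinearMap 𝕜 (fun _ : Fin n => V) U) (σ : Equiv.Perm (Fin n)) :
    ev₁ (signedPerm 𝒱 σ ϕ) x a = ev₁ ϕ x a := by
  unfold ev₁
  rw [← Equiv.sum_comp σ]
  exact Finset.sum_congr rfl fun α _ => apply_update_signedPerm 𝒱 hx ha ϕ σ α

include hb

/-- At most two entries are odd, so the Koszul sign only records whether σ exchanges their order;
this is the sign already built into `ev₂Term`. -/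
theorem ev₂Term_signedPerm (ϕ : MultilinearMap 𝕜 (fun _ : Fin n => V) U) (σ : Equiv.Perm (Fin n))
    (α β : Fin n) : ev₂Term (ksgn da db) (signedPerm 𝒱 σ ϕ) x a b (σ α) (σ β) =
      ev₂Term (ksgn da db) ϕ x a b α β := by
  unfold ev₂Term
  by_cases hαβ : α = β
  · simp [hαβ]
  have hσ : σ α ≠ σ β := fun h => hαβ (σ.injective h)
  rw [if_neg hαβ, if_neg hσ]
  rw [signedPerm_apply 𝒱 σ ϕ (update (update (fun _ => (0 : ℤ)) (σ α) da) (σ β) db) _ (fun i => by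
    by_cases h : i = σ β
    · subst h; simpa using hb
    · rw [Function.update_of_ne h, Function.update_of_ne h]
      exact mem_desusp_update 𝒱 hx ha _ _), smul_smul]
  congr 1
  · have he : ∀ k, ((update (update (fun _ => (0 : ℤ)) (σ α) da) (σ β) db (σ k) : ℤ) : ZMod 2) = 1 →
        k = α ∨ k = β := by
      intro k hk
      by_contra! h
      simp [h.1, h.2] at hk
    have h1 : update (update (fun _ => (0 : ℤ)) (σ α) da) (σ β) db (σ α) = da := by
      rw [Function.update_of_ne hσ, Function.update_self]
    have h2 : update (update (fun _ => (0 : ℤ)) (σ α) da) (σ β) db (σ β) = db := by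
      rw [Function.update_self]
    rcases lt_or_gt_of_ne hαβ with h | h
    · rw [koszulSign_two _ _ h he, h1, h2]
      rcases lt_or_gt_of_ne hσ with h3 | h3
      · simp [h, h3, h3.not_gt]
      · simp only [h, h3, h3.not_gt, true_and, if_true, if_false]
        exact ksgn_mul_self da db
    · rw [koszulSign_two _ _ h fun k hk => (he k hk).symm, h1, h2]
      rcases lt_or_gt_of_ne hσ with h3 | h3
      · simp only [h.not_gt, h3, true_and, if_true, if_false, one_mul]
        exact ksgn_comm db da
      · simp [h.not_gt, h3.not_gt]
  · congr 1
    funext i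
    rw [update_comp_perm _ σ β b i]
    congr 1
    funext i
    exact update_comp_perm _ σ α a i

theorem ev₂_signedPerm (ϕ : MultilinearMap 𝕜 (fun _ : Fin n => V) U) (σ : Equiv.Perm (Fin n)) :
    ev₂ (ksgn da db) (signedPerm 𝒱 σ ϕ) x a b = ev₂ (ksgn da db) ϕ x a b := by
  unfold ev₂
  rw [← Equiv.sum_comp σ]
  refine Finset.sum_congr rfl fun α _ => ?_
  rw [← Equiv.sum_comp σ]
  exact Finset.sum_congr rfl fun β _ => ev₂Term_signedPerm 𝒱 hx ha hb ϕ σ α β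

end Invariance

/-! #### Insertion of the first argument -/

theorem castAdd_ne_natAdd {j m : ℕ} (α : Fin j) (β : Fin m) : Fin.castAdd m α ≠ Fin.natAdd j β := by
  intro h
  have := congrArg Fin.val h
  simp at this
  omega

theorem castAdd_lt_natAdd {j m : ℕ} (α : Fin j) (β : Fin m) : Fin.castAdd m α < Fin.natAdd j β := by
  simp [Fin.lt_def]
  omega

theorem update_castAdd_castAdd {j m : ℕ} (x : Fin (j + m) → V) (a : V) (α i : Fin j) :
    update x (Fin.castAdd m α) a (Fin.castAdd m i) =
      update (fun i => x (Fin.castAdd m i)) α a i := by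
  by_cases h : i = α
  · subst h; simp
  · rw [Function.update_of_ne h, Function.update_of_ne]
    exact fun h' => h (Fin.castAdd_injective _ _ h')

theorem update_natAdd_natAdd {j m : ℕ} (x : Fin (j + m) → V) (a : V) (α i : Fin m) :
    update x (Fin.natAdd j α) a (Fin.natAdd j i) = update (fun i => x (Fin.natAdd j i)) α a i := by
  by_cases h : i = α
  · subst h; simp
  · rw [Function.update_of_ne h, Function.update_of_ne]
    exact fun h' => h (Fin.natAdd_injective _ _ h')

theorem update_castAdd_natAdd {j m : ℕ} (x : Fin (j + m) → V) (a : V) (α : Fin j) (i : Fin m) :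
    update x (Fin.castAdd m α) a (Fin.natAdd j i) = x (Fin.natAdd j i) :=
  Function.update_of_ne (castAdd_ne_natAdd α i).symm _ _

theorem update_natAdd_castAdd {j m : ℕ} (x : Fin (j + m) → V) (a : V) (α : Fin m) (i : Fin j) :
    update x (Fin.natAdd j α) a (Fin.castAdd m i) = x (Fin.castAdd m i) :=
  Function.update_of_ne (castAdd_ne_natAdd i α) _ _

variable {j m : ℕ} (ψ : MultilinearMap 𝕜 (fun _ : Fin j => V) V)
    (ϕ : MultilinearMap 𝕜 (fun _ : Fin (m + 1) => V) U)

theorem apply_const_insertFirst (x : V) : insertFirst rfl ψ ϕ (fun _ => x) =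
    ϕ.curryLeft (ψ fun _ => x) fun _ => x := by
  rw [insertFirst_apply]; rfl

theorem ev₁_insertFirst (x a : V) : ev₁ (insertFirst rfl ψ ϕ) x a =
    ϕ.curryLeft (ev₁ ψ x a) (fun _ => x) + ev₁ (ϕ.curryLeft (ψ fun _ => x)) x a := by
  unfold ev₁
  rw [Fin.sum_univ_add, map_sum, sum_apply]
  simp only [insertFirst_apply, MultilinearMap.curryLeft_apply, update_castAdd_castAdd,
    update_natAdd_natAdd, update_castAdd_natAdd, update_natAdd_castAdd]

/-- Product rule: the four summands record which of a and b are arguments of ψ. If only b is, then b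
stands before a, whence the sign s. -/
theorem ev₂_insertFirst (s : ℤ) (x a b : V) : ev₂ s (insertFirst rfl ψ ϕ) x a b =
    ϕ.curryLeft (ev₂ s ψ x a b) (fun _ => x) + ev₁ (ϕ.curryLeft (ev₁ ψ x a)) x b +
      s • ev₁ (ϕ.curryLeft (ev₁ ψ x b)) x a + ev₂ s (ϕ.curryLeft (ψ fun _ => x)) x a b := by
  have h1 : ∀ α β : Fin j, ev₂Term s (insertFirst rfl ψ ϕ) x a b (Fin.castAdd m α)
      (Fin.castAdd m β) = ϕ.curryLeft (ev₂Term s ψ x a b α β) (fun _ => x) := by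
    intro α β
    unfold ev₂Term
    by_cases h : α = β
    · simp [h]
    have h' : Fin.castAdd m α ≠ Fin.castAdd m β := fun h' => h (Fin.castAdd_injective _ _ h')
    have hlt : (Fin.castAdd m α < Fin.castAdd m β) ↔ (α < β) := Iff.rfl
    rw [if_neg h, if_neg h', map_zsmul, smul_apply]
    simp only [insertFirst_apply, MultilinearMap.curryLeft_apply, update_castAdd_castAdd,
      update_castAdd_natAdd, hlt]
  have h2 : ∀ α β : Fin m, ev₂Term s (insertFirst rfl ψ ϕ) x a b (Fin.natAdd j α)
      (Fin.natAdd j β) = ev₂Term s (ϕ.curryLeft (ψ fun _ => x)) x a b α β := by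
    intro α β
    unfold ev₂Term
    by_cases h : α = β
    · simp [h]
    have h' : Fin.natAdd j α ≠ Fin.natAdd j β := fun h' => h (Fin.natAdd_injective _ _ h')
    have hlt : (Fin.natAdd j α < Fin.natAdd j β) ↔ (α < β) := by simp
    rw [if_neg h, if_neg h']
    simp only [insertFirst_apply, MultilinearMap.curryLeft_apply, update_natAdd_natAdd,
      update_natAdd_castAdd, hlt]
  have h3 : ∀ (α : Fin j) (β : Fin m), ev₂Term s (insertFirst rfl ψ ϕ) x a b (Fin.castAdd m α)
      (Fin.natAdd j β) = ϕ.curryLeft (ψ (update (fun _ => x) α a)) (update (fun _ => x) β b) := by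
    intro α β
    unfold ev₂Term
    rw [if_neg (castAdd_ne_natAdd α β), if_pos (castAdd_lt_natAdd α β), one_smul]
    simp only [insertFirst_apply, MultilinearMap.curryLeft_apply, update_castAdd_castAdd,
      update_natAdd_natAdd, update_castAdd_natAdd, update_natAdd_castAdd]
  have h4 : ∀ (α : Fin m) (β : Fin j), ev₂Term s (insertFirst rfl ψ ϕ) x a b (Fin.natAdd j α)
      (Fin.castAdd m β) =
        s • ϕ.curryLeft (ψ (update (fun _ => x) β b)) (update (fun _ => x) α a) := by
    intro α β
    unfold ev₂Term
    rw [if_neg (castAdd_ne_natAdd β α).symm, if_neg (castAdd_lt_natAdd β α).not_gt]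
    simp only [insertFirst_apply, MultilinearMap.curryLeft_apply, update_castAdd_castAdd,
      update_natAdd_natAdd, update_castAdd_natAdd, update_natAdd_castAdd]
  unfold ev₂
  rw [Fin.sum_univ_add]
  simp_rw [Fin.sum_univ_add, h1, h2, h3, h4]
  rw [Finset.sum_add_distrib, Finset.sum_add_distrib]
  unfold ev₁
  simp_rw [map_sum, sum_apply, Finset.smul_sum]
  rw [Finset.sum_comm (f := fun (α : Fin m) (β : Fin j) =>
      s • ϕ.curryLeft (ψ (update (fun _ => x) β b)) (update (fun _ => x) α a)),
    Finset.sum_comm (f := fun (β : Fin m) (α : Fin j) =>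
      ϕ.curryLeft (ψ (update (fun _ => x) α a)) (update (fun _ => x) β b))]
  abel

/-! #### Graded symmetric maps -/

theorem ev₂_comm (s : ℤ) (hs : s * s = 1) (χ : MultilinearMap 𝕜 (fun _ : Fin n => V) U)
    (x a b : V) : ev₂ s χ x a b = s • ev₂ s χ x b a := by
  unfold ev₂
  rw [Finset.sum_comm, Finset.smul_sum]
  refine Finset.sum_congr rfl fun α _ => ?_
  rw [Finset.smul_sum]
  refine Finset.sum_congr rfl fun β _ => ?_
  unfold ev₂Term
  by_cases h : α = β
  · simp [h]
  rw [if_neg h, if_neg (Ne.symm h), Function.update_comm h, smul_smul]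
  rcases lt_or_gt_of_ne h with h1 | h1
  · simp [h1, h1.not_gt]
  · simp [h1, h1.not_gt, hs]

theorem cons_const_eq_update (x b : V) :
    (Fin.cons b fun _ => x : Fin (m + 1) → V) = update (fun _ => x) 0 b := by
  funext i
  refine Fin.cases ?_ (fun i => ?_) i
  · simp
  · simp [Fin.succ_ne_zero]

theorem cons_update_eq_update (x b a : V) (β : Fin m) :
    (Fin.cons b (update (fun _ => x) β a) : Fin (m + 1) → V) =
      update (update (fun _ => x) 0 b) β.succ a := by
  rw [← cons_const_eq_update]
  exact Fin.cons_update _ _ _ _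

section Sym

variable {ϕ} (hϕ : IsSym 𝒱 ϕ) {x a b : V} (hx : x ∈ desusp 𝒱 0) {da db : ℤ}
  (ha : a ∈ desusp 𝒱 da) (hb : b ∈ desusp 𝒱 db)

include hϕ hx hb

/-- By symmetry all m + 1 slots contribute equally to the derivative. -/
theorem succ_smul_curryLeft_apply :
    (m + 1) • ϕ.curryLeft b (fun _ => x) = ev₁ ϕ x b := by
  unfold ev₁
  rw [MultilinearMap.curryLeft_apply, cons_const_eq_update]
  have h : ∀ α, ϕ (update (fun _ => x) α b) = ϕ (update (fun _ => x) 0 b) := by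
    intro α
    have := apply_update_signedPerm 𝒱 hx hb ϕ (Equiv.swap 0 α) 0
    rwa [hϕ, Equiv.swap_apply_left] at this
  rw [Finset.sum_congr rfl fun α _ => h α]
  simp

include ha

/-- By symmetry each position of b contributes as much as the first, where b precedes a and the sign
is trivial. -/
theorem succ_smul_ev₁_curryLeft :
    (m + 1) • ev₁ (ϕ.curryLeft b) x a = ev₂ (ksgn db da) ϕ x b a := by
  unfold ev₂
  have h : ∀ α, ∑ β, ev₂Term (ksgn db da) ϕ x b a α β =
      ∑ β, ev₂Term (ksgn db da) ϕ x b a 0 β := by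
    intro α
    rw [← Equiv.sum_comp (Equiv.swap 0 α)]
    refine Finset.sum_congr rfl fun β _ => ?_
    have := ev₂Term_signedPerm 𝒱 hx hb ha ϕ (Equiv.swap 0 α) 0 β
    rwa [hϕ, Equiv.swap_apply_left] at this
  rw [Finset.sum_congr rfl fun α _ => h α, Finset.sum_const, Finset.card_univ, Fintype.card_fin,
    Fin.sum_univ_succ]
  congr 1
  simp only [ev₂Term, if_true, zero_add, (Fin.succ_ne_zero _).symm, if_false, Fin.succ_pos,
    one_smul, ev₁, MultilinearMap.curryLeft_apply, cons_update_eq_update]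

end Sym

theorem koszulSign_swap_zero_one (e : Fin (m + 2) → ZMod 2) (h0 : e 0 = 1) (h1 : e 1 = 1) :
    koszulSign e (Equiv.swap 0 1) = -1 := by
  have hval : ∀ k : Fin (m + 2), k ≠ 0 → k ≠ 1 → 1 < k := by
    intro k h0 h1
    rw [Fin.lt_def]
    have h2 : (k : ℕ) ≠ 0 := fun h => h0 (Fin.ext h)
    have h3 : (k : ℕ) ≠ 1 := fun h => h1 (Fin.ext h)
    simp only [Fin.val_one]
    omega
  unfold koszulSign
  rw [Finset.prod_eq_single 0, Finset.prod_eq_single 1]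
  · simp [h0, h1]
  · intro b _ hb
    rw [if_neg]
    rintro ⟨h2, h3, -, -⟩
    have h4 := hval b h2.ne' hb
    rw [Equiv.swap_apply_of_ne_of_ne h2.ne' hb, Equiv.swap_apply_left] at h3
    exact absurd h3 h4.not_gt
  · simp
  · intro a _ ha
    refine Finset.prod_eq_one fun b _ => ?_
    rw [if_neg]
    rintro ⟨h2, h3, -, -⟩
    have hb0 : b ≠ 0 := fun h => by subst h; exact absurd h2 (by simp)
    by_cases ha1 : a = 1
    · subst ha1
      rw [Equiv.swap_apply_right] at h3
      exact absurd h3 (by simp)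
    · have hb1 : b ≠ 1 := fun h => by
        subst h
        exact absurd h2 (hval a ha ha1).not_gt
      rw [Equiv.swap_apply_of_ne_of_ne hb0 hb1, Equiv.swap_apply_of_ne_of_ne ha ha1] at h3
      exact absurd h2 h3.not_gt
  · simp

/-- A graded symmetric map vanishes if an odd element is repeated. -/
theorem IsSym.apply_eq_zero [CharZero 𝕜] {k : ℕ}
    {χ : MultilinearMap 𝕜 (fun _ : Fin k => V) U} (hχ : IsSym 𝒱 χ) (d : Fin k → ℤ)
    (v : Fin k → V) (hv : ∀ i, v i ∈ desusp 𝒱 (d i)) (i j : Fin k) (hij : i ≠ j)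
    (hd : (d i : ZMod 2) = 1) (hd' : (d j : ZMod 2) = 1) (h : v i = v j) : χ v = 0 := by
  obtain ⟨k, rfl⟩ : ∃ k', k = k' + 2 := ⟨k - 2, by
    have := Fin.val_ne_of_ne hij
    omega⟩
  obtain ⟨σ, h0, h1⟩ : ∃ σ : Equiv.Perm (Fin (k + 2)), σ 0 = i ∧ σ 1 = j := by
    refine ⟨Equiv.swap 0 i * Equiv.swap 1 (Equiv.swap 0 i j), ?_, ?_⟩
    · have h2 : Equiv.swap 0 i j ≠ 0 := fun h3 => by
        rw [Equiv.swap_apply_eq_iff, Equiv.swap_apply_left] at h3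
        exact hij h3.symm
      rw [Equiv.Perm.mul_apply, Equiv.swap_apply_of_ne_of_ne (by simp) h2.symm,
        Equiv.swap_apply_left]
    · simp
  rw [hχ.apply_perm σ d v hv]
  have h2 := hχ.apply_perm (Equiv.swap 0 1) (fun i => d (σ i)) (fun i => v (σ i)) fun i => hv _
  rw [koszulSign_swap_zero_one _ (by simpa [h0] using hd) (by simpa [h1] using hd')] at h2
  have h3 : (fun l => v (σ (Equiv.swap 0 1 l))) = fun l => v (σ l) := by
    funext l
    by_cases hl0 : l = 0
    · subst hl0; simp [h0, h1, h]
    by_cases hl1 : l = 1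
    · subst hl1; simp [h0, h1, h]
    rw [Equiv.swap_apply_of_ne_of_ne hl0 hl1]
  rw [h3, neg_smul, one_smul, eq_neg_iff_add_eq_zero, ← two_smul 𝕜] at h2
  rw [(smul_eq_zero.1 h2).resolve_left two_ne_zero, smul_zero]

/-- A third derivative with the same odd direction inserted twice. This removes the third-order term
from the second derivative of G Q in the direction of the curvature. -/
theorem ev₂_curryLeft_self [CharZero 𝕜] {ϕ : MultilinearMap 𝕜 (fun _ : Fin (m + 1) => V) U}
    (hϕ : IsSym 𝒱 ϕ) {x a b : V} (hx : x ∈ desusp 𝒱 0) {da db : ℤ} (ha : a ∈ desusp 𝒱 da)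
    (hb : b ∈ desusp 𝒱 db) (hdb : (db : ZMod 2) = 1) (s : ℤ) :
    ev₂ s (ϕ.curryLeft b) x b a = 0 := by
  refine Finset.sum_eq_zero fun α _ => Finset.sum_eq_zero fun β _ => ?_
  unfold ev₂Term
  by_cases h : α = β
  · simp [h]
  rw [if_neg h, MultilinearMap.curryLeft_apply, hϕ.apply_eq_zero 𝒱
    (Fin.cons db (update (update (fun _ => (0 : ℤ)) α db) β da)) _ ?_ 0 α.succ
    (Fin.succ_ne_zero _).symm ?_ ?_ ?_, smul_zero]
  · intro i
    refine Fin.cases ?_ (fun i => ?_) i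
    · simpa using hb
    · rw [Fin.cons_succ, Fin.cons_succ]
      by_cases hi : i = β
      · subst hi; simpa using ha
      · rw [Function.update_of_ne hi, Function.update_of_ne hi]
        exact mem_desusp_update 𝒱 hx hb _ _
  · simpa using hdb
  · simpa [h] using hdb
  · simp [h]

/-! #### Odd derivations -/

section OddDer

variable {x b : V} (hx : x ∈ desusp 𝒱 0) {db : ℤ} (hb : b ∈ desusp 𝒱 db)

include hx

theorem oddDer_apply_const (D : V →ₗ[𝕜] V) (χ : MultilinearMap 𝕜 (fun _ : Fin n => V) U) :
    oddDer 𝒱 D χ (fun _ => x) = ev₁ χ x (D x) := by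
  unfold oddDer ev₁
  rw [sum_apply]
  refine Finset.sum_congr rfl fun k _ => ?_
  rw [spot_apply 𝒱 _ _ _ _ (fun _ => 0) _ fun _ => hx, Finset.prod_eq_one, one_smul]
  · congr 1
    funext i
    by_cases h : i = k
    · subst h; simp
    · simp [h]
  · intro i _
    simp [zsign]

include hb

/-- Product rule: either b and D x occupy different slots, with a sign when D has to pass b, or D
acts on b itself. -/
theorem ev₁_oddDer (D : V →ₗ[𝕜] V) (χ : MultilinearMap 𝕜 (fun _ : Fin n => V) U) :
    ev₁ (oddDer 𝒱 D χ) x b = ev₂ (zsign (db : ZMod 2)) χ x (D x) b + ev₁ χ x (D b) := by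
  have h1 : ∀ β k, spot 𝒱 χ (fun _ => LinearMap.id) D k (update (fun _ => x) β b) =
      ev₂Term (zsign (db : ZMod 2)) χ x (D x) b k β +
        if k = β then χ (update (fun _ => x) β (D b)) else 0 := by
    intro β k
    rw [spot_apply 𝒱 _ _ _ _ _ _ (mem_desusp_update 𝒱 hx hb β)]
    have h2 : (∏ l, if l < k then zsign ((update (fun _ => (0 : ℤ)) β db l : ℤ) : ZMod 2) else 1) =
        if β < k then zsign (db : ZMod 2) else 1 := by
      rw [Finset.prod_eq_single β]
      · simp
      · intro l _ hl
        simp [hl, zsign]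
      · simp
    rw [h2]
    unfold ev₂Term
    by_cases h : k = β
    · subst h
      simp only [lt_irrefl, if_true, if_false, one_smul, zero_add]
      congr 1
      funext i
      by_cases hi : i = k
      · subst hi; simp
      · simp [hi]
    · have h3 : (if β < k then zsign (db : ZMod 2) else 1) =
          if k < β then 1 else zsign (db : ZMod 2) := by
        rcases lt_or_gt_of_ne h with h4 | h4 <;> simp [h4, h4.not_gt]
      rw [if_neg h, if_neg h, add_zero, h3]
      congr 2
      funext i
      by_cases hi : i = k
      · subst hi; simp [h]
      · by_cases hi' : i = β
        · subst hi'; simp [hi]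
        · simp [hi, hi']
  unfold ev₁ ev₂ oddDer
  simp_rw [sum_apply, h1, Finset.sum_add_distrib]
  rw [Finset.sum_comm]
  simp

end OddDer

end Evaluation

/-! ### Taylor expansions modulo the filtration -/

section Linear

variable {𝕜 : Type u} [Field 𝕜] {V : Type v} [AddCommGroup V] [Module 𝕜 V]
  {U : Type w} [AddCommGroup U] [Module 𝕜 U] {n : ℕ}

/-- `ev₁ ϕ x` as a linear map. -/
noncomputable def ev₁Lin (ϕ : MultilinearMap 𝕜 (fun _ : Fin n => V) U) (x : V) : V →ₗ[𝕜] U :=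
  ∑ α, ϕ.toLinearMap (fun _ => x) α

theorem ev₁Lin_apply (ϕ : MultilinearMap 𝕜 (fun _ : Fin n => V) U) (x a : V) :
    ev₁Lin ϕ x a = ev₁ ϕ x a := by
  simp [ev₁Lin, ev₁]

/-- `ev₂ s ϕ x` as a bilinear map. -/
noncomputable def ev₂Lin (s : ℤ) (ϕ : MultilinearMap 𝕜 (fun _ : Fin n => V) U) (x : V) :
    V →ₗ[𝕜] V →ₗ[𝕜] U :=
  LinearMap.mk₂ 𝕜 (ev₂ s ϕ x)
    (fun a a' b => by
      simp only [ev₂, ← Finset.sum_add_distrib]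
      refine Finset.sum_congr rfl fun α _ => Finset.sum_congr rfl fun β _ => ?_
      unfold ev₂Term
      by_cases h : α = β
      · simp [h]
      · simp only [h, if_false, Function.update_comm h, MultilinearMap.map_update_add, smul_add])
    (fun c a b => by
      simp only [ev₂, Finset.smul_sum]
      refine Finset.sum_congr rfl fun α _ => Finset.sum_congr rfl fun β _ => ?_
      unfold ev₂Term
      by_cases h : α = β
      · simp [h]
      · simp only [h, if_false, Function.update_comm h, MultilinearMap.map_update_smul]
        rw [smul_comm])
    (fun a b b' => by
      simp only [ev₂, ← Finset.sum_add_distrib]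
      refine Finset.sum_congr rfl fun α _ => Finset.sum_congr rfl fun β _ => ?_
      unfold ev₂Term
      by_cases h : α = β
      · simp [h]
      · simp only [h, if_false, MultilinearMap.map_update_add, smul_add])
    (fun c a b => by
      simp only [ev₂, Finset.smul_sum]
      refine Finset.sum_congr rfl fun α _ => Finset.sum_congr rfl fun β _ => ?_
      unfold ev₂Term
      by_cases h : α = β
      · simp [h]
      · simp only [h, if_false, MultilinearMap.map_update_smul]
        rw [smul_comm])

theorem ev₂Lin_apply (s : ℤ) (ϕ : MultilinearMap 𝕜 (fun _ : Fin n => V) U) (x a b : V) :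
    ev₂Lin s ϕ x a b = ev₂ s ϕ x a b := rfl

theorem ev₁_sum {ι : Type*} (t : Finset ι) (ϕ : ι → MultilinearMap 𝕜 (fun _ : Fin n => V) U)
    (x a : V) : ev₁ (∑ i ∈ t, ϕ i) x a = ∑ i ∈ t, ev₁ (ϕ i) x a := by
  simp only [ev₁, sum_apply]
  exact Finset.sum_comm

theorem ev₂_sum {ι : Type*} (s : ℤ) (t : Finset ι)
    (ϕ : ι → MultilinearMap 𝕜 (fun _ : Fin n => V) U)
    (x a b : V) : ev₂ s (∑ i ∈ t, ϕ i) x a b = ∑ i ∈ t, ev₂ s (ϕ i) x a b := by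
  have h : ∀ α β, ev₂Term s (∑ i ∈ t, ϕ i) x a b α β = ∑ i ∈ t, ev₂Term s (ϕ i) x a b α β := by
    intro α β
    unfold ev₂Term
    by_cases h : α = β
    · simp [h]
    · simp [h, sum_apply, Finset.smul_sum]
  simp only [ev₂, h]
  rw [Finset.sum_comm (s := t)]
  exact Finset.sum_congr rfl fun α _ => Finset.sum_comm

theorem ev₁_smul (ϕ : MultilinearMap 𝕜 (fun _ : Fin n => V) U) (c : 𝕜) (x a : V) :
    ev₁ ϕ x (c • a) = c • ev₁ ϕ x a := by
  rw [← ev₁Lin_apply, ← ev₁Lin_apply, map_smul]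

theorem ev₂_smul_left (s : ℤ) (ϕ : MultilinearMap 𝕜 (fun _ : Fin n => V) U) (c : 𝕜)
    (x a b : V) : ev₂ s ϕ x (c • a) b = c • ev₂ s ϕ x a b := by
  rw [← ev₂Lin_apply, ← ev₂Lin_apply, map_smul, LinearMap.smul_apply]

end Linear

/-! ### Derivatives of Taylor series with the factors 1/n! -/

section Normalized

variable {𝕜 : Type u} [Field 𝕜] {V : Type v} [AddCommGroup V] [Module 𝕜 V]
  {U : Type w} [AddCommGroup U] [Module 𝕜 U]

/-- The `n`-th term of the derivative of `∑ 1/n! ϕ_n(x^n)` at `x`. -/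
noncomputable def term₁ (ϕ : Taylor 𝕜 V U) (n : ℕ) (x : V) : V →ₗ[𝕜] U :=
  ((n.factorial : ℕ) : 𝕜)⁻¹ • ev₁Lin (ϕ n) x

/-- The `n`-th term of the second derivative of `∑ 1/n! ϕ_n(x^n)` at `x`, `s` being the sign of
the exchange of the two tangent directions. -/
noncomputable def term₂ (s : ℤ) (ϕ : Taylor 𝕜 V U) (n : ℕ) (x : V) : V →ₗ[𝕜] V →ₗ[𝕜] U :=
  ((n.factorial : ℕ) : 𝕜)⁻¹ • ev₂Lin s (ϕ n) x

/-- The truncated derivative of `∑ 1/n! ϕ_n(x^n)` at `x`. -/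
noncomputable def der₁ (ϕ : Taylor 𝕜 V U) (M : ℕ) (x : V) : V →ₗ[𝕜] U :=
  ∑ n ∈ Finset.Icc 1 M, term₁ ϕ n x

/-- The truncated second derivative of `∑ 1/n! ϕ_n(x^n)` at `x`. -/
noncomputable def der₂ (s : ℤ) (ϕ : Taylor 𝕜 V U) (M : ℕ) (x : V) : V →ₗ[𝕜] V →ₗ[𝕜] U :=
  ∑ n ∈ Finset.Icc 1 M, term₂ s ϕ n x

/-- The `n`-th term `1/n! ϕ_n(x^n)`. -/
noncomputable def term₀ (ϕ : Taylor 𝕜 V U) (n : ℕ) (x : V) : U :=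
  ((n.factorial : ℕ) : 𝕜)⁻¹ • ϕ n fun _ => x

theorem expSum_eq (ϕ : Taylor 𝕜 V U) (a : ℕ) (x : V) (M : ℕ) :
    expSum ϕ a x M = ∑ n ∈ Finset.Icc a M, term₀ ϕ n x := rfl

theorem der₁_apply (ϕ : Taylor 𝕜 V U) (M : ℕ) (x a : V) :
    der₁ ϕ M x a = ∑ n ∈ Finset.Icc 1 M, term₁ ϕ n x a := by
  simp [der₁]

theorem der₂_apply (s : ℤ) (ϕ : Taylor 𝕜 V U) (M : ℕ) (x a b : V) :
    der₂ s ϕ M x a b = ∑ n ∈ Finset.Icc 1 M, term₂ s ϕ n x a b := by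
  simp [der₂]

theorem term₁_apply (ϕ : Taylor 𝕜 V U) (n : ℕ) (x a : V) :
    term₁ ϕ n x a = ((n.factorial : ℕ) : 𝕜)⁻¹ • ev₁ (ϕ n) x a := by
  simp [term₁, ev₁Lin_apply]

theorem term₂_apply (s : ℤ) (ϕ : Taylor 𝕜 V U) (n : ℕ) (x a b : V) :
    term₂ s ϕ n x a b = ((n.factorial : ℕ) : 𝕜)⁻¹ • ev₂ s (ϕ n) x a b := by
  simp [term₂, ev₂Lin_apply]

variable (𝒱 : ℤ → Submodule 𝕜 V) [DirectSum.Decomposition 𝒱] [CharZero 𝕜]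

section Comp

variable {n j m : ℕ} (h : j + m = n)
  (ψ : MultilinearMap 𝕜 (fun _ : Fin j => V) V)
  (ϕ : MultilinearMap 𝕜 (fun _ : Fin (m + 1) => V) U)

/-- There are n!/(j! m!) unshuffles; this is how the factorials of a coderivation split. -/
theorem factorial_smul_card_unshuffles (h : j + m = n) (u : U) :
    ((n.factorial : ℕ) : 𝕜)⁻¹ • (unshuffles n j).card • u =
      ((j.factorial : ℕ) : 𝕜)⁻¹ • ((m.factorial : ℕ) : 𝕜)⁻¹ • u := by
  subst h
  have h0 : ∀ k : ℕ, ((k.factorial : ℕ) : 𝕜) ≠ 0 := fun k => by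
    exact_mod_cast k.factorial_ne_zero
  rw [← Nat.cast_smul_eq_nsmul 𝕜, smul_smul, smul_smul]
  congr 1
  have := congrArg (Nat.cast (R := 𝕜)) (card_unshuffles j m)
  push_cast at this
  have h1 := h0 (j + m)
  have h2 := h0 j
  have h3 := h0 m
  field_simp
  rw [this]
  ring

theorem factorial_succ_smul (m : ℕ) (u : U) :
    (((m + 1).factorial : ℕ) : 𝕜)⁻¹ • (m + 1) • u = ((m.factorial : ℕ) : 𝕜)⁻¹ • u := by
  have h0 : ((m : 𝕜) + 1) ≠ 0 := by exact_mod_cast m.succ_ne_zero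
  rw [← Nat.cast_smul_eq_nsmul 𝕜, smul_smul, Nat.factorial_succ]
  congr 1
  push_cast
  field_simp

variable {x a b : V} (hx : x ∈ desusp 𝒱 0) {da db : ℤ} (ha : a ∈ desusp 𝒱 da)
  (hb : b ∈ desusp 𝒱 db) {ϕ}

include hx

/-- With factors 1/n!, composing with Q amounts to differentiating in the direction Q(x). The factor
m + 1 from the slots of ϕ turns 1/m! into 1/(m+1)!. -/
theorem apply_const_compCoder (hϕ : IsSym 𝒱 ϕ)
    {k : ℤ} (hψ : (ψ fun _ => x) ∈ desusp 𝒱 k) :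
    ((n.factorial : ℕ) : 𝕜)⁻¹ • compCoder 𝒱 h ϕ ψ (fun _ => x) =
      (((m + 1).factorial : ℕ) : 𝕜)⁻¹ • ev₁ ϕ x (((j.factorial : ℕ) : 𝕜)⁻¹ • ψ fun _ => x) := by
  subst h
  rw [compCoder, sum_apply, Finset.sum_congr rfl fun σ _ => apply_const_signedPerm 𝒱 hx _ σ,
    Finset.sum_const, factorial_smul_card_unshuffles rfl, apply_const_insertFirst,
    ← factorial_succ_smul m, succ_smul_curryLeft_apply 𝒱 hϕ hx hψ, ev₁_smul, smul_comm]

include ha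

theorem ev₁_compCoder (hϕ : IsSym 𝒱 ϕ)
    {k : ℤ} (hψ : (ψ fun _ => x) ∈ desusp 𝒱 k) (hψa : ev₁ ψ x a ∈ desusp 𝒱 (da + k)) :
    ((n.factorial : ℕ) : 𝕜)⁻¹ • ev₁ (compCoder 𝒱 h ϕ ψ) x a =
      (((m + 1).factorial : ℕ) : 𝕜)⁻¹ • (ev₁ ϕ x (((j.factorial : ℕ) : 𝕜)⁻¹ • ev₁ ψ x a) +
        ev₂ (ksgn k da) ϕ x (((j.factorial : ℕ) : 𝕜)⁻¹ • ψ fun _ => x) a) := by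
  subst h
  rw [compCoder, ev₁_sum, Finset.sum_congr rfl fun σ _ => ev₁_signedPerm 𝒱 hx ha _ σ,
    Finset.sum_const, factorial_smul_card_unshuffles rfl, ev₁_insertFirst,
    ← factorial_succ_smul m, smul_add, succ_smul_curryLeft_apply 𝒱 hϕ hx hψa,
    succ_smul_ev₁_curryLeft 𝒱 hϕ hx ha hψ, ev₁_smul, ev₂_smul_left, ← smul_add,
    smul_comm]

include hb

/-- The last summand, a derivative of third order in the directions of ψ(x), a and b, is
deliberately left in curried form: it drops out only after summation over j. -/
theorem ev₂_compCoder (hϕ : IsSym 𝒱 ϕ)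
    {k : ℤ} (hψa : ev₁ ψ x a ∈ desusp 𝒱 (da + k)) (hψb : ev₁ ψ x b ∈ desusp 𝒱 (db + k))
    (hψ₂ : ev₂ (ksgn da db) ψ x a b ∈ desusp 𝒱 (da + db + k)) :
    ((n.factorial : ℕ) : 𝕜)⁻¹ • ev₂ (ksgn da db) (compCoder 𝒱 h ϕ ψ) x a b =
      (((m + 1).factorial : ℕ) : 𝕜)⁻¹ •
        (ev₁ ϕ x (((j.factorial : ℕ) : 𝕜)⁻¹ • ev₂ (ksgn da db) ψ x a b) +
        ev₂ (ksgn (da + k) db) ϕ x (((j.factorial : ℕ) : 𝕜)⁻¹ • ev₁ ψ x a) b +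
        ksgn da db • ev₂ (ksgn (db + k) da) ϕ x (((j.factorial : ℕ) : 𝕜)⁻¹ • ev₁ ψ x b) a) +
      ((m.factorial : ℕ) : 𝕜)⁻¹ •
        ev₂ (ksgn da db) (ϕ.curryLeft (((j.factorial : ℕ) : 𝕜)⁻¹ • ψ fun _ => x)) x a b := by
  subst h
  have h1 : ∀ (c : 𝕜) (v : V), ev₂ (ksgn da db) (ϕ.curryLeft (c • v)) x a b =
      c • ev₂ (ksgn da db) (ϕ.curryLeft v) x a b := by
    intro c v
    simp only [ev₂, ev₂Term, map_smul, smul_apply, Finset.smul_sum, smul_ite, smul_zero]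
    refine Finset.sum_congr rfl fun α _ => Finset.sum_congr rfl fun β _ => ?_
    rw [smul_comm]
  rw [compCoder, ev₂_sum, Finset.sum_congr rfl fun σ _ => ev₂_signedPerm 𝒱 hx ha hb _ σ,
    Finset.sum_const, factorial_smul_card_unshuffles rfl, ev₂_insertFirst, h1, ev₂_smul_left, ev₂_smul_left, ev₁_smul,
    ← succ_smul_curryLeft_apply 𝒱 hϕ hx hψ₂, ← succ_smul_ev₁_curryLeft 𝒱 hϕ hx hb hψa,
    ← succ_smul_ev₁_curryLeft 𝒱 hϕ hx ha hψb]
  simp only [smul_add]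
  simp only [smul_comm (((m + 1).factorial : ℕ) : 𝕜)⁻¹ (ksgn da db),
    smul_comm (((m + 1).factorial : ℕ) : 𝕜)⁻¹ ((j.factorial : ℕ) : 𝕜)⁻¹, factorial_succ_smul,
    smul_comm ((m.factorial : ℕ) : 𝕜)⁻¹ ((j.factorial : ℕ) : 𝕜)⁻¹,
    smul_comm ((m.factorial : ℕ) : 𝕜)⁻¹ (ksgn da db),
    smul_comm ((j.factorial : ℕ) : 𝕜)⁻¹ (ksgn da db)]

end Comp

end Normalized

/-! ### Filtration estimates for derivatives -/

section Estimates

variable {𝕜 : Type u} [Field 𝕜] {V : Type v} [AddCommGroup V] [Module 𝕜 V]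
  {U : Type w} [AddCommGroup U] [Module 𝕜 U] {n : ℕ}
  {F : ℕ → Submodule 𝕜 V} {F' : ℕ → Submodule 𝕜 U}

theorem smodEq_of_eq {N : Submodule 𝕜 U} {a b : U} (h : a = b) : a ≡ b [SMOD N] := h ▸ SModEq.rfl

theorem sum_update_one (α : Fin n) (p : ℕ) : ∑ i, update (fun _ => 1) α p i = n - 1 + p := by
  rw [Finset.sum_update_of_mem (Finset.mem_univ _)]
  simp [Finset.card_sdiff, add_comm]

section

variable (hF : F 1 = ⊤) {ϕ : MultilinearMap 𝕜 (fun _ : Fin n => V) U} (hϕ : IsCont F F' ϕ)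

include hF hϕ

theorem IsCont.apply_const_mem (x : V) : ϕ (fun _ => x) ∈ F' n := by
  simpa using hϕ (fun _ => 1) (fun _ => x) (fun _ => le_rfl) fun _ => by simp [hF]

theorem IsCont.apply_update_mem (x : Fin n → V) (α : Fin n) {p : ℕ} (hp : 1 ≤ p)
    (ha : x α ∈ F p) : ϕ x ∈ F' (n - 1 + p) := by
  rw [← sum_update_one α p]
  refine hϕ _ _ (fun i => ?_) fun i => ?_
  · by_cases h : i = α
    · subst h; simpa using hp
    · simp [h]
  · by_cases h : i = α
    · subst h; simpa using ha
    · simp [h, hF]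

theorem IsCont.ev₁_mem (x : V) {a : V} {p : ℕ} (hp : 1 ≤ p) (ha : a ∈ F p) :
    ev₁ ϕ x a ∈ F' (n - 1 + p) :=
  Submodule.sum_mem _ fun α _ => hϕ.apply_update_mem hF _ α hp (by simpa using ha)

theorem IsCont.ev₂_mem (s : ℤ) (x : V) {a : V} (b : V) {p : ℕ} (hp : 1 ≤ p) (ha : a ∈ F p) :
    ev₂ s ϕ x a b ∈ F' (n - 1 + p) := by
  refine Submodule.sum_mem _ fun α _ => Submodule.sum_mem _ fun β _ => ?_
  unfold ev₂Term
  by_cases h : α = β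
  · simp [h]
  · rw [if_neg h]
    exact Submodule.smul_of_tower_mem _ _
      (hϕ.apply_update_mem hF _ α hp (by simpa [h] using ha))

end

theorem IsCont.curryLeft_ev₂_mem (hF : F 1 = ⊤)
    {ϕ : MultilinearMap 𝕜 (fun _ : Fin (n + 1) => V) U} (hϕ : IsCont F F' ϕ) (s : ℤ)
    (x a b : V) {c : V} {p : ℕ} (hp : 1 ≤ p) (hc : c ∈ F p) :
    ev₂ s (ϕ.curryLeft c) x a b ∈ F' (n + p) := by
  refine Submodule.sum_mem _ fun α _ => Submodule.sum_mem _ fun β _ => ?_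
  unfold ev₂Term
  by_cases h : α = β
  · simp [h]
  · rw [if_neg h]
    exact Submodule.smul_of_tower_mem _ _
      (hϕ.apply_update_mem hF _ 0 hp (by simpa using hc))

/-- Sums over n of compositions in which q_j meets ϕ_k with n = j + k - 1 are sums over a triangle.
The rest of the square j, k ≤ M has j + k - 1 > M and is negligible. -/
theorem sum_triangle (hF' : Antitone F') (T : ℕ → ℕ → U)
    (hT : ∀ j k, 1 ≤ j → 1 ≤ k → T j k ∈ F' (j + k - 1)) (M : ℕ) :
    ∑ n ∈ Finset.Icc 1 M, ∑ j : Fin n, T (j + 1) (n - (j + 1) + 1) ≡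
      ∑ j ∈ Finset.Icc 1 M, ∑ k ∈ Finset.Icc 1 M, T j k [SMOD F' M] := by
  have h1 : ∑ n ∈ Finset.Icc 1 M, ∑ j : Fin n, T (j + 1) (n - (j + 1) + 1) =
      ∑ a ∈ (Finset.Icc 1 M ×ˢ Finset.Icc 1 M).filter (fun a => a.1 + a.2 ≤ M + 1),
        T a.1 a.2 := by
    rw [Finset.sum_congr rfl fun n _ =>
      Fin.sum_univ_eq_sum_range (fun j => T (j + 1) (n - (j + 1) + 1)) n, Finset.sum_sigma']
    refine Finset.sum_bij' (fun a _ => (a.2 + 1, a.1 - (a.2 + 1) + 1))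
      (fun b _ => ⟨b.1 + b.2 - 1, b.1 - 1⟩) ?_ ?_ ?_ ?_ ?_
    · rintro ⟨n, j⟩ h
      simp only [Finset.mem_sigma, Finset.mem_Icc, Finset.mem_range, Finset.mem_filter,
        Finset.mem_product] at h ⊢
      omega
    · rintro ⟨n, j⟩ h
      simp only [Finset.mem_sigma, Finset.mem_Icc, Finset.mem_range, Finset.mem_filter,
        Finset.mem_product] at h ⊢
      omega
    · rintro ⟨n, j⟩ h
      simp only [Finset.mem_sigma, Finset.mem_Icc, Finset.mem_range] at h
      have : j + 1 + (n - (j + 1) + 1) - 1 = n := by omega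
      simp [this]
    · rintro ⟨n, j⟩ h
      simp only [Finset.mem_Icc, Finset.mem_filter, Finset.mem_product] at h
      simp only [Prod.mk.injEq]
      omega
    · rintro ⟨n, j⟩ h
      rfl
  rw [h1, ← Finset.sum_product', SModEq.comm, SModEq.sub_mem,
    ← Finset.sum_filter_add_sum_filter_not _ (fun a : ℕ × ℕ => a.1 + a.2 ≤ M + 1),
    add_sub_cancel_left]
  refine Submodule.sum_mem _ fun a ha => ?_
  simp only [Finset.mem_Icc, Finset.mem_filter, Finset.mem_product] at ha
  exact hF' (by omega) (hT a.1 a.2 ha.1.1.1 ha.1.2.1)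

end Estimates

/-! ### Chain rules for composition with the coderivation -/

section Expansion

variable {𝕜 : Type u} [Field 𝕜] [CharZero 𝕜] {V : Type v} [AddCommGroup V] [Module 𝕜 V]
  {U : Type w} [AddCommGroup U] [Module 𝕜 U]
  {𝒱 : ℤ → Submodule 𝕜 V} [DirectSum.Decomposition 𝒱] {𝒰 : ℤ → Submodule 𝕜 U}
  {F : ℕ → Submodule 𝕜 V} {F' : ℕ → Submodule 𝕜 U}

section Deg

variable {n : ℕ} {ψ : MultilinearMap 𝕜 (fun _ : Fin n => V) U} {k : ℤ} (hψ : HasDeg 𝒱 𝒰 ψ k)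
  {x a b : V} (hx : x ∈ desusp 𝒱 0) {da db : ℤ} (ha : a ∈ desusp 𝒱 da) (hb : b ∈ desusp 𝒱 db)

include hψ hx

theorem HasDeg.apply_const_mem : ψ (fun _ => x) ∈ desusp 𝒰 k := by
  simpa using hψ (fun _ => 0) (fun _ => x) fun _ => hx

include ha

theorem HasDeg.ev₁_mem : ev₁ ψ x a ∈ desusp 𝒰 (da + k) := by
  refine Submodule.sum_mem _ fun α _ => ?_
  have := hψ _ _ (mem_desusp_update 𝒱 hx ha α)
  rwa [Finset.sum_update_of_mem (Finset.mem_univ _), Finset.sum_const_zero, add_zero] at this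

include hb

theorem HasDeg.ev₂_mem (s : ℤ) : ev₂ s ψ x a b ∈ desusp 𝒰 (da + db + k) := by
  refine Submodule.sum_mem _ fun α _ => Submodule.sum_mem _ fun β _ => ?_
  unfold ev₂Term
  by_cases h : α = β
  · simp [h]
  · rw [if_neg h]
    refine Submodule.smul_of_tower_mem _ _ ?_
    have := hψ (update (update (fun _ => (0 : ℤ)) α da) β db) (update (update (fun _ => x) α a) β b)
      fun i => by
        by_cases hi : i = β
        · subst hi; simpa using hb
        · rw [Function.update_of_ne hi, Function.update_of_ne hi]
          exact mem_desusp_update 𝒱 hx ha α i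
    have h1 : ∑ i, update (update (fun _ => (0 : ℤ)) α da) β db i = da + db := by
      rw [Finset.sum_update_of_mem (Finset.mem_univ _), Finset.sum_update_of_mem (by simp [h])]
      simp [add_comm]
    rwa [h1] at this

end Deg

variable (hF : F 1 = ⊤) (hF' : Antitone F')
  {ϕ : Taylor 𝕜 V U} {q : Taylor 𝕜 V V} (hϕs : ∀ n ≥ 1, IsSym 𝒱 (ϕ n))
  (hϕc : ∀ n ≥ 1, IsCont F F' (ϕ n)) (hqd : ∀ n ≥ 1, HasDeg 𝒱 𝒱 (q n) 1)
  (hqc : ∀ n ≥ 1, IsCont F F (q n)) {x a : V} (hx : x ∈ desusp 𝒱 0)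

theorem term₁_mem (hF : F 1 = ⊤) (hϕc : ∀ n ≥ 1, IsCont F F' (ϕ n)) (x : V) {n p : ℕ} (hn : 1 ≤ n)
    (hp : 1 ≤ p) {a : V} (ha : a ∈ F p) : term₁ ϕ n x a ∈ F' (n - 1 + p) := by
  rw [term₁_apply]
  exact Submodule.smul_mem _ _ ((hϕc n hn).ev₁_mem hF x hp ha)

theorem term₂_mem (hF : F 1 = ⊤) (hϕc : ∀ n ≥ 1, IsCont F F' (ϕ n)) (s : ℤ) (x : V) {n p : ℕ}
    (hn : 1 ≤ n) (hp : 1 ≤ p) {a : V} (ha : a ∈ F p) (b : V) :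
    term₂ s ϕ n x a b ∈ F' (n - 1 + p) := by
  rw [term₂_apply]
  exact Submodule.smul_mem _ _ ((hϕc n hn).ev₂_mem hF s x b hp ha)

theorem term₀_mem (hF : F 1 = ⊤) (hϕc : ∀ n ≥ 1, IsCont F F' (ϕ n)) (x : V) {n : ℕ}
    (hn : 1 ≤ n) : term₀ ϕ n x ∈ F' n :=
  Submodule.smul_mem _ _ ((hϕc n hn).apply_const_mem hF x)

theorem der₁_mem (hF : F 1 = ⊤) (hF' : Antitone F') (hϕc : ∀ n ≥ 1, IsCont F F' (ϕ n)) (M : ℕ)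
    (x : V) {p : ℕ} (hp : 1 ≤ p) {a : V} (ha : a ∈ F p) : der₁ ϕ M x a ∈ F' p := by
  rw [der₁_apply]
  refine Submodule.sum_mem _ fun n hn => ?_
  have := (Finset.mem_Icc.1 hn).1
  exact hF' (by omega) (term₁_mem hF hϕc x this hp ha)

theorem der₂_mem (hF : F 1 = ⊤) (hF' : Antitone F') (hϕc : ∀ n ≥ 1, IsCont F F' (ϕ n)) (s : ℤ)
    (M : ℕ) (x : V) {p : ℕ} (hp : 1 ≤ p) {a : V} (ha : a ∈ F p) (b : V) :
    der₂ s ϕ M x a b ∈ F' p := by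
  rw [der₂_apply]
  refine Submodule.sum_mem _ fun n hn => ?_
  have := (Finset.mem_Icc.1 hn).1
  exact hF' (by omega) (term₂_mem hF hϕc s x this hp ha b)

theorem sum_term₁ (T : ℕ → V) (M : ℕ) : ∑ j ∈ Finset.Icc 1 M, ∑ k ∈ Finset.Icc 1 M,
    term₁ ϕ k x (T j) = der₁ ϕ M x (∑ j ∈ Finset.Icc 1 M, T j) := by
  simp only [der₁_apply, map_sum]

theorem sum_term₂ (s : ℤ) (T : ℕ → V) (a : V) (M : ℕ) : ∑ j ∈ Finset.Icc 1 M,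
    ∑ k ∈ Finset.Icc 1 M, term₂ s ϕ k x (T j) a =
      der₂ s ϕ M x (∑ j ∈ Finset.Icc 1 M, T j) a := by
  simp only [der₂_apply, map_sum, LinearMap.sum_apply]

include hF hF' hϕs hϕc hqd hqc hx

theorem expSum_coder (M : ℕ) :
    expSum (coder 𝒱 ϕ q) 1 x M ≡ der₁ ϕ M x (expSum q 1 x M) [SMOD F' M] := by
  have h1 := sum_triangle hF' (fun j k => term₁ ϕ k x (term₀ q j x))
    (fun j k hj hk => by
      have := term₁_mem hF hϕc x hk hj (term₀_mem hF hqc x hj)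
      rwa [show k - 1 + j = j + k - 1 by omega] at this) M
  rw [sum_term₁] at h1
  rw [expSum_eq, expSum_eq]
  refine SModEq.trans (smodEq_of_eq ?_) h1
  refine Finset.sum_congr rfl fun n hn => ?_
  rw [term₀, coder, sum_apply, Finset.smul_sum]
  refine Finset.sum_congr rfl fun j _ => ?_
  rw [apply_const_compCoder 𝒱 _ _ hx (hϕs _ (by omega)) ((hqd _ (by omega)).apply_const_mem hx),
    term₁_apply, term₀]

/-- Differentiates (ϕ Q)(x) = ϕ'_x(Q(x)) in the direction a: either Q(x) or ϕ'_x is differentiated,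
the latter with the sign of exchanging Q(x) and a. -/
theorem der₁_coder {da : ℤ} (ha : a ∈ desusp 𝒱 da) (M : ℕ) :
    der₁ (coder 𝒱 ϕ q) M x a ≡ der₁ ϕ M x (der₁ q M x a) +
      der₂ (ksgn 1 da) ϕ M x (expSum q 1 x M) a [SMOD F' M] := by
  have ha1 : a ∈ F 1 := by simp [hF]
  have h1 := sum_triangle hF'
    (fun j k => term₁ ϕ k x (term₁ q j x a) + term₂ (ksgn 1 da) ϕ k x (term₀ q j x) a)
    (fun j k hj hk => by
      have := Submodule.add_mem _ (term₁_mem hF hϕc x hk (by omega) (term₁_mem hF hqc x hj le_rfl ha1))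
        (term₂_mem (p := j - 1 + 1) hF hϕc (ksgn 1 da) x hk (by omega)
          (by rw [Nat.sub_add_cancel hj]; exact (term₀_mem hF hqc x hj)) a)
      rwa [show k - 1 + (j - 1 + 1) = j + k - 1 by omega] at this) M
  simp only [Finset.sum_add_distrib] at h1
  rw [sum_term₁, sum_term₂] at h1
  rw [der₁_apply, der₁_apply q, expSum_eq]
  refine SModEq.trans (smodEq_of_eq ?_) h1
  rw [← Finset.sum_add_distrib]
  refine Finset.sum_congr rfl fun n hn => ?_
  rw [term₁_apply, coder, ev₁_sum, Finset.smul_sum, ← Finset.sum_add_distrib]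
  refine Finset.sum_congr rfl fun j _ => ?_
  rw [ev₁_compCoder 𝒱 _ _ hx ha (hϕs _ (by omega)) ((hqd _ (by omega)).apply_const_mem hx)
    ((hqd _ (by omega)).ev₁_mem hx ha), smul_add, term₁_apply, term₁_apply, term₂_apply, term₀]

/-- The second derivative of `coder ϕ q` in the directions of the curvature and of an odd `a`. -/
theorem der₂_coder (ha : a ∈ desusp 𝒱 (-1)) (M : ℕ) :
    der₂ (-1) (coder 𝒱 ϕ q) M x (expSum q 1 x M) a ≡
      der₁ ϕ M x (der₂ (-1) q M x (expSum q 1 x M) a) +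
      der₂ 1 ϕ M x (der₁ q M x (expSum q 1 x M)) a -
      der₂ 1 ϕ M x (der₁ q M x a) (expSum q 1 x M) [SMOD F' M] := by
  have ha1 : a ∈ F 1 := by simp [hF]
  set c := expSum q 1 x M with hc
  have hcd : c ∈ desusp 𝒱 1 := Submodule.sum_mem _ fun n hn =>
    Submodule.smul_mem _ _ ((hqd _ (Finset.mem_Icc.1 hn).1).apply_const_mem hx)
  have hc1 : c ∈ F 1 := by simp [hF]
  have hk : ksgn 1 (-1) = -1 := by decide
  have h1 := sum_triangle hF'
    (fun j k => (term₁ ϕ k x (term₂ (-1) q j x c a) + term₂ 1 ϕ k x (term₁ q j x c) a +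
      -term₂ 1 ϕ k x (term₁ q j x a) c) + (((k - 1).factorial : ℕ) : 𝕜)⁻¹ •
        ev₂ (-1) ((ϕ (k - 1 + 1)).curryLeft (term₀ q j x)) x c a)
    (fun j k hj hk => by
      have h1 := term₁_mem hF hϕc x hk (by omega) (term₂_mem hF hqc (-1) x hj le_rfl hc1 a)
      have h2 := term₂_mem hF hϕc 1 x hk (by omega) (term₁_mem hF hqc x hj le_rfl hc1) a
      have h3 := term₂_mem hF hϕc 1 x hk (by omega) (term₁_mem hF hqc x hj le_rfl ha1) c
      have h4 := (hϕc (k - 1 + 1) (by omega)).curryLeft_ev₂_mem hF (-1) x c a hj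
        (term₀_mem hF hqc x hj)
      rw [show k - 1 + (j - 1 + 1) = j + k - 1 by omega] at h1 h2 h3
      rw [show k - 1 + j = j + k - 1 by omega] at h4
      exact Submodule.add_mem _ (Submodule.add_mem _ (Submodule.add_mem _ h1 h2)
        (Submodule.neg_mem _ h3)) (Submodule.smul_mem _ _ h4)) M
  simp only [Finset.sum_add_distrib, Finset.sum_neg_distrib] at h1
  -- Summed over j first, the curried direction becomes c, which is odd and already occurs once as a
  -- direction.
  have h5 : ∑ j ∈ Finset.Icc 1 M, ∑ k ∈ Finset.Icc 1 M, (((k - 1).factorial : ℕ) : 𝕜)⁻¹ •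
      ev₂ (-1) ((ϕ (k - 1 + 1)).curryLeft (term₀ q j x)) x c a = 0 := by
    rw [Finset.sum_comm]
    refine Finset.sum_eq_zero fun k _ => ?_
    rw [← Finset.smul_sum, ← ev₂_sum, ← map_sum, ← expSum_eq, ← hc,
      ev₂_curryLeft_self 𝒱 (hϕs _ (by omega)) hx ha hcd (by decide), smul_zero]
  rw [sum_term₁, sum_term₂, sum_term₂, h5, add_zero] at h1
  rw [sub_eq_add_neg, der₂_apply, der₂_apply _ q, der₁_apply q, der₁_apply q]
  refine SModEq.trans (smodEq_of_eq ?_) h1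
  simp only [← Finset.sum_add_distrib, ← Finset.sum_neg_distrib]
  refine Finset.sum_congr rfl fun n hn => ?_
  rw [term₂_apply, coder, ev₂_sum, Finset.smul_sum]
  refine Finset.sum_congr rfl fun j _ => ?_
  have h6 := ev₂_compCoder 𝒱 (h := show (j : ℕ) + 1 + (n - (j + 1)) = n by omega) (q (j + 1)) hx
    hcd ha (hϕs (n - (j + 1) + 1) (by omega)) ((hqd (j + 1) (by omega)).ev₁_mem hx hcd)
    ((hqd (j + 1) (by omega)).ev₁_mem hx ha) ((hqd (j + 1) (by omega)).ev₂_mem hx hcd ha _)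
  rw [hk, show ksgn (1 + 1) (-1) = 1 by decide, show ksgn (-1 + 1) 1 = 1 by decide] at h6
  rw [h6, smul_add, smul_add, term₁_apply, term₂_apply, term₂_apply, term₂_apply, term₁_apply,
    term₁_apply, term₀, neg_one_smul, smul_neg]
  rfl

end Expansion

/-! ### The tangent field along the fibres of the transferred morphism -/

section Tangent

variable {𝕜 : Type u} [Field 𝕜] [CharZero 𝕜] {V : Type v} [AddCommGroup V] [Module 𝕜 V]
  {W : Type w} [AddCommGroup W] [Module 𝕜 W]
  {𝒱 : ℤ → Submodule 𝕜 V} [DirectSum.Decomposition 𝒱]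
  {𝒲 : ℤ → Submodule 𝕜 W} [DirectSum.Decomposition 𝒲]
  {FV : ℕ → Submodule 𝕜 V} {q : Taylor 𝕜 V V}
  {dW : W →ₗ[𝕜] W} {f : W →ₗ[𝕜] V} {g : V →ₗ[𝕜] W} {K : V →ₗ[𝕜] V}

theorem mem_desusp_zero {x : V} : x ∈ desusp 𝒱 0 ↔ x ∈ 𝒱 1 := by simp [desusp]

theorem mem_desusp_one {x : V} : x ∈ desusp 𝒱 1 ↔ x ∈ 𝒱 2 := by
  simp [desusp]

theorem mem_desusp_neg_one {x : V} : x ∈ desusp 𝒱 (-1) ↔ x ∈ 𝒱 0 := by simp [desusp]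

variable (hc : IsCompleteContraction 𝒱 FV (linearPart q) 𝒲 dW f g K)
  (hq : IsCompleteLInfty 𝒱 FV q)

include hc hq

theorem antitone_inducedFiltration : Antitone (inducedFiltration FV f) := fun _ _ h _ hx =>
  hc.completeGraded.antitone h hx

/-- The truncated tangent field `x ↦ Q'_x(K x) + K Q(x)`. -/
noncomputable def tangent (q : Taylor 𝕜 V V) (K : V →ₗ[𝕜] V) (M : ℕ) (x : V) : V :=
  der₁ q M x (K x) + K (expSum q 1 x M)

variable {x : V} (hx : x ∈ 𝒱 1) (M : ℕ)

include hx

theorem expSum_q_mem : expSum q 1 x M ∈ 𝒱 2 := mem_desusp_one.1 <|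
  Submodule.sum_mem _ fun n hn => Submodule.smul_mem _ _
    ((hq.hasDeg n (Finset.mem_Icc.1 hn).1).apply_const_mem (mem_desusp_zero.2 hx))

theorem der₁_K_mem : der₁ q M x (K x) ∈ 𝒱 1 := by
  rw [der₁_apply]
  refine Submodule.sum_mem _ fun n hn => ?_
  rw [term₁_apply]
  exact Submodule.smul_mem _ _ (mem_desusp_zero.1 ((hq.hasDeg n (Finset.mem_Icc.1 hn).1).ev₁_mem
    (mem_desusp_zero.2 hx) (mem_desusp_neg_one.2 (hc.K_degree _ _ hx))))

theorem tangent_mem : tangent q K M x ∈ 𝒱 1 :=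
  Submodule.add_mem _ (der₁_K_mem hc hq hx M) (hc.K_degree _ _ (expSum_q_mem hc hq hx M))

omit hq in
theorem der₁_K_eq_zero {ϕ : Taylor 𝕜 V W} (hϕ : ∀ n, oddDer 𝒱 K (ϕ n) = 0) :
    der₁ ϕ M x (K x) = 0 := by
  rw [der₁_apply]
  refine Finset.sum_eq_zero fun n _ => ?_
  rw [term₁_apply, ← oddDer_apply_const 𝒱 (mem_desusp_zero.2 hx), hϕ]
  simp

omit hq in
-- The derivative in the direction b of the identity saying that the odd derivation K annihilates ϕ.
theorem der₁_K_apply {ϕ : Taylor 𝕜 V W} (hϕ : ∀ n, oddDer 𝒱 K (ϕ n) = 0) {b : V} {d : ℤ}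
    (hb : b ∈ desusp 𝒱 d) :
    der₁ ϕ M x (K b) = -der₂ (zsign (d : ZMod 2)) ϕ M x (K x) b := by
  rw [der₁_apply, der₂_apply, eq_neg_iff_add_eq_zero, ← Finset.sum_add_distrib]
  refine Finset.sum_eq_zero fun n _ => ?_
  rw [term₁_apply, term₂_apply, ← smul_add, add_comm,
    ← ev₁_oddDer 𝒱 (mem_desusp_zero.2 hx) hb, hϕ]
  simp [ev₁]

omit hc hq hx in
theorem der₂_comm (ϕ : Taylor 𝕜 V W) (s : ℤ) (hs : s * s = 1) (x a b : V) :
    der₂ s ϕ M x a b = s • der₂ s ϕ M x b a := by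
  rw [der₂_apply, der₂_apply, Finset.smul_sum]
  refine Finset.sum_congr rfl fun n _ => ?_
  rw [term₂_apply, term₂_apply, ev₂_comm s hs, smul_comm]

/-- Since K annihilates G Q, its derivative along K x vanishes: G'(Q'(K x)) + G''(c, K x) = 0 with c
= Q(x). Since K annihilates G, G'(K c) = -G''(K x, c). The second derivative is antisymmetric in
these odd directions, so the two parts of the tangent field cancel. -/
theorem der₁_transferG_tangent :
    der₁ (transferG 𝒱 q f g K) M x (tangent q K M x) ∈ inducedFiltration FV f M := by
  have hC := mem_desusp_one.2 (expSum_q_mem hc hq hx M)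
  have h1 := der₁_coder hc.completeGraded.one (antitone_inducedFiltration hc hq)
    (fun n _ => isSym_transferG (q := q) hc n) (fun n _ => isCont_transferG hc hq n) hq.hasDeg
    hq.isCont (mem_desusp_zero.2 hx) (mem_desusp_neg_one.2 (hc.K_degree _ _ hx)) M
  rw [der₁_K_eq_zero hc hx M (oddDer_coder_transferG hc hq), show ksgn 1 (-1) = -1 by decide,
    der₂_comm M _ (-1) (by norm_num)] at h1
  rw [tangent, map_add, der₁_K_apply hc hx M (oddDer_transferG hc hq) hC,
    show zsign ((1 : ℤ) : ZMod 2) = -1 by decide]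
  rw [neg_one_smul] at h1
  exact SModEq.zero.1 h1.symm

/-- Let c = Q(x) and e = Q'(K x). The derivative equals (G Q)'(e) + (G Q)''(c, K x). In the
expansion G''(c, e) cancels, and what remains is G'(Q'(e) + Q''(c, K x)) + G''(Q'(c), K x); both
inner expressions vanish by Q² = 0. -/
theorem der₁_coder_transferG_tangent (hM : 1 ≤ M) :
    der₁ (coder 𝒱 (transferG 𝒱 q f g K) q) M x (tangent q K M x) ∈ inducedFiltration FV f M := by
  have hx0 := mem_desusp_zero.2 hx
  have hC := mem_desusp_one.2 (expSum_q_mem hc hq hx M)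
  have he := mem_desusp_zero.2 (der₁_K_mem hc hq hx M)
  have hKx := mem_desusp_neg_one.2 (hc.K_degree _ _ hx)
  have hF := antitone_inducedFiltration hc hq
  have hF1 := hc.completeGraded.one
  have hγ : ∀ n ≥ 1, IsCont FV (inducedFiltration FV f) (transferG 𝒱 q f g K n) :=
    fun n _ => isCont_transferG hc hq n
  have h1 := der₁_coder hF1 hF (fun n _ => isSym_transferG (q := q) hc n) hγ hq.hasDeg
    hq.isCont hx0 he M
  have h2 := der₂_coder hF1 hF (fun n _ => isSym_transferG (q := q) hc n) hγ hq.hasDeg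
    hq.isCont hx0 hKx M
  have h3 := der₁_coder hF1 hc.completeGraded.antitone hq.isSym hq.isCont hq.hasDeg
    hq.isCont hx0 hKx M
  have h4 := expSum_coder hF1 hc.completeGraded.antitone hq.isSym hq.isCont hq.hasDeg
    hq.isCont hx0 M
  have h5 : der₁ (coder 𝒱 q q) M x (K x) = 0 := by
    simp [der₁_apply, term₁_apply, hq.coder_eq_zero, ev₁]
  have h6 : expSum (coder 𝒱 q q) 1 x M = 0 := by simp [expSum, hq.coder_eq_zero]
  rw [h5, show ksgn 1 (-1) = -1 by decide] at h3
  rw [h6] at h4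
  have h7 := der₁_mem hF1 hF hγ M x hM (SModEq.zero.1 h3.symm)
  have h8 := der₂_mem hF1 hF hγ 1 M x hM (SModEq.zero.1 h4.symm) (K x)
  rw [show ksgn 1 0 = 1 by decide] at h1
  rw [tangent, map_add, der₁_K_apply hc hx M (oddDer_coder_transferG hc hq) hC,
    show zsign ((1 : ℤ) : ZMod 2) = -1 by decide, der₂_comm M _ (-1) (by norm_num), neg_one_smul,
    neg_neg]
  refine SModEq.zero.1 ((h1.add h2).trans (SModEq.zero.2 ?_))
  rw [der₂_comm M _ 1 (by norm_num) x (der₁ q M x (K x)), one_smul]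
  rw [map_add] at h7
  convert Submodule.add_mem _ h7 h8 using 1
  abel

end Tangent

/-! ### Polynomial maps -/

section Poly

variable {𝕜 : Type*} [Field 𝕜] {A B C : Type*} [AddCommGroup A] [Module 𝕜 A]
  [AddCommGroup B] [Module 𝕜 B] [AddCommGroup C] [Module 𝕜 C]

/-- The restriction of a multilinear map to the diagonal. -/
def diagLin (𝕜 A B : Type*) [Field 𝕜] [AddCommGroup A] [Module 𝕜 A] [AddCommGroup B] [Module 𝕜 B]
    (k : ℕ) : MultilinearMap 𝕜 (fun _ : Fin k => A) B →ₗ[𝕜] (A → B) where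
  toFun m x := m fun _ => x
  map_add' _ _ := rfl
  map_smul' _ _ := rfl

theorem diagLin_apply {k : ℕ} (m : MultilinearMap 𝕜 (fun _ : Fin k => A) B) (x : A) :
    diagLin 𝕜 A B k m x = m fun _ => x := rfl

/-- Polynomial maps: sums of restrictions of multilinear maps to the diagonal. -/
def polyMaps (𝕜 A B : Type*) [Field 𝕜] [AddCommGroup A] [Module 𝕜 A] [AddCommGroup B]
    [Module 𝕜 B] : Submodule 𝕜 (A → B) :=
  ⨆ k, LinearMap.range (diagLin 𝕜 A B k)

theorem diag_mem_polyMaps {k : ℕ} (m : MultilinearMap 𝕜 (fun _ : Fin k => A) B) :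
    (fun x => m fun _ => x) ∈ polyMaps 𝕜 A B :=
  Submodule.mem_iSup_of_mem k ⟨m, rfl⟩

theorem exists_diag_of_mem_polyMaps {D : A → B} (hD : D ∈ polyMaps 𝕜 A B) :
    ∃ (S : Finset ℕ) (m : (k : ℕ) → MultilinearMap 𝕜 (fun _ : Fin k => A) B),
      (∀ k ∉ S, m k = 0) ∧ ∀ x, D x = ∑ k ∈ S, m k fun _ => x := by
  classical
  obtain ⟨f, hf, rfl⟩ := (Submodule.mem_iSup_iff_exists_finsupp _ _).1 hD
  choose m hm using hf
  refine ⟨f.support, fun k => if k ∈ f.support then m k else 0, fun k hk => if_neg hk,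
    fun x => ?_⟩
  rw [Finsupp.sum, Finset.sum_apply]
  refine Finset.sum_congr rfl fun k hk => ?_
  simp only [if_pos hk, ← hm k, diagLin_apply]

theorem const_mem_polyMaps (b : B) : (fun _ => b) ∈ polyMaps 𝕜 A B :=
  diag_mem_polyMaps (MultilinearMap.constOfIsEmpty 𝕜 (fun _ : Fin 0 => A) b)

theorem linear_mem_polyMaps (L : A →ₗ[𝕜] B) : (fun x => L x) ∈ polyMaps 𝕜 A B :=
  diag_mem_polyMaps (MultilinearMap.ofSubsingleton 𝕜 A B (0 : Fin 1) L)

/-- Expanding the sums writes the composite as a sum of diagonals of composed multilinear maps. -/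
theorem multilinear_comp_mem_polyMaps {n : ℕ} (r : MultilinearMap 𝕜 (fun _ : Fin n => B) C)
    {D : Fin n → A → B} (hD : ∀ i, D i ∈ polyMaps 𝕜 A B) :
    (fun x => r fun i => D i x) ∈ polyMaps 𝕜 A C := by
  classical
  choose S m _ hm using fun i => exists_diag_of_mem_polyMaps (hD i)
  have h1 : (fun x => r fun i => D i x) = ∑ κ ∈ Fintype.piFinset S,
      fun x => ((r.compMultilinearMap fun i => m i (κ i)).domDomCongr finSigmaFinEquiv)
        fun _ => x := by
    funext x
    simp only [hm, Finset.sum_apply]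
    rw [MultilinearMap.map_sum_finset]
    rfl
  rw [h1]
  exact Submodule.sum_mem _ fun κ _ => diag_mem_polyMaps _

theorem comp_mem_polyMaps {D : B → C} (hD : D ∈ polyMaps 𝕜 B C) {c : A → B}
    (hc : c ∈ polyMaps 𝕜 A B) : (fun x => D (c x)) ∈ polyMaps 𝕜 A C := by
  obtain ⟨S, m, -, hm⟩ := exists_diag_of_mem_polyMaps hD
  have : (fun x => D (c x)) = ∑ k ∈ S, fun x => m k fun _ => c x := by
    funext x
    simp [hm]
  rw [this]
  exact Submodule.sum_mem _ fun k _ => multilinear_comp_mem_polyMaps _ fun _ => hc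

theorem add_mem_polyMaps {c d : A → B} (hc : c ∈ polyMaps 𝕜 A B) (hd : d ∈ polyMaps 𝕜 A B) :
    (fun x => c x + d x) ∈ polyMaps 𝕜 A B :=
  Submodule.add_mem _ hc hd

theorem sum_mem_polyMaps {ι : Type*} (S : Finset ι) {c : ι → A → B}
    (hc : ∀ i ∈ S, c i ∈ polyMaps 𝕜 A B) : (fun x => ∑ i ∈ S, c i x) ∈ polyMaps 𝕜 A B := by
  have : (fun x => ∑ i ∈ S, c i x) = ∑ i ∈ S, c i := by
    funext x; simp
  rw [this]
  exact Submodule.sum_mem _ hc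

theorem const_smul_mem_polyMaps (s : 𝕜) {c : A → B} (hc : c ∈ polyMaps 𝕜 A B) :
    (fun x => s • c x) ∈ polyMaps 𝕜 A B :=
  Submodule.smul_mem _ s hc

theorem id_smul_mem_polyMaps {c : 𝕜 → B} (hc : c ∈ polyMaps 𝕜 𝕜 B) :
    (fun t => t • c t) ∈ polyMaps 𝕜 𝕜 B := by
  obtain ⟨S, m, -, hm⟩ := exists_diag_of_mem_polyMaps hc
  simp only [hm, Finset.smul_sum]
  refine sum_mem_polyMaps _ fun k _ => ?_
  -- Multiplication by t becomes one additional argument.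
  have := diag_mem_polyMaps (𝕜 := 𝕜) (A := 𝕜) (B := B) (k := k + 1)
    (LinearMap.uncurryLeft (LinearMap.toSpanSingleton 𝕜 _ (m k)))
  exact this

theorem pow_smul_mem_polyMaps (k : ℕ) {c : 𝕜 → B} (hc : c ∈ polyMaps 𝕜 𝕜 B) :
    (fun t => t ^ k • c t) ∈ polyMaps 𝕜 𝕜 B := by
  induction k with
  | zero => simpa using hc
  | succ k ih =>
    have := id_smul_mem_polyMaps ih
    simpa only [smul_smul, ← pow_succ'] using this

theorem apply_smul_const {k : ℕ} (m : MultilinearMap 𝕜 (fun _ : Fin k => A) B) (s : 𝕜) (x : A) :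
    (m fun _ => s • x) = s ^ k • m fun _ => x := by
  have := m.map_smul_univ (fun _ => s) fun _ => x
  simpa using this

/-- Linear functionals reduce this to scalar polynomials, where characteristic zero provides
infinitely many points. -/
theorem coeff_eq_zero [CharZero 𝕜] (S : Finset ℕ) (b : ℕ → B)
    (h : ∀ t : 𝕜, ∑ k ∈ S, t ^ k • b k = 0) : ∀ k ∈ S, b k = 0 := by
  intro k hk
  rw [← Module.forall_dual_apply_eq_zero_iff 𝕜]
  intro φ
  have h1 : (∑ k ∈ S, Polynomial.C (φ (b k)) * Polynomial.X ^ k : Polynomial 𝕜) = 0 := by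
    refine Polynomial.funext fun t => ?_
    have := congrArg φ (h t)
    simp only [map_sum, map_smul, smul_eq_mul, map_zero] at this
    simp only [Polynomial.eval_finsetSum, Polynomial.eval_mul, Polynomial.eval_C,
      Polynomial.eval_pow, Polynomial.eval_X, Polynomial.eval_zero, ← this]
    exact Finset.sum_congr rfl fun k _ => mul_comm _ _
  have h2 := congrArg (fun P : Polynomial 𝕜 => P.coeff k) h1
  simpa [Polynomial.finsetSum_coeff, Polynomial.coeff_C_mul, Polynomial.coeff_X_pow, hk] using h2

/-- Algebraic continuity. Multiplying by t gives an identity valid at t = 0 too, from which the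
coefficients can be read off. -/
theorem apply_zero_of_polyMaps [CharZero 𝕜] {h : 𝕜 → B} (hh : h ∈ polyMaps 𝕜 𝕜 B)
    (h0 : ∀ t ≠ 0, h t = 0) : h 0 = 0 := by
  obtain ⟨S, m, -, hm⟩ := exists_diag_of_mem_polyMaps hh
  have h1 : ∀ k (t : 𝕜), (m k fun _ => t) = t ^ k • m k fun _ => 1 := fun k t => by
    rw [← apply_smul_const]; simp
  have h2 : ∀ t : 𝕜, ∑ k ∈ S.map (addRightEmbedding 1), t ^ k • (m (k - 1) fun _ => 1) = 0 := by
    intro t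
    rw [Finset.sum_map]
    by_cases ht : t = 0
    · subst ht; simp
    · have := congrArg (t • ·) (h0 t ht)
      simp only [hm, Finset.smul_sum, smul_zero] at this
      rw [← this]
      refine Finset.sum_congr rfl fun k _ => ?_
      rw [h1 k t, smul_smul, ← pow_succ']
      rfl
  have h3 := coeff_eq_zero _ _ h2
  rw [hm]
  refine Finset.sum_eq_zero fun k hk => ?_
  have := h3 (k + 1) (by simpa using hk)
  rw [Nat.add_sub_cancel] at this
  rw [h1, this, smul_zero]

/-- Divide by t and let t tend to 0. This extracts first-order terms without any topology. -/
theorem eq_zero_of_smul_eq [CharZero 𝕜] {e : B} {ρ : 𝕜 → B} (hρ : ρ ∈ polyMaps 𝕜 𝕜 B)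
    (h : ∀ t : 𝕜, t • e = t ^ 2 • ρ t) : e = 0 := by
  have := apply_zero_of_polyMaps (h := fun t => e - t • ρ t)
    (Submodule.sub_mem _ (const_mem_polyMaps e) (id_smul_mem_polyMaps hρ)) fun t ht => by
      have h1 := h t
      rw [pow_two, mul_smul] at h1
      rw [smul_right_injective B ht h1, sub_self]
  simpa using this

/-- Taylor expansion to first order. -/
theorem apply_add_smul {n : ℕ} (m : MultilinearMap 𝕜 (fun _ : Fin n => A) B) (x a : A) :
    ∃ ρ ∈ polyMaps 𝕜 𝕜 B, ∀ t : 𝕜,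
      (m fun _ => x + t • a) = (m fun _ => x) + t • ev₁ m x a + t ^ 2 • ρ t := by
  classical
  -- The remainder collects the terms with a in at least two slots, after division by t².
  refine ⟨fun t => ∑ s : Finset (Fin n) with 2 ≤ s.card, t ^ (s.card - 2) •
    m (s.piecewise (fun _ => a) fun _ => x),
    sum_mem_polyMaps _ fun s _ => pow_smul_mem_polyMaps _ (const_mem_polyMaps _), fun t => ?_⟩
  have h := m.map_add_eq_map_add_linearDeriv_add (fun _ => x) fun _ => t • a
  rw [MultilinearMap.linearDeriv_apply] at h
  refine (h.trans ?_)
  congr 2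
  · rw [ev₁, Finset.smul_sum]
    exact Finset.sum_congr rfl fun i _ => m.map_update_smul _ _ _ _
  · rw [Finset.smul_sum]
    refine Finset.sum_congr rfl fun s hs => ?_
    rw [smul_smul, ← pow_add, Nat.add_sub_cancel' (Finset.mem_filter.1 hs).2]
    have := m.map_piecewise_smul (fun _ => t) (s.piecewise (fun _ => a) fun _ => x) s
    simp only [Finset.prod_const] at this
    rw [← this]
    congr 1
    funext i
    by_cases hi : i ∈ s <;> simp [hi]

/-- A polynomial expression in `w + t²ρ(t)` agrees with its value at `w` up to order two. -/
theorem apply_add_sq_smul {n : ℕ} (m : MultilinearMap 𝕜 (fun _ : Fin n => A) B) (x : A)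
    {ρ : 𝕜 → A} (hρ : ρ ∈ polyMaps 𝕜 𝕜 A) :
    ∃ ρ' ∈ polyMaps 𝕜 𝕜 B, ∀ t : 𝕜,
      (m fun _ => x + t ^ 2 • ρ t) = (m fun _ => x) + t ^ 2 • ρ' t := by
  classical
  let m' : Finset (Fin n) → 𝕜 → B := fun s t => m (s.piecewise (fun _ => x) fun _ => ρ t)
  have hm' : ∀ s, m' s ∈ polyMaps 𝕜 𝕜 B := fun s => by
    have := multilinear_comp_mem_polyMaps m (D := fun i t => if i ∈ s then x else ρ t) fun i => by
      by_cases hi : i ∈ s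
      · simpa [hi] using const_mem_polyMaps x
      · simpa [hi] using hρ
    exact this
  refine ⟨fun t => ∑ s ∈ Finset.univ.erase Finset.univ, t ^ (2 * sᶜ.card - 2) • m' s t,
    sum_mem_polyMaps _ fun s _ => pow_smul_mem_polyMaps _ (hm' s), fun t => ?_⟩
  have h1 : ∀ s : Finset (Fin n), m (s.piecewise (fun _ => x) fun _ => t ^ 2 • ρ t) =
      t ^ (2 * sᶜ.card) • m' s t := fun s => by
    have := m.map_piecewise_smul (fun _ => t ^ 2) (s.piecewise (fun _ => x) fun _ => ρ t) sᶜ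
    simp only [Finset.prod_const, ← pow_mul] at this
    rw [← this]
    congr 1
    funext i
    by_cases hi : i ∈ s <;> simp [hi]
  have h2 := m.map_add_univ (fun _ => x) fun _ => t ^ 2 • ρ t
  refine h2.trans ?_
  rw [← Finset.add_sum_erase _ _ (Finset.mem_univ Finset.univ), Finset.smul_sum]
  congr 1
  · simp
  · refine Finset.sum_congr rfl fun s hs => ?_
    have : 1 ≤ sᶜ.card := by
      rw [Nat.one_le_iff_ne_zero, Ne, Finset.card_eq_zero, Finset.compl_eq_empty_iff]
      exact (Finset.mem_erase.1 hs).1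
    rw [h1, smul_smul, ← pow_add, Nat.add_sub_cancel' (by omega)]

theorem ev₁_smul_smul {n : ℕ} (m : MultilinearMap 𝕜 (fun _ : Fin n => A) B) (s : 𝕜) (x a : A) :
    ev₁ m (s • x) (s • a) = s ^ n • ev₁ m x a := by
  simp only [ev₁, Finset.smul_sum]
  refine Finset.sum_congr rfl fun α _ => ?_
  have := m.map_smul_univ (fun _ => s) (update (fun _ => x) α a)
  simp only [Finset.prod_const, Finset.card_univ, Fintype.card_fin] at this
  rw [← this]
  congr 1
  funext i
  by_cases hi : i = α
  · subst hi; simp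
  · simp [hi]

/-- `ev₁ m x a` is the coefficient of t in m(x + t a). -/
theorem ev₁_eq_zero_of_diag [CharZero 𝕜] {n : ℕ} {m : MultilinearMap 𝕜 (fun _ : Fin n => A) B}
    (h : ∀ x, (m fun _ => x) = 0) (x a : A) : ev₁ m x a = 0 := by
  obtain ⟨ρ, hρ, h1⟩ := apply_add_smul m x a
  refine eq_zero_of_smul_eq (Submodule.neg_mem _ hρ) fun t => ?_
  have h2 := h1 t
  rw [h, h, zero_add] at h2
  rw [Pi.neg_apply, smul_neg]
  exact eq_neg_of_add_eq_zero_left h2.symm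

/-- A homogeneous polynomial map that vanishes on the image of `1 - p` and is constant along the
image of the projection `p` is zero. -/
theorem diag_eq_zero_of_projection [CharZero 𝕜] {n : ℕ}
    {m : MultilinearMap 𝕜 (fun _ : Fin n => A) B} {p : A →ₗ[𝕜] A} (hp : ∀ x, p (p x) = p x)
    (h1 : ∀ x, ev₁ m x (p x) = 0) (h2 : ∀ x, (m fun _ => x - p x) = 0) (x : A) :
    (m fun _ => x) = 0 := by
  set a := x - p x with ha
  set b := p x with hb
  have hpz : ∀ t : 𝕜, p (a + t • b) = t • b := fun t => by
    simp [ha, hb, hp]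
  obtain ⟨S, r, hrS, hr⟩ := exists_diag_of_mem_polyMaps (𝕜 := 𝕜)
    (multilinear_comp_mem_polyMaps (A := 𝕜) m
      (D := fun _ t => a + t • b) fun _ =>
        add_mem_polyMaps (const_mem_polyMaps a) (id_smul_mem_polyMaps (const_mem_polyMaps b)))
  have hev : ∀ (k : ℕ) (t : 𝕜), ev₁ (r k) t t = t ^ k • (k • r k fun _ => 1) := by
    intro k t
    have : ∀ α : Fin k, update (fun _ => t) α t = fun _ => t • (1 : 𝕜) := fun α => by
      funext i; simp
    simp only [ev₁, this, apply_smul_const]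
    rw [Finset.sum_const, Finset.card_univ, Fintype.card_fin, smul_comm]
  -- Euler's operator t d/dt applied to t ↦ m(a + t b) is the derivative at z = a + t b in the
  -- direction p z = t b, which is zero by hypothesis. So only the constant term survives.
  have h3 : ∀ t : 𝕜, ∑ k ∈ S, t ^ k • (k • r k fun _ => 1) = 0 := by
    intro t
    choose ρ hρ hρ' using fun k => apply_add_smul (r k) t t
    obtain ⟨ρ₀, hρ₀, hρ₀'⟩ := apply_add_smul m (a + t • b) (t • b)
    have h4 := h1 (a + t • b)
    rw [hpz] at h4
    refine eq_zero_of_smul_eq (ρ := fun s => ρ₀ s + -∑ k ∈ S, ρ k s)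
      (add_mem_polyMaps hρ₀ (Submodule.neg_mem _ (sum_mem_polyMaps _ fun k _ => hρ k)))
      fun s => ?_
    have h5 := hr (t + s • t)
    have h6 := hρ₀' s
    rw [h4, smul_zero, add_zero] at h6
    have h7 : a + (t + s • t) • b = a + t • b + s • t • b := by
      rw [add_smul, smul_assoc, add_assoc]
    rw [h7, h6, hr t, Finset.sum_congr rfl fun k _ => hρ' k s] at h5
    simp only [Finset.sum_add_distrib, hev, ← Finset.smul_sum] at h5
    rw [add_assoc] at h5
    rw [smul_add, smul_neg, add_left_cancel h5]
    abel
  have h4 := coeff_eq_zero S _ h3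
  have h5 : ∀ t : 𝕜, (m fun _ => a + t • b) = m fun _ => a := by
    have h6 : ∀ t : 𝕜, (m fun _ => a + t • b) = r 0 fun _ => 0 := by
      intro t
      rw [hr t]
      by_cases h0 : 0 ∈ S
      · rw [Finset.sum_eq_single_of_mem 0 h0]
        · congr 1
          funext i
          exact i.elim0
        · intro k hk hk0
          have := h4 k hk
          rw [← Nat.cast_smul_eq_nsmul 𝕜, smul_eq_zero_iff_right (Nat.cast_ne_zero.2 hk0)] at this
          have h7 := apply_smul_const (r k) t 1
          rw [this, smul_zero] at h7
          simpa using h7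
      · rw [hrS 0 h0]
        refine Finset.sum_eq_zero fun k hk => ?_
        have hk0 : k ≠ 0 := fun h => h0 (h ▸ hk)
        have := h4 k hk
        rw [← Nat.cast_smul_eq_nsmul 𝕜, smul_eq_zero_iff_right (Nat.cast_ne_zero.2 hk0)] at this
        have h7 := apply_smul_const (r k) t 1
        rw [this, smul_zero] at h7
        simpa using h7
    intro t
    have := h6 0
    rw [zero_smul, add_zero] at this
    rw [h6, this]
  have h6 := h5 1
  rw [one_smul, ha, hb, sub_add_cancel] at h6
  rw [h6, h2]

/-- Induction on homogeneous components. If all components below n vanish, rescaling x by s and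
taking the lowest order in s replaces L by its linear part -p and the zeros of D by their tangent
directions x - p x; then `diag_eq_zero_of_projection` applies to the component of degree n. -/
theorem polyMap_eq_zero [CharZero 𝕜] {D : A → B} (hD : D ∈ polyMaps 𝕜 A B) {p : A →ₗ[𝕜] A}
    (hp : ∀ x, p (p x) = p x) (L : A → A)
    (hL : ∀ x, ∃ l ∈ polyMaps 𝕜 𝕜 A, ∀ s : 𝕜, L (s • x) = s • (-p x + s • l s))
    (h1 : ∀ x, ∃ ρ ∈ polyMaps 𝕜 𝕜 B, ∀ t : 𝕜, D (x + t • L x) = D x + t ^ 2 • ρ t)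
    (h2 : ∀ x, ∃ u ∈ polyMaps 𝕜 𝕜 A, ∀ s : 𝕜, D (s • (x - p x + s • u s)) = 0) (x : A) :
    D x = 0 := by
  classical
  obtain ⟨S, m, hmS, hm⟩ := exists_diag_of_mem_polyMaps hD
  -- The first-order coefficient in t of D(x + t L x), collected over all components.
  have hev : ∀ x, ∑ k ∈ S, ev₁ (m k) x (L x) = 0 := by
    intro x
    obtain ⟨ρ₀, hρ₀, hρ₀'⟩ := h1 x
    choose ρ hρ hρ' using fun k => apply_add_smul (m k) x (L x)
    refine eq_zero_of_smul_eq (ρ := fun s => ρ₀ s + -∑ k ∈ S, ρ k s)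
      (add_mem_polyMaps hρ₀ (Submodule.neg_mem _ (sum_mem_polyMaps _ fun k _ => hρ k)))
      fun s => ?_
    have h5 := hm (x + s • L x)
    rw [hρ₀', hm x, Finset.sum_congr rfl fun k _ => hρ' k s] at h5
    simp only [Finset.sum_add_distrib, ← Finset.smul_sum] at h5
    rw [add_assoc] at h5
    rw [smul_add, smul_neg, add_left_cancel h5]
    abel
  /- Lowest order terms of a sum of homogeneous polynomials. -/
  have hlow : ∀ (n : ℕ) (c : ℕ → 𝕜 → B), (∀ k, c k ∈ polyMaps 𝕜 𝕜 B) → (∀ k < n, c k = 0) →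
      (∀ k ∉ S, c k = 0) → (∀ s : 𝕜, ∑ k ∈ S, s ^ k • c k s = 0) → c n 0 = 0 := by
    intro n c hc hn hS h
    have h3 := apply_zero_of_polyMaps (𝕜 := 𝕜) (h := fun s => ∑ k ∈ S, s ^ (k - n) • c k s)
      (sum_mem_polyMaps _ fun k _ => pow_smul_mem_polyMaps _ (hc k)) fun s hs => by
        refine smul_right_injective B (pow_ne_zero n hs) ?_
        simp only [Finset.smul_sum, smul_zero]
        rw [← h s]
        refine Finset.sum_congr rfl fun k _ => ?_
        by_cases hk : k < n
        · simp [hn k hk]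
        · rw [smul_smul, ← pow_add, Nat.add_sub_cancel' (not_lt.1 hk)]
    by_cases hnS : n ∈ S
    · rw [Finset.sum_eq_single_of_mem n hnS] at h3
      · simpa using h3
      · intro k _ hk
        rcases lt_or_gt_of_ne hk with hk | hk
        · simp [hn k hk]
        · simp [Nat.sub_ne_zero_of_lt hk]
    · rw [hS n hnS]; rfl
  have key : ∀ n, ∀ x, (m n fun _ => x) = 0 := by
    intro n
    induction n using Nat.strong_induction_on with
    | _ n ih =>
      refine diag_eq_zero_of_projection hp (fun x => ?_) fun x => ?_
      · obtain ⟨l, hl, hl'⟩ := hL x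
        have := hlow n (fun k s => ev₁ (m k) x (-p x + s • l s))
          (fun k => comp_mem_polyMaps (linear_mem_polyMaps (ev₁Lin (m k) x)) (c := fun s => -p x + s • l s)
            (add_mem_polyMaps (const_mem_polyMaps _) (id_smul_mem_polyMaps hl)) |> fun h => by
              simpa only [ev₁Lin_apply] using h)
          (fun k hk => funext fun s => ev₁_eq_zero_of_diag (ih k hk) _ _)
          (fun k hk => by rw [hmS k hk]; funext s; simp [ev₁]) fun s => by
            have h3 := hev (s • x)
            rw [hl'] at h3
            rw [← h3]
            exact Finset.sum_congr rfl fun k _ => (ev₁_smul_smul _ _ _ _).symm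
        rw [zero_smul, add_zero, ← ev₁Lin_apply, map_neg, neg_eq_zero, ev₁Lin_apply] at this
        exact this
      · obtain ⟨u, hu, hu'⟩ := h2 x
        have := hlow n (fun k s => m k fun _ => x - p x + s • u s)
          (fun k => multilinear_comp_mem_polyMaps _ fun _ =>
            add_mem_polyMaps (const_mem_polyMaps _) (id_smul_mem_polyMaps hu))
          (fun k hk => funext fun s => ih k hk _)
          (fun k hk => by rw [hmS k hk]; rfl) fun s => by
            have h3 := hu' s
            rw [hm] at h3
            rw [← h3]
            exact Finset.sum_congr rfl fun k _ => (apply_smul_const _ _ _).symm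
        simpa using this
  rw [hm]
  exact Finset.sum_eq_zero fun k _ => key k x

end Poly

/-! ### The morphism `F` and the structure `R` -/

section CompMor

variable {𝕜 : Type u} [Field 𝕜] {V : Type v} [AddCommGroup V] [Module 𝕜 V]
  {W : Type w} [AddCommGroup W] [Module 𝕜 W]
  {𝒱 : ℤ → Submodule 𝕜 V}
  {𝒲 : ℤ → Submodule 𝕜 W} [DirectSum.Decomposition 𝒲]
  {FV : ℕ → Submodule 𝕜 V} {FW : ℕ → Submodule 𝕜 W} {n : ℕ} (c : Composition n)

theorem compBlocks_apply (ϕ : MultilinearMap 𝕜 (fun _ : Fin c.length => V) V)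
    (f : (i : Fin c.length) → MultilinearMap 𝕜 (fun _ : Fin (c.blocksFun i) => W) V)
    (v : Fin n → W) : compBlocks c ϕ f v = ϕ fun j => f j fun i => v (c.blocksFinEquiv ⟨j, i⟩) :=
  rfl

theorem sum_blocks {A : Type*} [AddCommMonoid A] (d : Fin n → A) :
    ∑ j, ∑ i, d (c.blocksFinEquiv ⟨j, i⟩) = ∑ i, d i := by
  rw [← Equiv.sum_comp c.blocksFinEquiv, Fintype.sum_sigma]

variable {ϕ : MultilinearMap 𝕜 (fun _ : Fin c.length => V) V}
    {f : (i : Fin c.length) → MultilinearMap 𝕜 (fun _ : Fin (c.blocksFun i) => W) V}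

theorem HasDeg.compMor [DirectSum.Decomposition 𝒱] {k : ℤ} (hϕ : HasDeg 𝒱 𝒱 ϕ k)
    (hf : ∀ i, HasDeg 𝒲 𝒱 (f i) 0) : HasDeg 𝒲 𝒱 (compMor 𝒲 c ϕ f) k := by
  refine HasDeg.smul _ (HasDeg.sum _ fun σ _ => HasDeg.signedPerm (fun d x hx => ?_) σ)
  rw [compBlocks_apply, ← sum_blocks c]
  refine hϕ (fun j => ∑ i, d (c.blocksFinEquiv ⟨j, i⟩)) _ fun j => ?_
  simpa using hf j _ _ fun i => hx _

theorem IsCont.compMor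
    (hF : ∀ p : ℕ, ∀ x ∈ FW p, ∀ k : ℤ, ((DirectSum.decompose 𝒲 x k : 𝒲 k) : W) ∈ FW p)
    (hϕ : IsCont FV FV ϕ) (hf : ∀ i, IsCont FW FV (f i)) :
    IsCont FW FV (compMor 𝒲 c ϕ f) := by
  refine IsCont.smul _ (IsCont.sum _ fun σ _ => IsCont.signedPerm hF (fun p x h1 hx => ?_) σ)
  rw [compBlocks_apply, ← sum_blocks c]
  refine hϕ (fun j => ∑ i, p (c.blocksFinEquiv ⟨j, i⟩)) _ (fun j => ?_) fun j => ?_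
  · have h2 := Finset.single_le_sum (f := fun i => p (c.blocksFinEquiv ⟨j, i⟩))
      (fun i _ => Nat.zero_le _) (Finset.mem_univ (⟨0, c.one_le_blocksFun j⟩ : Fin (c.blocksFun j)))
    exact (h1 _).trans h2
  · exact hf j _ _ (fun i => h1 _) fun i => hx _

/-- At an even point all shuffles contribute equally, and their number n!/∏ i_j! distributes 1/n!
over the blocks. -/
theorem apply_const_compMor [CharZero 𝕜] {y : W} (hy : y ∈ desusp 𝒲 0) :
    ((n.factorial : ℕ) : 𝕜)⁻¹ • compMor 𝒲 c ϕ f (fun _ => y) =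
      ((c.length.factorial : ℕ) : 𝕜)⁻¹ •
        ϕ fun i => (((c.blocksFun i).factorial : ℕ) : 𝕜)⁻¹ • f i fun _ => y := by
  have h0 : ∀ k : ℕ, ((k.factorial : ℕ) : 𝕜) ≠ 0 := fun k => by
    exact_mod_cast k.factorial_ne_zero
  rw [compMor, smul_apply, sum_apply,
    Finset.sum_congr rfl fun σ _ => apply_const_signedPerm 𝒲 hy _ σ, Finset.sum_const,
    MultilinearMap.map_smul_univ, smul_comm, ← Nat.cast_smul_eq_nsmul 𝕜, smul_smul _ _ (compBlocks c ϕ f _)]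
  congr 2
  have h1 := congrArg (Nat.cast (R := 𝕜)) (card_multiUnshuffles c)
  push_cast at h1
  have h2 : ∏ i, (((c.blocksFun i).factorial : ℕ) : 𝕜) ≠ 0 :=
    Finset.prod_ne_zero_iff.2 fun i _ => h0 _
  have h3 := h0 n
  rw [Finset.prod_inv_distrib]
  field_simp
  rw [h1]
  ring

end CompMor

/-! ### Estimates for F and R and the expansion of Q along F -/

section TransferF

variable {𝕜 : Type u} [Field 𝕜] [CharZero 𝕜] {V : Type v} [AddCommGroup V] [Module 𝕜 V]
  {W : Type w} [AddCommGroup W] [Module 𝕜 W]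
  {𝒱 : ℤ → Submodule 𝕜 V} [DirectSum.Decomposition 𝒱]
  {𝒲 : ℤ → Submodule 𝕜 W} [DirectSum.Decomposition 𝒲]
  {FV : ℕ → Submodule 𝕜 V} {q : Taylor 𝕜 V V}
  {dW : W →ₗ[𝕜] W} {f : W →ₗ[𝕜] V} {g : V →ₗ[𝕜] W} {K : V →ₗ[𝕜] V}

/-- The sum `∑_{k=2}^n q_k F^k_n`. -/
noncomputable def transferPre (𝒲 : ℤ → Submodule 𝕜 W) [DirectSum.Decomposition 𝒲]
    (q : Taylor 𝕜 V V) (f : W →ₗ[𝕜] V) (K : V →ₗ[𝕜] V) : Taylor 𝕜 W V := fun n =>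
  ∑ c : {c : Composition n // 2 ≤ c.length},
    compMor 𝒲 c.1 (q c.1.length) fun i => transferF 𝒲 q f K (c.1.blocksFun i)

theorem transferF_add_two (n : ℕ) : transferF 𝒲 q f K (n + 2) =
    K.compMultilinearMap (transferPre 𝒲 q f K (n + 2)) := by
  rw [transferF]; rfl

theorem transferR_add_two (n : ℕ) : transferR 𝒲 q dW f g K (n + 2) =
    g.compMultilinearMap (transferPre 𝒲 q f K (n + 2)) := by
  rw [transferR]; rfl

variable (hc : IsCompleteContraction 𝒱 FV (linearPart q) 𝒲 dW f g K)
  (hq : IsCompleteLInfty 𝒱 FV q)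

include hc

theorem decompose_f (y : W) (k : ℤ) :
    ((DirectSum.decompose 𝒱 (f y) k : 𝒱 k) : V) = f (DirectSum.decompose 𝒲 y k : 𝒲 k) := by
  induction y using DirectSum.Decomposition.inductionOn 𝒲 with
  | zero => simp
  | @homogeneous i m =>
    by_cases h : i = k
    · subst h
      rw [DirectSum.decompose_of_mem_same _ (hc.f_degree _ _ m.2),
        DirectSum.decompose_of_mem_same _ m.2]
    · rw [DirectSum.decompose_of_mem_ne _ (hc.f_degree _ _ m.2) h,
        DirectSum.decompose_of_mem_ne _ m.2 h, map_zero]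
  | add a b ha hb => simp [ha, hb]

theorem inducedFiltration_graded (p : ℕ) (y : W) (hy : y ∈ inducedFiltration FV f p) (k : ℤ) :
    ((DirectSum.decompose 𝒲 y k : 𝒲 k) : W) ∈ inducedFiltration FV f p := by
  change f _ ∈ FV p
  rw [← decompose_f hc]
  exact hc.completeGraded.graded p _ hy k

theorem inducedFiltration_one : inducedFiltration FV f 1 = ⊤ := by
  rw [inducedFiltration, hc.completeGraded.one, Submodule.comap_top]

theorem g_mem_inducedFiltration {p : ℕ} {x : V} (hx : x ∈ FV p) :
    g x ∈ inducedFiltration FV f p := hc.fg_continuous p x hx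

include hq

theorem hasDeg_transferF (n : ℕ) : HasDeg 𝒲 𝒱 (transferF 𝒲 q f K n) 0 := by
  induction n using Nat.strong_induction_on with
  | _ n ih =>
    match n with
    | 0 => rw [transferF]; exact HasDeg.zero 0
    | 1 =>
      rw [transferF]
      exact hasDeg_toUnary fun k x hx => by simpa using hc.f_degree k x hx
    | n + 2 =>
      rw [transferF_add_two]
      have h : HasDeg 𝒲 𝒱 (transferPre 𝒲 q f K (n + 2)) 1 := HasDeg.sum _ fun c _ =>
        HasDeg.compMor c.1 (hq.hasDeg _ (by have := c.2; omega)) fun i =>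
          ih _ (blocksFun_lt_of_two_le_length c.1 c.2 i)
      intro d x hx
      have := hc.K_degree _ _ (h d x hx)
      simpa [desusp] using this

theorem hasDeg_transferPre (n : ℕ) : HasDeg 𝒲 𝒱 (transferPre 𝒲 q f K n) 1 :=
  HasDeg.sum _ fun c _ => HasDeg.compMor c.1 (hq.hasDeg _ (by have := c.2; omega)) fun _ =>
    hasDeg_transferF hc hq _

theorem isCont_transferF (n : ℕ) :
    IsCont (inducedFiltration FV f) FV (transferF 𝒲 q f K n) := by
  induction n using Nat.strong_induction_on with
  | _ n ih =>
    match n with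
    | 0 => rw [transferF]; exact IsCont.zero
    | 1 => rw [transferF]; exact isCont_toUnary fun p x hx => hx
    | n + 2 =>
      rw [transferF_add_two]
      have h : IsCont (inducedFiltration FV f) FV (transferPre 𝒲 q f K (n + 2)) :=
        IsCont.sum _ fun c _ => IsCont.compMor c.1 (inducedFiltration_graded hc)
          (hq.isCont _ (by have := c.2; omega)) fun i =>
            ih _ (blocksFun_lt_of_two_le_length c.1 c.2 i)
      exact fun p x h1 hx => hc.K_continuous _ _ (h p x h1 hx)

theorem isCont_transferPre (n : ℕ) :
    IsCont (inducedFiltration FV f) FV (transferPre 𝒲 q f K n) :=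
  IsCont.sum _ fun c _ => IsCont.compMor c.1 (inducedFiltration_graded hc)
    (hq.isCont _ (by have := c.2; omega)) fun _ => isCont_transferF hc hq _

theorem hasDeg_transferR (n : ℕ) : HasDeg 𝒲 𝒲 (transferR 𝒲 q dW f g K n) 1 := by
  match n with
  | 0 => rw [transferR]; exact HasDeg.zero 1
  | 1 => rw [transferR]; exact hasDeg_toUnary hc.dW_degree
  | n + 2 =>
    rw [transferR_add_two]
    exact fun d x hx => hc.g_degree _ _ (hasDeg_transferPre hc hq _ d x hx)

theorem isCont_transferR (n : ℕ) :
    IsCont (inducedFiltration FV f) (inducedFiltration FV f) (transferR 𝒲 q dW f g K n) := by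
  match n with
  | 0 => rw [transferR]; exact IsCont.zero
  | 1 =>
    rw [transferR]
    refine isCont_toUnary fun p x hx => ?_
    have := hc.dV_continuous p _ hx
    rwa [← LinearMap.comp_apply, ← hc.f_comm] at this
  | n + 2 =>
    rw [transferR_add_two]
    exact fun p x h1 hx => g_mem_inducedFiltration hc (isCont_transferPre hc hq _ p x h1 hx)

omit hc hq [CharZero 𝕜] in
-- Transport along an equality of arities, needed because the arity of `q` is a composition length.
theorem factorial_smul_apply_congr (q : Taylor 𝕜 V V) (t : ℕ → V) {k l : ℕ} (h : l = k)
    {κ : Fin k → ℕ} {κ' : Fin l → ℕ} (hκ : ∀ j : Fin k, κ' ⟨j, h.symm ▸ j.2⟩ = κ j) :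
    ((k.factorial : ℕ) : 𝕜)⁻¹ • (q k fun i => t (κ i)) =
      ((l.factorial : ℕ) : 𝕜)⁻¹ • q l fun i => t (κ' i) := by
  subst h
  obtain rfl : κ' = κ := funext hκ
  rfl

open FormalMultilinearSeries in
/-- `∑ 1/n! (∑_k q_k F^k_n)(y^n)` is the sum of `1/k! q_k(x^k)`, `k ≥ 2`, at `x = F(y)`. -/
theorem expSum_transferPre {y : W} (hy : y ∈ 𝒲 1) (M : ℕ) :
    expSum (transferPre 𝒲 q f K) 2 y M ≡
      expSum q 2 (expSum (transferF 𝒲 q f K) 1 y M) M [SMOD FV M] := by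
  have hy0 := mem_desusp_zero.2 hy
  let t : ℕ → V := fun k => term₀ (transferF 𝒲 q f K) k y
  have ht : ∀ k ≥ 1, t k ∈ FV k := fun k hk =>
    term₀_mem (inducedFiltration_one hc) (fun n _ => isCont_transferF hc hq n) y hk
  let T : (Σ n, Composition n) → V := fun a =>
    ((a.2.length.factorial : ℕ) : 𝕜)⁻¹ • q a.2.length fun i => t (a.2.blocksFun i)
  have hT : ∀ a : (Σ n, Composition n), 2 ≤ a.2.length → T a ∈ FV a.1 := by
    rintro ⟨n, c⟩ h
    have := hq.isCont c.length (by simp only at h; omega) c.blocksFun _ c.one_le_blocksFun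
      fun i => ht _ (c.one_le_blocksFun i)
    rw [c.sum_blocksFun] at this
    exact Submodule.smul_mem _ _ this
  -- Multilinear expansion gives tuples of positive indices, which are the same as compositions. The
  -- bounds M + 1 are strict: lengths lie between 2 and M, blocks are at most M.
  have h1 : expSum q 2 (expSum (transferF 𝒲 q f K) 1 y M) M =
      ∑ a ∈ compPartialSumTarget 2 (M + 1) (M + 1), T a := by
    rw [← compChangeOfVariables_sum 2 (M + 1) (M + 1)
      (fun a => ((a.1.factorial : ℕ) : 𝕜)⁻¹ • q a.1 fun i => t (a.2 i)) T, expSum, expSum_eq]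
    · rw [compPartialSumSource, Finset.sum_sigma]
      refine Finset.sum_congr rfl fun k _ => ?_
      rw [MultilinearMap.map_sum_finset, Finset.smul_sum]
      rfl
    · rintro ⟨k, κ⟩ he
      have h2 := compChangeOfVariables_length 2 (M + 1) (M + 1) he
      have h3 := compChangeOfVariables_blocksFun 2 (M + 1) (M + 1) he
      exact factorial_smul_apply_congr q t h2 h3
  have h2 : expSum (transferPre 𝒲 q f K) 2 y M =
      ∑ a ∈ (compPartialSumTarget 2 (M + 1) (M + 1)).filter (fun a => a.1 ≤ M), T a := by
    have h3 : ∀ n, term₀ (transferPre 𝒲 q f K) n y =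
        ∑ c ∈ (Finset.univ : Finset (Composition n)).filter (fun c => 2 ≤ c.length), T ⟨n, c⟩ := by
      intro n
      rw [term₀, transferPre, sum_apply, Finset.smul_sum,
        Finset.sum_subtype _ (p := fun c : Composition n => 2 ≤ c.length) (by simp)]
      exact Finset.sum_congr rfl fun c _ => apply_const_compMor c.1 hy0
    rw [expSum_eq, Finset.sum_congr rfl fun n _ => h3 n, Finset.sum_sigma']
    refine Finset.sum_congr ?_ fun _ _ => rfl
    ext ⟨n, c⟩
    simp only [Finset.mem_sigma, Finset.mem_Icc, Finset.mem_filter, Finset.mem_univ, true_and,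
      mem_compPartialSumTarget_iff]
    have h4 := c.length_le
    have h5 := c.blocksFun_le
    constructor
    · rintro ⟨h6, h7⟩
      exact ⟨⟨h7, by omega, fun j => by have := h5 j; omega⟩, h6.2⟩
    · rintro ⟨⟨h6, h7, h8⟩, h9⟩
      exact ⟨by omega, h6⟩
  -- The two sums differ by compositions of integers larger than M, whose terms lie in `FV M`.
  rw [h1, h2, SModEq.comm, SModEq.sub_mem,
    ← Finset.sum_filter_add_sum_filter_not _ (fun a : (Σ n, Composition n) => a.1 ≤ M),
    add_sub_cancel_left]
  refine Submodule.sum_mem _ fun a ha => ?_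
  rw [Finset.mem_filter, mem_compPartialSumTarget_iff] at ha
  exact hc.completeGraded.antitone (not_le.1 ha.2).le (hT a ha.1.1)

end TransferF

/-! ### The curvature relation for the morphism `G` -/

section ExpSum

variable {𝕜 : Type u} [Field 𝕜] {V : Type v} [AddCommGroup V] [Module 𝕜 V]
  {U : Type w} [AddCommGroup U] [Module 𝕜 U]
  {F : ℕ → Submodule 𝕜 V} {F' : ℕ → Submodule 𝕜 U}

/-- In the expansion of ϕ at u' + (u - u'), every term but ϕ(u') has u - u' in some slot. -/
theorem IsCont.sub_mem (hF : F 1 = ⊤) {n : ℕ} {ϕ : MultilinearMap 𝕜 (fun _ : Fin n => V) U}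
    (hϕ : IsCont F F' ϕ) {p : ℕ} (hp : 1 ≤ p) {u u' : V} (h : u - u' ∈ F p) :
    (ϕ fun _ => u) - (ϕ fun _ => u') ∈ F' (n - 1 + p) := by
  classical
  have h1 := ϕ.map_add_univ (fun _ => u') fun _ => u - u'
  have h2 : ((fun _ => u') + fun _ => u - u' : Fin n → V) = fun _ => u := by
    funext i; simp
  rw [h2, ← Finset.add_sum_erase _ _ (Finset.mem_univ Finset.univ), Finset.piecewise_univ] at h1
  rw [h1, add_sub_cancel_left]
  refine Submodule.sum_mem _ fun s hs => ?_
  obtain ⟨i, hi⟩ : ∃ i, i ∉ s := by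
    by_contra! h
    exact (Finset.mem_erase.1 hs).1 (Finset.eq_univ_of_forall h)
  exact hϕ.apply_update_mem hF _ i hp (by simpa [hi] using h)

theorem term₀_sub_mem (hF : F 1 = ⊤) {ϕ : Taylor 𝕜 V U} (hϕ : ∀ n ≥ 1, IsCont F F' (ϕ n))
    {p : ℕ} (hp : 1 ≤ p) {u u' : V} (h : u - u' ∈ F p) {n : ℕ} (hn : 1 ≤ n) :
    term₀ ϕ n u - term₀ ϕ n u' ∈ F' (n - 1 + p) := by
  rw [term₀, term₀, ← smul_sub]
  exact Submodule.smul_mem _ _ ((hϕ n hn).sub_mem hF hp h)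

/-- Starting the series at order a gains a - 1 steps of the filtration; a = 2 makes the recursion a
contraction. -/
theorem expSum_sub_mem (hF : F 1 = ⊤) (hF' : Antitone F') {ϕ : Taylor 𝕜 V U}
    (hϕ : ∀ n ≥ 1, IsCont F F' (ϕ n)) {p : ℕ} (hp : 1 ≤ p) {u u' : V} (h : u - u' ∈ F p)
    {a : ℕ} (ha : 1 ≤ a) (M : ℕ) : expSum ϕ a u M - expSum ϕ a u' M ∈ F' (a - 1 + p) := by
  rw [expSum_eq, expSum_eq, ← Finset.sum_sub_distrib]
  refine Submodule.sum_mem _ fun n hn => ?_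
  have := (Finset.mem_Icc.1 hn).1
  exact hF' (by omega) (term₀_sub_mem hF hϕ hp h (ha.trans this))

theorem expSum_one_eq (ϕ : Taylor 𝕜 V U) (x : V) {M : ℕ} (hM : 1 ≤ M) :
    expSum ϕ 1 x M = linearPart ϕ x + expSum ϕ 2 x M := by
  rw [expSum_eq, ← Finset.add_sum_Ioc_eq_sum_Icc hM]
  congr 1
  simp [term₀, linearPart]

theorem expSum_mem_polyMaps {A : Type*} [AddCommGroup A] [Module 𝕜 A] (ϕ : Taylor 𝕜 V U) (a M : ℕ)
    {c : A → V} (hc : c ∈ polyMaps 𝕜 A V) : (fun x => expSum ϕ a (c x) M) ∈ polyMaps 𝕜 A U :=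
  sum_mem_polyMaps _ fun _ _ => const_smul_mem_polyMaps _ (multilinear_comp_mem_polyMaps _ fun _ => hc)

theorem expSum_add_smul (ϕ : Taylor 𝕜 V U) (M : ℕ) (x a : V) :
    ∃ ρ ∈ polyMaps 𝕜 𝕜 U, ∀ t : 𝕜,
      expSum ϕ 1 (x + t • a) M = expSum ϕ 1 x M + t • der₁ ϕ M x a + t ^ 2 • ρ t := by
  choose ρ hρ h using fun n => apply_add_smul (ϕ n) x a
  refine ⟨fun t => ∑ n ∈ Finset.Icc 1 M, ((n.factorial : ℕ) : 𝕜)⁻¹ • ρ n t,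
    sum_mem_polyMaps _ fun n _ => const_smul_mem_polyMaps _ (hρ n), fun t => ?_⟩
  rw [expSum, expSum, der₁_apply, Finset.smul_sum, Finset.smul_sum, ← Finset.sum_add_distrib,
    ← Finset.sum_add_distrib]
  refine Finset.sum_congr rfl fun n _ => ?_
  rw [h, smul_add, smul_add, term₁_apply, smul_comm t, smul_comm (t ^ 2)]

theorem expSum_add_sq_smul (ϕ : Taylor 𝕜 V U) (M : ℕ) (x : V) {ρ : 𝕜 → V}
    (hρ : ρ ∈ polyMaps 𝕜 𝕜 V) : ∃ ρ' ∈ polyMaps 𝕜 𝕜 U, ∀ t : 𝕜,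
      expSum ϕ 1 (x + t ^ 2 • ρ t) M = expSum ϕ 1 x M + t ^ 2 • ρ' t := by
  choose ρ' hρ' h using fun n => apply_add_sq_smul (ϕ n) x hρ
  refine ⟨fun t => ∑ n ∈ Finset.Icc 1 M, ((n.factorial : ℕ) : 𝕜)⁻¹ • ρ' n t,
    sum_mem_polyMaps _ fun n _ => const_smul_mem_polyMaps _ (hρ' n), fun t => ?_⟩
  rw [expSum, expSum, Finset.smul_sum, ← Finset.sum_add_distrib]
  refine Finset.sum_congr rfl fun n _ => ?_
  rw [h, smul_add, smul_comm (t ^ 2)]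

theorem term₀_smul (ϕ : Taylor 𝕜 V U) (n : ℕ) (s : 𝕜) (x : V) :
    term₀ ϕ n (s • x) = s ^ n • term₀ ϕ n x := by
  rw [term₀, term₀, apply_smul_const, smul_comm]

theorem term₁_smul_smul (ϕ : Taylor 𝕜 V U) (n : ℕ) (s : 𝕜) (x a : V) :
    term₁ ϕ n (s • x) (s • a) = s ^ n • term₁ ϕ n x a := by
  rw [term₁_apply, term₁_apply, ev₁_smul_smul, smul_comm]

theorem term₀_one (ϕ : Taylor 𝕜 V U) (x : V) : term₀ ϕ 1 x = linearPart ϕ x := by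
  simp [term₀, linearPart]

theorem term₁_one (ϕ : Taylor 𝕜 V U) (x a : V) : term₁ ϕ 1 x a = linearPart ϕ a := by
  have : update (fun _ : Fin 1 => x) 0 a = fun _ => a := by
    funext i; simp [Subsingleton.elim i 0]
  simp [term₁_apply, ev₁, linearPart, this]

end ExpSum

/-! ### Curvature identity: along the image of F, then everywhere -/

section Curvature

variable {𝕜 : Type u} [Field 𝕜] [CharZero 𝕜] {V : Type v} [AddCommGroup V] [Module 𝕜 V]
  {W : Type w} [AddCommGroup W] [Module 𝕜 W]
  {𝒱 : ℤ → Submodule 𝕜 V} [DirectSum.Decomposition 𝒱]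
  {𝒲 : ℤ → Submodule 𝕜 W} [DirectSum.Decomposition 𝒲]
  {FV : ℕ → Submodule 𝕜 V} {q : Taylor 𝕜 V V}
  {dW : W →ₗ[𝕜] W} {f : W →ₗ[𝕜] V} {g : V →ₗ[𝕜] W} {K : V →ₗ[𝕜] V}

theorem linearPart_transferF : linearPart (transferF 𝒲 q f K) = f := by
  ext y; simp [linearPart, transferF, toUnary]

theorem linearPart_transferR : linearPart (transferR 𝒲 q dW f g K) = dW := by
  ext y; simp [linearPart, transferR, toUnary]

theorem linearPart_transferG : linearPart (transferG 𝒱 q f g K) = g := by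
  ext y; simp [linearPart, transferG, toUnary]

theorem expSum_transferF (y : W) {M : ℕ} (hM : 1 ≤ M) : expSum (transferF 𝒲 q f K) 1 y M =
    f y + K (expSum (transferPre 𝒲 q f K) 2 y M) := by
  rw [expSum_one_eq _ _ hM, linearPart_transferF, expSum, expSum, map_sum]
  congr 1
  refine Finset.sum_congr rfl fun n hn => ?_
  obtain ⟨m, rfl⟩ : ∃ m, n = m + 2 := ⟨n - 2, by have := (Finset.mem_Icc.1 hn).1; omega⟩
  rw [transferF_add_two, map_smul]
  rfl

theorem expSum_transferR (y : W) {M : ℕ} (hM : 1 ≤ M) : expSum (transferR 𝒲 q dW f g K) 1 y M =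
    dW y + g (expSum (transferPre 𝒲 q f K) 2 y M) := by
  rw [expSum_one_eq _ _ hM, linearPart_transferR, expSum, expSum, map_sum]
  congr 1
  refine Finset.sum_congr rfl fun n hn => ?_
  obtain ⟨m, rfl⟩ : ∃ m, n = m + 2 := ⟨n - 2, by have := (Finset.mem_Icc.1 hn).1; omega⟩
  rw [transferR_add_two, map_smul]
  rfl

variable (hc : IsCompleteContraction 𝒱 FV (linearPart q) 𝒲 dW f g K)
  (hq : IsCompleteLInfty 𝒱 FV q)

include hc

include hq

/-- `γ_n(v)`, `n ≥ 2`, is small if all `K v_i` are small. -/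
theorem transferG_mem_of_K {n p : ℕ} (hp : 1 ≤ p) (d : Fin (n + 2) → ℤ) (v : Fin (n + 2) → V)
    (hv : ∀ i, v i ∈ desusp 𝒱 (d i)) (hK : ∀ i, K (v i) ∈ FV p) :
    transferG 𝒱 q f g K (n + 2) v ∈ inducedFiltration FV f p := by
  have hcont : IsCont FV (inducedFiltration FV f)
      (coderPlus 𝒱 (transferG 𝒱 q f g K) q (n + 1)) :=
    IsCont.sum _ fun j _ => IsCont.compCoder hc.completeGraded.graded _ (by omega)
      (hq.isCont _ (by omega)) (isCont_transferG hc hq _)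
  rw [transferG_add_two, compSymHtpy, smul_apply, sum_apply]
  refine Submodule.smul_mem _ _ (Submodule.sum_mem _ fun σ _ => ?_)
  rw [sum_apply]
  refine Submodule.sum_mem _ fun j _ => ?_
  rw [signedPerm_apply 𝒱 σ _ d v hv]
  refine Submodule.smul_of_tower_mem _ _ ?_
  rw [MultilinearMap.compLinearMap_apply]
  refine antitone_inducedFiltration hc hq (by omega)
    (hcont.apply_update_mem hc.completeGraded.one _ j hp ?_)
  simpa using hK (σ j)

theorem expSum_transferG_of_K {x : V} (hx : x ∈ 𝒱 1) {p M : ℕ} (hp : 1 ≤ p) (hM : 1 ≤ M)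
    (hK : K x ∈ FV p) : expSum (transferG 𝒱 q f g K) 1 x M ≡ g x
      [SMOD inducedFiltration FV f p] := by
  rw [SModEq.sub_mem, expSum_one_eq _ _ hM, linearPart_transferG, add_sub_cancel_left]
  refine Submodule.sum_mem _ fun n hn => Submodule.smul_mem _ _ ?_
  obtain ⟨m, rfl⟩ : ∃ m, n = m + 2 := ⟨n - 2, by have := (Finset.mem_Icc.1 hn).1; omega⟩
  exact transferG_mem_of_K hc hq hp (fun _ => 0) _ (fun _ => mem_desusp_zero.2 hx) fun _ => hK

theorem der₁_transferG_of_K {x b : V} (hx : x ∈ 𝒱 1) {d : ℤ} (hb : b ∈ desusp 𝒱 d) {p M : ℕ}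
    (hp : 1 ≤ p) (hM : 1 ≤ M) (hK : K x ∈ FV p) (hKb : K b ∈ FV p) :
    der₁ (transferG 𝒱 q f g K) M x b ≡ g b [SMOD inducedFiltration FV f p] := by
  rw [SModEq.sub_mem, der₁_apply, ← Finset.add_sum_Ioc_eq_sum_Icc hM, term₁_one,
    linearPart_transferG, add_sub_cancel_left]
  refine Submodule.sum_mem _ fun n hn => ?_
  rw [term₁_apply]
  refine Submodule.smul_mem _ _ (Submodule.sum_mem _ fun α _ => ?_)
  obtain ⟨m, rfl⟩ : ∃ m, n = m + 2 := ⟨n - 2, by have := (Finset.mem_Ioc.1 hn).1; omega⟩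
  refine transferG_mem_of_K hc hq hp _ _ (mem_desusp_update 𝒱 (mem_desusp_zero.2 hx) hb α)
    fun i => ?_
  by_cases hi : i = α
  · subst hi; simpa using hKb
  · simpa [hi] using hK

/-- The curvature relation along the image of `F`. -/
theorem expSum_coder_transferG_transferF {y : W} (hy : y ∈ 𝒲 1) {M : ℕ} (hM : 1 ≤ M) :
    expSum (coder 𝒱 (transferG 𝒱 q f g K) q) 1 (expSum (transferF 𝒲 q f K) 1 y M) M ≡
      expSum (transferR 𝒲 q dW f g K) 1
        (expSum (transferG 𝒱 q f g K) 1 (expSum (transferF 𝒲 q f K) 1 y M) M) M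
      [SMOD inducedFiltration FV f M] := by
  have hF := antitone_inducedFiltration hc hq
  have hpre := expSum_transferPre hc hq hy M
  have hxF := expSum_transferF (𝒲 := 𝒲) (q := q) (f := f) (K := K) y hM
  set x := expSum (transferF 𝒲 q f K) 1 y M with hx
  set s := expSum (transferPre 𝒲 q f K) 2 y M with hs
  have hx1 : x ∈ 𝒱 1 := mem_desusp_zero.1 <| Submodule.sum_mem _ fun n _ =>
    Submodule.smul_mem _ _ ((hasDeg_transferF hc hq n).apply_const_mem (mem_desusp_zero.2 hy))
  have hKx : K x = 0 := by rw [hxF, map_add, hc.K_f_apply, hc.K_K_apply, add_zero]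
  have hgx : g x = y := by rw [hxF, map_add, hc.g_f_apply, hc.g_K_apply, add_zero]
  have hC := mem_desusp_one.2 (expSum_q_mem hc hq hx1 M)
  have h1 := expSum_coder hc.completeGraded.one hF (fun n _ => isSym_transferG (q := q) hc n)
    (fun n _ => isCont_transferG hc hq n) hq.hasDeg hq.isCont (mem_desusp_zero.2 hx1) M
  set c := expSum q 1 x M with hcdef
  have hc1 : c = linearPart q x + expSum q 2 x M := expSum_one_eq _ _ hM
  -- The linear part contributes K q_1 x = f g x - x = -K s, and the higher part of the curvature is
  -- s modulo `FV M` by the definition of F.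
  have hKc : K c ∈ FV M := by
    have h2 := hc.homotopy_apply x
    rw [hKx, map_zero, add_zero, hgx] at h2
    rw [hc1, map_add, h2]
    have h3 : f y - x = -K s := by rw [hxF]; abel
    rw [h3, neg_add_eq_sub, ← map_sub]
    exact hc.K_continuous _ _ (SModEq.sub_mem.1 hpre.symm)
  have h2 := der₁_transferG_of_K hc hq hx1 hC hM hM (by rw [hKx]; exact zero_mem _) hKc
  have h3 : g c ≡ expSum (transferR 𝒲 q dW f g K) 1 y M [SMOD inducedFiltration FV f M] := by
    rw [expSum_transferR y hM, hc1, map_add]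
    have h4 : g (linearPart q x) = dW y := by
      rw [← LinearMap.comp_apply, hc.g_comm, LinearMap.comp_apply, hgx]
    rw [h4]
    refine SModEq.add SModEq.rfl ?_
    rw [SModEq.sub_mem, ← map_sub]
    exact g_mem_inducedFiltration hc (SModEq.sub_mem.1 hpre.symm)
  have h4 := expSum_transferG_of_K hc hq hx1 hM hM (by rw [hKx]; exact zero_mem _)
  rw [hgx] at h4
  have h5 := expSum_sub_mem (inducedFiltration_one hc) hF
    (fun n (_ : n ≥ 1) => isCont_transferR hc hq n) hM (SModEq.sub_mem.1 h4) le_rfl M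
  rw [Nat.sub_self, zero_add, ← SModEq.sub_mem] at h5
  exact ((h1.trans h2).trans h3).trans h5.symm

/-- The terms of the tangent field. -/
theorem tangent_smul (M : ℕ) (hM : 1 ≤ M) (x : V) (s : 𝕜) : tangent q K M (s • x) =
    s • (f (g x) - x) + ∑ n ∈ Finset.Icc 2 M,
      s ^ n • (term₁ q n x (K x) + K (term₀ q n x)) := by
  have h : tangent q K M (s • x) =
      ∑ n ∈ Finset.Icc 1 M, s ^ n • (term₁ q n x (K x) + K (term₀ q n x)) := by
    rw [tangent, der₁_apply, expSum_eq, map_sum, ← Finset.sum_add_distrib]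
    refine Finset.sum_congr rfl fun n _ => ?_
    rw [map_smul, term₁_smul_smul, term₀_smul, map_smul, smul_add]
  rw [h, ← Finset.add_sum_Ioc_eq_sum_Icc hM, term₁_one, term₀_one, pow_one, add_comm (linearPart q _),
    hc.homotopy_apply]
  rfl

/-- The curvature relation: `G'_x(Q(x)) = R(G(x))`. -/
theorem expSum_coder_transferG {x : V} (hx : x ∈ 𝒱 1) {M : ℕ} (hM : 1 ≤ M) :
    expSum (coder 𝒱 (transferG 𝒱 q f g K) q) 1 x M ≡
      expSum (transferR 𝒲 q dW f g K) 1 (expSum (transferG 𝒱 q f g K) 1 x M) M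
      [SMOD inducedFiltration FV f M] := by
  set FW := inducedFiltration FV f with hFWdef
  have hF : Antitone FW := antitone_inducedFiltration hc hq
  let Q := (FW M).mkQ
  let γ := transferG 𝒱 q f g K
  let ψ := coder 𝒱 γ q
  let R := transferR 𝒲 q dW f g K
  -- Modulo `FW M` finite partial sums suffice, so the defect of the identity is a genuine
  -- polynomial map.
  let D : 𝒱 1 → W ⧸ FW M := fun x => Q (expSum ψ 1 (x : V) M) -
    Q (expSum R 1 (expSum γ 1 (x : V) M) M)
  have hsub : (fun x : 𝒱 1 => (x : V)) ∈ polyMaps 𝕜 (𝒱 1) V :=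
    linear_mem_polyMaps (𝒱 1).subtype
  have hD : D ∈ polyMaps 𝕜 (𝒱 1) (W ⧸ FW M) := Submodule.sub_mem _
    (comp_mem_polyMaps (linear_mem_polyMaps Q) (expSum_mem_polyMaps _ _ _ hsub))
    (comp_mem_polyMaps (linear_mem_polyMaps Q)
      (expSum_mem_polyMaps _ _ _ (expSum_mem_polyMaps _ _ _ hsub)))
  let p : 𝒱 1 →ₗ[𝕜] 𝒱 1 := LinearMap.id - (f ∘ₗ g).restrict (hc.fg_degree 1)
  have hpx : ∀ x : 𝒱 1, ((p x : 𝒱 1) : V) = x - f (g x) := fun x => rfl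
  have hp : ∀ x, p (p x) = p x := fun x => Subtype.ext <| by
    rw [hpx, hpx]; simp [hc.g_f_apply]
  suffices h : D ⟨x, hx⟩ = 0 by
    rw [SModEq.def]
    exact sub_eq_zero.1 h
  refine polyMap_eq_zero hD hp (fun x => ⟨tangent q K M x, tangent_mem hc hq x.2 M⟩) ?_ ?_ ?_ _
  -- The tangent field has linear part f g - 1 = -p; all other terms are divisible by s².
  · intro x
    have hx0 := mem_desusp_zero.2 x.2
    have hT : ∀ n ∈ Finset.Icc 2 M, term₁ q n (x : V) (K x) + K (term₀ q n (x : V)) ∈ 𝒱 1 := by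
      intro n hn
      have hd := hq.hasDeg n (by have := (Finset.mem_Icc.1 hn).1; omega)
      refine Submodule.add_mem _ ?_ ?_
      · rw [term₁_apply]
        exact Submodule.smul_mem _ _ (mem_desusp_zero.1 (hd.ev₁_mem
          hx0 (mem_desusp_neg_one.2 (hc.K_degree _ _ x.2))))
      · exact hc.K_degree 2 _ (mem_desusp_one.1 (Submodule.smul_mem _ _ (hd.apply_const_mem hx0)))
    refine ⟨fun s => ∑ n ∈ (Finset.Icc 2 M).attach, s ^ (n.1 - 2) • ⟨_, hT n.1 n.2⟩,
      sum_mem_polyMaps _ fun n _ => pow_smul_mem_polyMaps _ (const_mem_polyMaps _), fun s => ?_⟩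
    refine Subtype.ext ?_
    simp only [Submodule.coe_smul, Submodule.coe_add, Submodule.coe_neg, hpx, Submodule.coe_sum]
    rw [tangent_smul hc hq M hM, smul_add, neg_sub, smul_smul, Finset.smul_sum,
      ← Finset.sum_attach (Finset.Icc 2 M)]
    congr 1
    refine Finset.sum_congr rfl fun n _ => ?_
    rw [smul_smul, ← pow_two, ← pow_add, Nat.add_sub_cancel' (Finset.mem_Icc.1 n.2).1]
  -- Both G Q and G are constant to first order along the tangent field; R composed with a
  -- second-order change of G is again a second-order change.
  · intro x
    obtain ⟨ρ₁, hρ₁, h₁⟩ := expSum_add_smul ψ M (x : V) (tangent q K M (x : V))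
    obtain ⟨ρ₂, hρ₂, h₂⟩ := expSum_add_smul γ M (x : V) (tangent q K M (x : V))
    obtain ⟨ρ₃, hρ₃, h₃⟩ := expSum_add_sq_smul R M (expSum γ 1 (x : V) M) hρ₂
    refine ⟨fun t => Q (ρ₁ t) - Q (ρ₃ t), Submodule.sub_mem _
      (comp_mem_polyMaps (linear_mem_polyMaps Q) hρ₁)
      (comp_mem_polyMaps (linear_mem_polyMaps Q) hρ₃), fun t => ?_⟩
    have h4 : Q (der₁ ψ M (x : V) (tangent q K M (x : V))) = 0 :=
      (Submodule.Quotient.mk_eq_zero _).2 (der₁_coder_transferG_tangent hc hq x.2 M hM)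
    have h5 : Q (expSum R 1 (expSum γ 1 ((x : V) + t • tangent q K M (x : V)) M) M) =
        Q (expSum R 1 (expSum γ 1 (x : V) M + t ^ 2 • ρ₂ t) M) := by
      refine (Submodule.Quotient.eq _).2 ?_
      have := expSum_sub_mem (F' := FW) (inducedFiltration_one hc) hF
        (fun n (_ : n ≥ 1) => isCont_transferR hc hq n) (p := M) hM
        (u := expSum γ 1 ((x : V) + t • tangent q K M (x : V)) M)
        (u' := expSum γ 1 (x : V) M + t ^ 2 • ρ₂ t) (by
          rw [h₂]
          convert Submodule.smul_mem _ t (der₁_transferG_tangent hc hq x.2 M) using 1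
          abel) le_rfl M
      rwa [Nat.sub_self, zero_add] at this
    change Q (expSum ψ 1 ((x : V) + t • tangent q K M (x : V)) M) -
      Q (expSum R 1 (expSum γ 1 ((x : V) + t • tangent q K M (x : V)) M) M) =
      Q (expSum ψ 1 (x : V) M) - Q (expSum R 1 (expSum γ 1 (x : V) M) M) + _
    rw [h5, h₃, h₁, map_add, map_add, map_add, map_smul, h4, smul_zero, map_smul, map_smul,
      smul_sub]
    abel
  -- Here x - p x = f g x is the initial direction of the curve s ↦ F(s g(x)), on which the defect
  -- is known to vanish.
  · intro x
    have hy : g x ∈ 𝒲 1 := hc.g_degree _ _ x.2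
    have hT : ∀ n, term₀ (transferF 𝒲 q f K) n (g x) ∈ 𝒱 1 := fun n => mem_desusp_zero.1 <|
      Submodule.smul_mem _ _ ((hasDeg_transferF hc hq n).apply_const_mem (mem_desusp_zero.2 hy))
    refine ⟨fun s => ∑ n ∈ Finset.Icc 2 M, s ^ (n - 2) • ⟨_, hT n⟩,
      sum_mem_polyMaps _ fun n _ => pow_smul_mem_polyMaps _ (const_mem_polyMaps _), fun s => ?_⟩
    have h1 : ((s • (x - p x + s • ∑ n ∈ Finset.Icc 2 M, s ^ (n - 2) •
        (⟨_, hT n⟩ : 𝒱 1)) : 𝒱 1) : V) = expSum (transferF 𝒲 q f K) 1 (s • g x) M := by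
      simp only [Submodule.coe_smul, Submodule.coe_add, Submodule.coe_sub, hpx, Submodule.coe_sum]
      rw [expSum_one_eq _ _ hM, linearPart_transferF, sub_sub_cancel, smul_add, map_smul, smul_smul,
        Finset.smul_sum, expSum_eq]
      congr 1
      refine Finset.sum_congr rfl fun n hn => ?_
      rw [smul_smul, ← pow_two, ← pow_add, Nat.add_sub_cancel' (Finset.mem_Icc.1 hn).1,
        term₀_smul]
    have h2 := expSum_coder_transferG_transferF hc hq (Submodule.smul_mem _ s hy) hM
    change Q (expSum ψ 1 _ M) - Q (expSum R 1 (expSum γ 1 _ M) M) = 0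
    rw [h1]
    exact sub_eq_zero.2 h2

end Curvature

/-! ### Convergence -/

section Convergence

variable {𝕜 : Type u} [Field 𝕜] [CharZero 𝕜] {V : Type v} [AddCommGroup V] [Module 𝕜 V]
  {U : Type w} [AddCommGroup U] [Module 𝕜 U]
  {𝒱 : ℤ → Submodule 𝕜 V} [DirectSum.Decomposition 𝒱]
  {𝒰 : ℤ → Submodule 𝕜 U} [DirectSum.Decomposition 𝒰]
  {F : ℕ → Submodule 𝕜 V} {F' : ℕ → Submodule 𝕜 U}

theorem IsCompleteGraded.zero (h : IsCompleteGraded 𝒱 F) : F 0 = ⊤ :=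
  top_le_iff.1 (h.one ▸ h.antitone zero_le_one)

theorem IsCompleteGraded.eq_zero (h : IsCompleteGraded 𝒱 F) {x : V} (hx : ∀ p, x ∈ F p) :
    x = 0 := by
  classical
  rw [← DirectSum.sum_support_decompose 𝒱 x]
  exact Finset.sum_eq_zero fun k _ =>
    h.separated k _ (SetLike.coe_mem _) fun p => h.graded p x (hx p) k

theorem IsCompleteGraded.eq_of_modEq (h : IsCompleteGraded 𝒱 F) {x x' : V}
    (hx : ∀ p, x ≡ x' [SMOD F p]) : x = x' :=
  sub_eq_zero.1 (h.eq_zero fun p => SModEq.sub_mem.1 (hx p))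

theorem convergesTo_of_modEq (hF : Antitone F) {s : ℕ → V} {x : V}
    (h : ∀ p, s p ≡ x [SMOD F p]) : ConvergesTo F s x := fun p =>
  ⟨p, fun n hn => hF hn (SModEq.sub_mem.1 (h n))⟩

theorem ConvergesTo.unique (h : IsCompleteGraded 𝒱 F) {s : ℕ → V} {x x' : V}
    (hx : ConvergesTo F s x) (hx' : ConvergesTo F s x') : x = x' := by
  refine h.eq_of_modEq fun p => ?_
  obtain ⟨N, hN⟩ := hx p
  obtain ⟨N', hN'⟩ := hx' p
  exact (SModEq.sub_mem.2 (hN _ (le_max_left N N'))).symm.trans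
    (SModEq.sub_mem.2 (hN' _ (le_max_right N N')))

theorem ConvergesTo.limit_eq (h : IsCompleteGraded 𝒱 F) {s : ℕ → V} {x : V}
    (hx : ConvergesTo F s x) : limit F s = x := by
  have h1 : ∃ x, ConvergesTo F s x := ⟨x, hx⟩
  rw [limit, dif_pos h1]
  exact h1.choose_spec.unique h hx

theorem limit_eq_of_modEq (h : IsCompleteGraded 𝒱 F) {s : ℕ → V} {x : V}
    (hx : ∀ p, s p ≡ x [SMOD F p]) : limit F s = x :=
  (convergesTo_of_modEq h.antitone hx).limit_eq h

/-- The sum of a convergent series of homogeneous terms. -/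
theorem exists_expSum_modEq (hF1 : F 1 = ⊤) (h : IsCompleteGraded 𝒰 F') {ϕ : Taylor 𝕜 V U} {k : ℤ}
    (hϕd : ∀ n ≥ 1, HasDeg 𝒱 𝒰 (ϕ n) k) (hϕc : ∀ n ≥ 1, IsCont F F' (ϕ n)) {x : V} (hx : x ∈ 𝒱 1)
    {a : ℕ} (ha : 1 ≤ a) : ∃ c ∈ 𝒰 (k + 1), ∀ M, expSum ϕ a x M ≡ c [SMOD F' M] := by
  obtain ⟨c, hc, h1⟩ := h.complete (k + 1) (expSum ϕ a x) (fun M => Submodule.sum_mem _ fun n hn =>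
      Submodule.smul_mem _ _ ((hϕd n (ha.trans (Finset.mem_Icc.1 hn).1)).apply_const_mem
        (mem_desusp_zero.2 hx))) fun M => by
    by_cases haM : a ≤ M + 1
    · rw [expSum_eq, expSum_eq, Finset.sum_Icc_succ_top haM, add_sub_cancel_left]
      exact h.antitone M.le_succ (term₀_mem hF1 hϕc x (by omega))
    · rw [expSum_eq, expSum_eq, Finset.Icc_eq_empty (by omega), Finset.Icc_eq_empty (by omega)]
      simp
  exact ⟨c, hc, fun M => SModEq.sub_mem.2 (h1 M)⟩

/-- The M-th partial sum is within `F M` of the limit, so the limit is zero iff each partial sum is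
that small. -/
theorem mem_MC_iff (hF1 : F 1 = ⊤) (h : IsCompleteGraded 𝒱 F) {q : Taylor 𝕜 V V}
    (hqd : ∀ n ≥ 1, HasDeg 𝒱 𝒱 (q n) 1) (hqc : ∀ n ≥ 1, IsCont F F (q n)) {x : V} (hx : x ∈ 𝒱 1) :
    x ∈ MC 𝒱 F q ↔ ∀ M, expSum q 1 x M ∈ F M := by
  constructor
  · rintro ⟨-, h0⟩ M
    obtain ⟨c, -, h1⟩ := exists_expSum_modEq hF1 h hqd hqc hx le_rfl
    have h2 := h1 M
    rwa [(convergesTo_of_modEq h.antitone h1).unique h h0, SModEq.zero] at h2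
  · exact fun h0 => ⟨hx, convergesTo_of_modEq h.antitone fun p => SModEq.zero.2 (h0 p)⟩

end Convergence

/-! ### The fixed point equation and the Maurer-Cartan equation -/

section Kuranishi

variable {𝕜 : Type u} [Field 𝕜] [CharZero 𝕜] {V : Type v} [AddCommGroup V] [Module 𝕜 V]
  {W : Type w} [AddCommGroup W] [Module 𝕜 W]
  {𝒱 : ℤ → Submodule 𝕜 V} [DirectSum.Decomposition 𝒱]
  {𝒲 : ℤ → Submodule 𝕜 W} [DirectSum.Decomposition 𝒲]
  {FV : ℕ → Submodule 𝕜 V} {q : Taylor 𝕜 V V}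
  {dW : W →ₗ[𝕜] W} {f : W →ₗ[𝕜] V} {g : V →ₗ[𝕜] W} {K : V →ₗ[𝕜] V}
  (hc : IsCompleteContraction 𝒱 FV (linearPart q) 𝒲 dW f g K)
  (hq : IsCompleteLInfty 𝒱 FV q)

include hc

/-- `W` is a retract of `V` through f and g, and f g preserves the filtration; so limits in `W` are
images under g of limits in `V`. -/
theorem isCompleteGraded_inducedFiltration :
    IsCompleteGraded 𝒲 (inducedFiltration FV f) where
  antitone _ _ h _ hx := hc.completeGraded.antitone h hx
  one := inducedFiltration_one hc
  graded p y hy k := inducedFiltration_graded hc p y hy k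
  separated k y hy h := by
    have := hc.completeGraded.separated k (f y) (hc.f_degree k y hy) h
    rw [← hc.g_f_apply y, this, map_zero]
  complete k s hs h := by
    obtain ⟨x, hx, h1⟩ := hc.completeGraded.complete k (fun p => f (s p))
      (fun p => hc.f_degree k _ (hs p)) fun p => by rw [← map_sub]; exact h p
    refine ⟨g x, hc.g_degree k x hx, fun p => ?_⟩
    have := hc.fg_continuous p _ (h1 p)
    rw [map_sub, hc.g_f_apply] at this
    exact this

include hq

theorem hasDeg_recTaylor (n : ℕ) (hn : 1 ≤ n) : HasDeg 𝒱 𝒱 (recTaylor 𝒱 q f g K n) 0 := by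
  intro d x hx
  refine Submodule.sub_mem _ ?_ (hc.f_degree _ _ (hasDeg_transferG hc hq n d x hx))
  simpa [desusp] using hc.K_degree _ _ (hq.hasDeg n hn d x hx)

theorem isCont_recTaylor (n : ℕ) (hn : 1 ≤ n) : IsCont FV FV (recTaylor 𝒱 q f g K n) :=
  fun p x h1 hx => Submodule.sub_mem _ (hc.K_continuous _ _ (hq.isCont n hn p x h1 hx))
    (isCont_transferG hc hq n p x h1 hx)

omit hc hq [CharZero 𝕜] in
theorem expSum_recTaylor (a : ℕ) (x : V) (M : ℕ) : expSum (recTaylor 𝒱 q f g K) a x M =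
    K (expSum q a x M) - f (expSum (transferG 𝒱 q f g K) a x M) := by
  simp only [expSum, map_sum, map_smul, ← Finset.sum_sub_distrib, ← smul_sub]
  rfl

/-- `x` solves the fixed point equation of the recursion. -/
def IsFix (𝒱 : ℤ → Submodule 𝕜 V) [DirectSum.Decomposition 𝒱] (FV : ℕ → Submodule 𝕜 V)
    (q : Taylor 𝕜 V V) (f : W →ₗ[𝕜] V) (g : V →ₗ[𝕜] W) (K : V →ₗ[𝕜] V) (y : W) (z x : V) : Prop :=
  ∀ M, x ≡ f y - linearPart q z + expSum (recTaylor 𝒱 q f g K) 2 x M [SMOD FV M]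

theorem expSum_recTaylor_sub_mem {u u' : V} {p : ℕ} (h : u - u' ∈ FV p) (M : ℕ) :
    expSum (recTaylor 𝒱 q f g K) 2 u M - expSum (recTaylor 𝒱 q f g K) 2 u' M ∈ FV (p + 1) := by
  rcases Nat.eq_zero_or_pos p with rfl | hp
  · simp [hc.completeGraded.one]
  · have := expSum_sub_mem hc.completeGraded.one hc.completeGraded.antitone
      (isCont_recTaylor hc hq) hp h (a := 2) (by omega) M
    rwa [show 2 - 1 + p = p + 1 by omega] at this

/-- If two solutions agree modulo `FV p`, their higher-order terms agree modulo `FV (p + 1)`, hence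
so do the solutions. -/
theorem IsFix.unique {y : W} {z x x' : V} (h : IsFix 𝒱 FV q f g K y z x)
    (h' : IsFix 𝒱 FV q f g K y z x') : x = x' := by
  refine hc.completeGraded.eq_of_modEq fun p => ?_
  induction p with
  | zero => rw [hc.completeGraded.zero]; exact SModEq.top
  | succ p ih =>
    refine (h (p + 1)).trans (SModEq.trans ?_ (h' (p + 1)).symm)
    exact SModEq.rfl.add (SModEq.sub_mem.2
      (expSum_recTaylor_sub_mem hc hq (SModEq.sub_mem.1 ih) _))

/-- The series in the recursion does converge, so the default value of `limit` never enters. -/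
theorem exists_recSeq_succ {y : W} {z : V} (n : ℕ) (hn : recSeq 𝒱 FV q f g K y z n ∈ 𝒱 1) :
    ∃ c ∈ 𝒱 1, recSeq 𝒱 FV q f g K y z (n + 1) = f y - linearPart q z + c ∧
      ∀ M, expSum (recTaylor 𝒱 q f g K) 2 (recSeq 𝒱 FV q f g K y z n) M ≡ c [SMOD FV M] := by
  obtain ⟨c, hc1, h⟩ := exists_expSum_modEq hc.completeGraded.one hc.completeGraded
    (hasDeg_recTaylor hc hq) (isCont_recTaylor hc hq) hn (a := 2) (by omega)
  refine ⟨c, by simpa using hc1, ?_, h⟩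
  rw [recSeq, limit_eq_of_modEq hc.completeGraded h]

theorem recSeq_mem {y : W} {z : V} (hy : y ∈ 𝒲 1) (hz : z ∈ 𝒱 0) (n : ℕ) :
    recSeq 𝒱 FV q f g K y z n ∈ 𝒱 1 := by
  induction n with
  | zero => rw [recSeq]; exact zero_mem _
  | succ n ih =>
    obtain ⟨c, hc1, h, -⟩ := exists_recSeq_succ hc hq n ih
    rw [h]
    exact Submodule.add_mem _ (Submodule.sub_mem _ (hc.f_degree _ _ hy)
      (by simpa using hc.dV_degree 0 z hz)) hc1

/-- Consecutive iterates differ by an element of `FV n` by the contraction estimate; completeness in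
degree one gives the limit. -/
theorem exists_recSeq_modEq {y : W} {z : V} (hy : y ∈ 𝒲 1) (hz : z ∈ 𝒱 0) :
    ∃ x ∈ 𝒱 1, (∀ n, recSeq 𝒱 FV q f g K y z n ≡ x [SMOD FV n]) ∧
      IsFix 𝒱 FV q f g K y z x := by
  have hm := recSeq_mem hc hq hy hz
  choose c _ hc2 hc3 using fun n => exists_recSeq_succ hc hq n (hm n)
  have h1 : ∀ n, recSeq 𝒱 FV q f g K y z (n + 1) - recSeq 𝒱 FV q f g K y z n ∈ FV n := by
    intro n
    induction n with
    | zero => rw [hc.completeGraded.zero]; trivial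
    | succ n ih =>
      rw [hc2 (n + 1), hc2 n, add_sub_add_left_eq_sub]
      exact SModEq.sub_mem.1 ((hc3 (n + 1) (n + 1)).symm.trans ((SModEq.sub_mem.2
        (expSum_recTaylor_sub_mem hc hq ih (n + 1))).trans (hc3 n (n + 1))))
  obtain ⟨x, hx, h2⟩ := hc.completeGraded.complete 1 _ hm h1
  refine ⟨x, hx, fun n => SModEq.sub_mem.2 (h2 n), fun M => ?_⟩
  have h3 : recSeq 𝒱 FV q f g K y z (M + 1) ≡ x [SMOD FV M] :=
    SModEq.sub_mem.2 (hc.completeGraded.antitone M.le_succ (h2 (M + 1)))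
  refine h3.symm.trans ?_
  rw [hc2 M]
  refine SModEq.rfl.add ((hc3 M M).symm.trans (SModEq.sub_mem.2 ?_))
  exact hc.completeGraded.antitone M.le_succ (expSum_recTaylor_sub_mem hc hq (h2 M) M)

/-- Replace q_1 K x by f g x - x - K q_1 x; the linear terms complete the higher-order terms to the
full series of Q and G. -/
theorem fix_eq (y : W) (x : V) {M : ℕ} (hM : 1 ≤ M) :
    f y - linearPart q (K x) + expSum (recTaylor 𝒱 q f g K) 2 x M =
      x + (K (expSum q 1 x M) + f (y - expSum (transferG 𝒱 q f g K) 1 x M)) := by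
  rw [expSum_recTaylor, expSum_one_eq q _ hM, expSum_one_eq _ _ hM, linearPart_transferG, map_sub,
    map_add, map_add, eq_sub_of_add_eq (hc.homotopy_apply x)]
  abel

theorem isFix_iff (y : W) (x : V) : IsFix 𝒱 FV q f g K y (K x) x ↔
    ∀ M ≥ 1, K (expSum q 1 x M) + f (y - expSum (transferG 𝒱 q f g K) 1 x M) ∈ FV M := by
  constructor
  · intro h M hM
    have h1 := SModEq.sub_mem.1 (h M).symm
    rwa [fix_eq hc hq y x hM, add_sub_cancel_left] at h1
  · intro h M
    rcases Nat.eq_zero_or_pos M with rfl | hM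
    · rw [hc.completeGraded.zero]; exact SModEq.top
    · rw [fix_eq hc hq y x hM, SModEq.comm, SModEq.sub_mem, add_sub_cancel_left]
      exact h M hM

theorem exists_push_transferG {x : V} (hx : x ∈ 𝒱 1) :
    push (inducedFiltration FV f) (transferG 𝒱 q f g K) x ∈ 𝒲 1 ∧
    ∀ M, expSum (transferG 𝒱 q f g K) 1 x M ≡
      push (inducedFiltration FV f) (transferG 𝒱 q f g K) x [SMOD inducedFiltration FV f M] := by
  obtain ⟨c, hc1, h⟩ := exists_expSum_modEq hc.completeGraded.one
    (isCompleteGraded_inducedFiltration hc) (fun n _ => hasDeg_transferG hc hq n)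
    (fun n _ => isCont_transferG hc hq n) hx le_rfl
  rw [push, limit_eq_of_modEq (isCompleteGraded_inducedFiltration hc) h]
  exact ⟨by simpa using hc1, h⟩

/-- Each higher coefficient of G applies K to one of its arguments. -/
theorem g_eq_push {x : V} (hx : x ∈ 𝒱 1) (hK : K x = 0) :
    push (inducedFiltration FV f) (transferG 𝒱 q f g K) x = g x := by
  refine (isCompleteGraded_inducedFiltration hc).eq_of_modEq fun p => ?_
  have h1 := (exists_push_transferG hc hq hx).2 (p + 1)
  have h2 := expSum_transferG_of_K hc hq hx (p := p + 1) (M := p + 1) (by omega) (by omega)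
    (by rw [hK]; exact zero_mem _)
  exact (h1.symm.trans h2).mono (antitone_inducedFiltration hc hq p.le_succ)

/-- Maurer-Cartan elements solve the fixed point equation. -/
theorem isFix_of_mem_MC {x : V} (hx : x ∈ MC 𝒱 FV q) : IsFix 𝒱 FV q f g K
    (push (inducedFiltration FV f) (transferG 𝒱 q f g K) x) (K x) x := by
  rw [isFix_iff hc hq]
  intro M _
  have h := (mem_MC_iff hc.completeGraded.one hc.completeGraded hq.hasDeg hq.isCont hx.1).1 hx M
  refine Submodule.add_mem _ (hc.K_continuous _ _ h) ?_
  exact SModEq.sub_mem.1 ((exists_push_transferG hc hq hx.1).2 M).symm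

/-- Apply K to the equation. K f = 0 and K² = 0 leave only -K q_1 K v, which is K v by the homotopy
relation at K v. -/
theorem IsFix.K_eq {y : W} {v x : V} (h : IsFix 𝒱 FV q f g K y (K v) x) : K x = K v := by
  refine hc.completeGraded.eq_of_modEq fun M => ?_
  have h1 := hc.K_continuous _ _ (SModEq.sub_mem.1 (h M))
  have h2 := hc.homotopy_apply (K v)
  rw [hc.K_K_apply, map_zero, add_zero, hc.g_K_apply, map_zero, zero_sub] at h2
  rw [expSum_recTaylor, map_sub, map_add, map_sub, map_sub, hc.K_f_apply, hc.K_f_apply,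
    hc.K_K_apply, h2] at h1
  rw [SModEq.sub_mem]
  simpa using h1

/-- Applying f g kills the summand in the image of K and fixes the one in the image of f, so each
summand of the equation is small by itself. -/
theorem IsFix.push_eq {y : W} {x : V} (hx : x ∈ 𝒱 1) (h : IsFix 𝒱 FV q f g K y (K x) x) :
    push (inducedFiltration FV f) (transferG 𝒱 q f g K) x = y ∧
      ∀ M, K (expSum q 1 x M) ∈ FV M := by
  rw [isFix_iff hc hq] at h
  have h1 : ∀ M, f (y - expSum (transferG 𝒱 q f g K) 1 x M) ∈ FV M := by
    intro M
    rcases Nat.eq_zero_or_pos M with rfl | hM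
    · rw [hc.completeGraded.zero]; trivial
    · have := hc.fg_continuous _ _ (h M hM)
      rwa [map_add, hc.g_K_apply, zero_add, hc.g_f_apply] at this
  constructor
  · refine (isCompleteGraded_inducedFiltration hc).eq_of_modEq fun M => ?_
    exact ((exists_push_transferG hc hq hx).2 M).symm.trans (SModEq.sub_mem.2 (h1 M)).symm
  · intro M
    rcases Nat.eq_zero_or_pos M with rfl | hM
    · rw [hc.completeGraded.zero]; trivial
    · exact (Submodule.add_mem_iff_left _ (h1 M)).1 (h M hM)

/-- The curvature `c` of `x` satisfies `G'_x(c) = R(G(x))`. -/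
theorem der₁_transferG_curvature {x : V} (hx : x ∈ 𝒱 1) {M : ℕ} (hM : 1 ≤ M) :
    der₁ (transferG 𝒱 q f g K) M x (expSum q 1 x M) ≡ expSum (transferR 𝒲 q dW f g K) 1
      (push (inducedFiltration FV f) (transferG 𝒱 q f g K) x) M
      [SMOD inducedFiltration FV f M] := by
  have hF := antitone_inducedFiltration hc hq
  have h1 := expSum_coder hc.completeGraded.one hF (fun n _ => isSym_transferG (q := q) hc n)
    (fun n _ => isCont_transferG hc hq n) hq.hasDeg hq.isCont (mem_desusp_zero.2 hx) M
  have h2 := expSum_coder_transferG hc hq hx hM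
  have h3 := expSum_sub_mem (inducedFiltration_one hc) hF
    (fun n (_ : n ≥ 1) => isCont_transferR hc hq n) hM
    (SModEq.sub_mem.1 ((exists_push_transferG hc hq hx).2 M)) le_rfl M
  rw [Nat.sub_self, zero_add] at h3
  exact (h1.symm.trans h2).trans (SModEq.sub_mem.2 h3)

/-- R(G(x)) = G'_x(Q(x)), and a derivative in a vanishing direction vanishes. -/
theorem push_mem_MC {x : V} (hx : x ∈ MC 𝒱 FV q) :
    push (inducedFiltration FV f) (transferG 𝒱 q f g K) x ∈
      MC 𝒲 (inducedFiltration FV f) (transferR 𝒲 q dW f g K) := by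
  have hW := isCompleteGraded_inducedFiltration hc
  refine (mem_MC_iff hW.one hW (fun n _ => hasDeg_transferR hc hq n)
    (fun n _ => isCont_transferR hc hq n) (exists_push_transferG hc hq hx.1).1).2 fun M => ?_
  rcases Nat.eq_zero_or_pos M with rfl | hM
  · rw [hW.zero]; trivial
  have h := (mem_MC_iff hc.completeGraded.one hc.completeGraded hq.hasDeg hq.isCont hx.1).1 hx M
  exact SModEq.zero.1 ((der₁_transferG_curvature hc hq hx.1 hM).symm.trans (SModEq.zero.2
    (der₁_mem hc.completeGraded.one hW.antitone (fun n _ => isCont_transferG hc hq n) M x hM h)))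

/-- A fixed point over a Maurer-Cartan element is a Maurer-Cartan element. -/
theorem IsFix.mem_MC {y : W} (hy : y ∈ MC 𝒲 (inducedFiltration FV f) (transferR 𝒲 q dW f g K))
    {x : V} (hx : x ∈ 𝒱 1) (h : IsFix 𝒱 FV q f g K y (K x) x) : x ∈ MC 𝒱 FV q := by
  have hV := hc.completeGraded
  have hW := isCompleteGraded_inducedFiltration hc
  have hγ : ∀ n ≥ 1, IsCont FV (inducedFiltration FV f) (transferG 𝒱 q f g K n) :=
    fun n _ => isCont_transferG hc hq n
  obtain ⟨hGx, hKc⟩ := h.push_eq hc hq hx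
  obtain ⟨c, -, hcM⟩ := exists_expSum_modEq hV.one hV hq.hasDeg hq.isCont hx le_rfl
  have hKc0 : K c = 0 := hV.eq_zero fun M => by
    have h1 := hc.K_continuous _ _ (SModEq.sub_mem.1 (hcM M))
    rw [map_sub] at h1
    exact (Submodule.sub_mem_iff_right _ (hKc M)).1 h1
  have hR := (mem_MC_iff hW.one hW (fun n _ => hasDeg_transferR hc hq n)
    (fun n _ => isCont_transferR hc hq n) hy.1).1 hy
  have hγc : ∀ M ≥ 1, der₁ (transferG 𝒱 q f g K) M x c ∈ inducedFiltration FV f M := by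
    intro M hM
    have h1 := der₁_transferG_curvature hc hq hx hM
    rw [hGx] at h1
    have h2 := SModEq.zero.1 (h1.trans (SModEq.zero.2 (hR M)))
    have h3 := der₁_mem hV.one hW.antitone hγ M x hM (SModEq.sub_mem.1 (hcM M))
    rw [map_sub] at h3
    exact (Submodule.sub_mem_iff_right _ h2).1 h3
  -- The Bianchi identity Q'_x(Q(x)) = 0, a consequence of Q² = 0.
  have hqc : ∀ M ≥ 1, der₁ q M x c ∈ FV M := by
    intro M hM
    have h1 := expSum_coder hV.one hV.antitone hq.isSym hq.isCont hq.hasDeg hq.isCont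
      (mem_desusp_zero.2 hx) M
    have h2 : expSum (coder 𝒱 q q) 1 x M = 0 := by simp [expSum, hq.coder_eq_zero]
    rw [h2] at h1
    have h3 := der₁_mem hV.one hV.antitone hq.isCont M x hM (SModEq.sub_mem.1 (hcM M))
    rw [map_sub] at h3
    exact (Submodule.sub_mem_iff_right _ (SModEq.zero.1 h1.symm)).1 h3
  -- If c lies in `FV p`, the terms of order at least two in Q'_x(c) and G'_x(c) lie one step
  -- deeper, so q_1 c and g c do as well. As K c = 0, the homotopy relation rebuilds c from them.
  -- The step from 1 needs p ≥ 1, so p = 0 is settled by `FV 1` being everything.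
  have key : ∀ p, c ∈ FV p := by
    intro p
    induction p with
    | zero => rw [hV.zero]; trivial
    | succ p ih =>
      rcases Nat.eq_zero_or_pos p with rfl | hp
      · simp [hV.one]
      have hM : 1 ≤ p + 1 := by omega
      have h1 : g c ∈ inducedFiltration FV f (p + 1) := by
        have h2 := hγc (p + 1) hM
        rw [der₁_apply, ← Finset.add_sum_Ioc_eq_sum_Icc hM, term₁_one, linearPart_transferG] at h2
        refine (Submodule.add_mem_iff_left _ (Submodule.sum_mem _ fun n hn => ?_)).1 h2
        have h3 := (Finset.mem_Ioc.1 hn).1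
        exact hW.antitone (by omega) (term₁_mem hV.one hγ x (by omega) hp ih)
      have h2 : linearPart q c ∈ FV (p + 1) := by
        have h2 := hqc (p + 1) hM
        rw [der₁_apply, ← Finset.add_sum_Ioc_eq_sum_Icc hM, term₁_one] at h2
        refine (Submodule.add_mem_iff_left _ (Submodule.sum_mem _ fun n hn => ?_)).1 h2
        have h3 := (Finset.mem_Ioc.1 hn).1
        exact hV.antitone (by omega) (term₁_mem hV.one hq.isCont x (by omega) hp ih)
      have h3 := hc.homotopy_apply c
      rw [hKc0, map_zero, add_zero] at h3
      rw [show c = f (g c) - K (linearPart q c) by rw [h3]; abel]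
      exact Submodule.sub_mem _ h1 (hc.K_continuous _ _ h2)
  rw [mem_MC_iff hV.one hV hq.hasDeg hq.isCont hx]
  exact fun M => SModEq.zero.1 ((hcM M).trans (SModEq.zero.2 (key M)))

/-- `F(y)` solves the fixed point equation for `(y, 0)`. -/
theorem push_transferF {y : W} (hy : y ∈ 𝒲 1) :
    push FV (transferF 𝒲 q f K) y ∈ 𝒱 1 ∧ K (push FV (transferF 𝒲 q f K) y) = 0 ∧
      IsFix 𝒱 FV q f g K y 0 (push FV (transferF 𝒲 q f K) y) := by
  have hV := hc.completeGraded
  obtain ⟨x, hx, h⟩ := exists_expSum_modEq (inducedFiltration_one hc) hV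
    (fun n _ => hasDeg_transferF hc hq n) (fun n _ => isCont_transferF hc hq n) hy le_rfl
  rw [push, limit_eq_of_modEq hV h]
  have hK : K x = 0 := by
    refine hV.eq_zero fun M => ?_
    rcases Nat.eq_zero_or_pos M with rfl | hM
    · rw [hV.zero]; trivial
    have h1 := hc.K_continuous _ _ (SModEq.sub_mem.1 (h M))
    rw [map_sub, expSum_transferF y hM, map_add, hc.K_f_apply, hc.K_K_apply, add_zero,
      zero_sub] at h1
    exact (Submodule.neg_mem_iff _).1 h1
  have hx1 : x ∈ 𝒱 1 := by simpa using hx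
  refine ⟨hx1, hK, fun M => ?_⟩
  rcases Nat.eq_zero_or_pos M with rfl | hM
  · rw [hV.zero]; exact SModEq.top
  rw [map_zero, sub_zero, expSum_recTaylor]
  -- Since K kills the point, only the K q_i part of the recursion remains, and that is the defining
  -- series of F.
  have h1 := expSum_transferG_of_K hc hq hx1 hM hM (by rw [hK]; exact zero_mem _)
  rw [SModEq.sub_mem, expSum_one_eq _ _ hM, linearPart_transferG, add_sub_cancel_left] at h1
  have h2 := expSum_sub_mem hV.one hV.antitone hq.isCont hM (SModEq.sub_mem.1 (h M)) (a := 2)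
    (by omega) M
  have h3 := (expSum_transferPre hc hq hy M).trans
    (SModEq.sub_mem.2 (hV.antitone (by omega) h2))
  have h4 := h M
  rw [expSum_transferF y hM] at h4
  refine h4.symm.trans (SModEq.rfl.add ?_)
  rw [SModEq.sub_mem, sub_sub_eq_add_sub, add_sub_right_comm, ← map_sub]
  exact Submodule.add_mem _ (hc.K_continuous _ _ (SModEq.sub_mem.1 h3)) h1

end Kuranishi

end LInfty

/-! ### The formal Kuranishi theorem -/

open LInfty in
theorem theorem1p6 {𝕜 : Type*} [Field 𝕜] [CharZero 𝕜]
    {V : Type*} [AddCommGroup V] [Module 𝕜 V] {W : Type*} [AddCommGroup W] [Module 𝕜 W]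
    (𝒱 : ℤ → Submodule 𝕜 V) [DirectSum.Decomposition 𝒱]
    (𝒲 : ℤ → Submodule 𝕜 W) [DirectSum.Decomposition 𝒲]
    (FV : ℕ → Submodule 𝕜 V) (q : Taylor 𝕜 V V) (hq : IsCompleteLInfty 𝒱 FV q)
    (dW : W →ₗ[𝕜] W) (f : W →ₗ[𝕜] V) (g : V →ₗ[𝕜] W) (K : V →ₗ[𝕜] V)
    (hc : IsCompleteContraction 𝒱 FV (linearPart q) 𝒲 dW f g K) :
    let FW : ℕ → Submodule 𝕜 W := inducedFiltration FV f
    let R : Taylor 𝕜 W W := transferR 𝒲 q dW f g K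
    let F : Taylor 𝕜 W V := transferF 𝒲 q f K
    let G : Taylor 𝕜 V W := transferG 𝒱 q f g K
    let ρ : V → W × V := fun x => (push FW G x, K x)
    let ρinv : W × V → V := fun p => limit FV (recSeq 𝒱 FV q f g K p.1 p.2)
    -- the series defining curvatures, push-forwards and the recursion converge
    (∀ x ∈ 𝒱 1, (∃ c ∈ 𝒱 2, ConvergesTo FV (expSum q 1 x) c) ∧
      (∃ c ∈ 𝒲 1, ConvergesTo FW (expSum G 1 x) c) ∧
      ∃ c ∈ 𝒱 1, ConvergesTo FV (expSum (recTaylor 𝒱 q f g K) 2 x) c) ∧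
    (∀ y ∈ 𝒲 1, (∃ c ∈ 𝒲 2, ConvergesTo FW (expSum R 1 y) c) ∧
      ∃ c ∈ 𝒱 1, ConvergesTo FV (expSum F 1 y) c) ∧
    -- `ρ` is a bijection
    Set.BijOn ρ (MC 𝒱 FV q) (MC 𝒲 FW R ×ˢ (K '' (𝒱 1 : Set V))) ∧
    -- the recursion stays in `V^1`, converges in `V^1`, and its limit is `ρ⁻¹(y, K v)`
    (∀ y ∈ MC 𝒲 FW R, ∀ v ∈ 𝒱 1,
      (∀ n, recSeq 𝒱 FV q f g K y (K v) n ∈ 𝒱 1) ∧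
      ∃ x ∈ 𝒱 1, ConvergesTo FV (recSeq 𝒱 FV q f g K y (K v)) x) ∧
    Set.InvOn ρinv ρ (MC 𝒱 FV q) (MC 𝒲 FW R ×ˢ (K '' (𝒱 1 : Set V))) ∧
    -- `ρ⁻¹(-, 0) = MC(F)` is a bijection onto `MC(V) ∩ Ker K`, with inverse `g`
    (∀ y ∈ MC 𝒲 FW R, ρinv (y, 0) = push FV F y) ∧
    Set.BijOn (push FV F) (MC 𝒲 FW R) (MC 𝒱 FV q ∩ {x | K x = 0}) ∧
    Set.InvOn g (push FV F) (MC 𝒲 FW R) (MC 𝒱 FV q ∩ {x | K x = 0}) := by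

  intro FW R F G ρ ρinv
  have hV := hc.completeGraded
  have hW : IsCompleteGraded 𝒲 FW := isCompleteGraded_inducedFiltration hc
  have hseq : ∀ y ∈ 𝒲 1, ∀ v ∈ 𝒱 1, ρinv (y, K v) ∈ 𝒱 1 ∧
      ConvergesTo FV (recSeq 𝒱 FV q f g K y (K v)) (ρinv (y, K v)) ∧
      IsFix 𝒱 FV q f g K y (K v) (ρinv (y, K v)) := by
    intro y hy v hv
    obtain ⟨x, hx, h1, h2⟩ := exists_recSeq_modEq hc hq hy (hc.K_degree _ _ hv)
    rw [show ρinv (y, K v) = x from limit_eq_of_modEq hV h1]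
    exact ⟨hx, convergesTo_of_modEq hV.antitone h1, h2⟩
  have hρ : Set.MapsTo ρ (MC 𝒱 FV q) (MC 𝒲 FW R ×ˢ (K '' (𝒱 1 : Set V))) := fun x hx =>
    ⟨push_mem_MC hc hq hx, x, hx.1, rfl⟩
  have hρinv : Set.MapsTo ρinv (MC 𝒲 FW R ×ˢ (K '' (𝒱 1 : Set V))) (MC 𝒱 FV q) := by
    rintro ⟨y, -⟩ ⟨hy, v, hv, rfl⟩
    obtain ⟨hx, -, h⟩ := hseq y hy.1 v hv
    generalize ρinv (y, K v) = x at hx h ⊢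
    rw [← h.K_eq hc hq] at h
    exact h.mem_MC hc hq hy hx
  -- On one side uniqueness identifies x with the limit of the recursion for its own data; on the
  -- other, the fixed point equation returns both components of the data.
  have hinv : Set.InvOn ρinv ρ (MC 𝒱 FV q) (MC 𝒲 FW R ×ˢ (K '' (𝒱 1 : Set V))) := by
    constructor
    · intro x hx
      exact (hseq _ (hρ hx).1.1 x hx.1).2.2.unique hc hq (isFix_of_mem_MC hc hq hx)
    · rintro ⟨y, -⟩ ⟨hy, v, hv, rfl⟩
      obtain ⟨hx, -, h⟩ := hseq y hy.1 v hv
      generalize ρinv (y, K v) = x at hx h ⊢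
      have hK := h.K_eq hc hq
      rw [← hK] at h
      exact Prod.ext (h.push_eq hc hq hx).1 hK
  have hinv' : Set.InvOn g (push FV F) (MC 𝒲 FW R) (MC 𝒱 FV q ∩ {x | K x = 0}) := by
    constructor
    · intro y hy
      obtain ⟨hx, hK, h⟩ := push_transferF hc hq hy.1
      rw [← g_eq_push hc hq hx hK]
      rw [← hK] at h
      exact (h.push_eq hc hq hx).1
    · rintro x ⟨hx, hK⟩
      have hK : K x = 0 := hK
      have h := isFix_of_mem_MC hc hq hx
      rw [g_eq_push hc hq hx.1 hK, hK] at h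
      exact (push_transferF hc hq (hc.g_degree _ _ hx.1)).2.2.unique hc hq h
  refine ⟨fun x hx => ⟨?_, ?_, ?_⟩, fun y hy => ⟨?_, ?_⟩, hinv.bijOn hρ hρinv, ?_, hinv, ?_,
    hinv'.bijOn ?_ ?_, hinv'⟩
  · obtain ⟨c, h, h1⟩ := exists_expSum_modEq hV.one hV hq.hasDeg hq.isCont hx le_rfl
    exact ⟨c, h, convergesTo_of_modEq hV.antitone h1⟩
  · obtain ⟨h, h1⟩ := exists_push_transferG hc hq hx
    exact ⟨_, h, convergesTo_of_modEq hW.antitone h1⟩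
  · obtain ⟨c, h, h1⟩ := exists_expSum_modEq hV.one hV (hasDeg_recTaylor hc hq)
      (isCont_recTaylor hc hq) hx (a := 2) (by omega)
    exact ⟨c, by simpa using h, convergesTo_of_modEq hV.antitone h1⟩
  · obtain ⟨c, h, h1⟩ := exists_expSum_modEq hW.one hW (fun n _ => hasDeg_transferR hc hq n)
      (fun n _ => isCont_transferR hc hq n) hy le_rfl
    exact ⟨c, h, convergesTo_of_modEq hW.antitone h1⟩
  · obtain ⟨c, h, h1⟩ := exists_expSum_modEq hW.one hV (fun n _ => hasDeg_transferF hc hq n)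
      (fun n _ => isCont_transferF hc hq n) hy le_rfl
    exact ⟨c, by simpa using h, convergesTo_of_modEq hV.antitone h1⟩
  · intro y hy v hv
    obtain ⟨hx, h, -⟩ := hseq y hy.1 v hv
    exact ⟨recSeq_mem hc hq hy.1 (hc.K_degree _ _ hv), _, hx, h⟩
  · intro y hy
    -- The value 0 enters the recursion as K 0.
    have h := (hseq y hy.1 0 (zero_mem _)).2.2
    rw [map_zero] at h
    exact h.unique hc hq (push_transferF hc hq hy.1).2.2
  · intro y hy
    obtain ⟨hx, hK, h⟩ := push_transferF hc hq hy.1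
    rw [← hK] at h
    exact ⟨h.mem_MC hc hq hy hx, hK⟩
  · rintro x ⟨hx, hK⟩
    rw [← g_eq_push hc hq hx.1 hK]
    exact push_mem_MC hc hq hx
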